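/- Setting. Points of $\mathbb{R}^{1+3}$ are $(t,x)$, with $r=|x|$, $\omega=x/|x|\in\mathbb{S}^2$, $\partial_0=\partial_t$, $\partial_i=\partial_{x_i}$ ($i=1,2,3$), and repeated Greek indices are summed over $0,1,2,3$. Let $\widetilde g^{\alpha\beta}=\widetilde g^{\beta\alpha}\in C^\infty(\mathbb{R})$ with $\widetilde g^{\alpha\beta}(0)\partial_\alpha\partial_\beta=\partial_t^2-\Delta_x$, and put $G(\omega)=\frac{d}{du}\widetilde g^{\alpha\beta}(0)\,\widehat\omega_\alpha\widehat\omega_\beta$, $\widehat\omega=(-1,\omega)$. Let $R\ge 1$ and let $A\in C_c^\infty(\mathbb{R}\times\mathbb{S}^2)$ be supported in $[-R,R]\times\mathbb{S}^2$. Define $$\mu(s,q,\omega)=-2\exp\big(\tfrac12 G(\omega)A(q,\omega)s\big),\qquad U(s,q,\omega)=\int_{-\infty}^q A(p,\omega)\exp\big(-\tfrac12 G(\omega)A(p,\omega)s\big)\,dp .$$ For $\varepsilon>0$ and $0<\delta<1$ let $q=q(t,r,\omega)$ ($t>0$, $r\ge 0$) be the solution of $$(\partial_t-\partial_r)q=\mu(\varepsilon\ln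 t-\delta,q,\omega),\qquad q(t,0,\omega)=-t .$$ For $T\geq 1$ let $\eta\in C^\infty(\mathbb{R})$ with $\eta=1$ on $[2T,\infty)$ and $\eta=0$ on $(-\infty,T]$, let $\psi\in C_c^\infty(\mathbb{R})$ with $\psi=1$ on $[3/4,5/4]$ and $\psi=0$ outside $[1/2,3/2]$, and set $$u_{app}(t,x)=\varepsilon r^{-1}\eta(t)\psi(r/t)\,U(\varepsilon\ln t-\delta,\,q(t,r,\omega),\,\omega).$$ Let $Z$ range over $\partial_\alpha$, $t\partial_t+r\partial_r$, $x_j\partial_i-x_i\partial_j$, $x_i\partial_t+t\partial_i$, and let $Z^I$ denote a product of $|I|$ of these fields. Proposition. There are $T_0\ge1$ and $\varepsilon_0>0$, depending only on $\widetilde g$, $A$ and $R$, such that for all $0<\varepsilon<\varepsilon_0$ and $0<\delta<1$ the function $q$ exists, is unique (among solutions continuous in $(t,r)$ up to $r=0$), and is smooth as a function of $(t,x)$ on $\{t>0,\ x\ne0\}$. Moreover, for every $T\ge T_0$ and all $\eta,\psi$ as above, $u_{app}$ is smooth on $\mathbb{R}^{1+3}$ and there are constants $C,K,C'$ and, for every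 $I$, constants $K_I,C_I$, all independent of $\varepsilon\in(0,\varepsilon_0)$, of $\delta\in(0,1)$ and of the point, such that: 1. $|\partial_\alpha u_{app}(t,x)|\le C\varepsilon(1+t)^{-1}$ for all $\alpha$ and all $(t,x)$ with $t\ge T$; 2. for every multi-index $I$ and all $(t,x)$ with $t\ge0$, $$|Z^Iu_{app}(t,x)|\le K_I\,\varepsilon(1+t)^{-1+C_I\varepsilon},\qquad \big|Z^I\big(\widetilde g^{\alpha\beta}(u_{app})\partial_\alpha\partial_\beta u_{app}\big)(t,x)\big|\le K_I\,\varepsilon(1+t)^{-3+C_I\varepsilon};$$ 3. $q$ is an approximate optical function near the light cone: for all $(t,x)$ with $t\ge T$ and $|q(t,r,\omega)|\le R$, $$\big|\widetilde g^{\alpha\beta}(\varepsilon r^{-1}U)\,\partial_\alpha q\,\partial_\beta q\big|\le K\,t^{-2+C'\varepsilon},\qquad U=U(\varepsilon\ln t-\delta,q(t,r,\omega),\omega).$$ -/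

import Mathlib

open scoped ContDiff Manifold

noncomputable section

namespace QuasilinearWave

/-- Physical space `ℝ³` with the Euclidean norm. -/
abbrev Space := EuclideanSpace ℝ (Fin 3)

/-- Spacetime `ℝ_t × ℝ³_x`; a point is `p = (t, x)`. -/
abbrev Spacetime := ℝ × Space

/-- The unit sphere `𝕊²`. -/
abbrev Sphere2 := Metric.sphere (0 : Space) 1

/-! ### Derivatives and commuting vector fields -/

/-- The coordinate directions: `0` is time, `1, 2, 3` are the spatial directions. -/
def coordDir : Fin 4 → Spacetime :=
  Fin.cons ((1 : ℝ), (0 : Space)) (fun i : Fin 3 => ((0 : ℝ), EuclideanSpace.single i (1 : ℝ)))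

/-- The partial derivative `∂_α φ`, with `∂_0 = ∂_t` and `∂_i = ∂_{x_i}`. -/
def pd (α : Fin 4) (φ : Spacetime → ℝ) : Spacetime → ℝ :=
  fun p => fderiv ℝ φ p (coordDir α)

/-- Labels of the commuting vector fields. -/
inductive VField
  | translation (α : Fin 4)
  | scaling
  | rotation (i j : Fin 3)
  | boost (i : Fin 3)

/-- The action of the commuting vector fields
`∂_α`, `S = t ∂_t + r ∂_r = t ∂_t + ∑ x_i ∂_i`, `Ω_{ij} = x_j ∂_i - x_i ∂_j`,
`Ω_{0i} = x_i ∂_t + t ∂_i`. -/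
def VField.act : VField → (Spacetime → ℝ) → Spacetime → ℝ
  | .translation α, φ => pd α φ
  | .scaling, φ => fun p => p.1 * pd 0 φ p + ∑ i : Fin 3, p.2 i * pd i.succ φ p
  | .rotation i j, φ => fun p => p.2 j * pd i.succ φ p - p.2 i * pd j.succ φ p
  | .boost i, φ => fun p => p.2 i * pd 0 φ p + p.1 * pd i.succ φ p

/-- `Z^I φ`: the product of the `|I|` vector fields listed in `I`, applied to `φ`. -/
def Zpow (I : List VField) (φ : Spacetime → ℝ) : Spacetime → ℝ :=
  I.foldr VField.act φ

/-! ### The quasilinear operator -/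

/-- The coefficients of `□ = ∂_t² - Δ_x`, i.e. `diag(1, -1, -1, -1)`. -/
def boxCoeff (α β : Fin 4) : ℝ :=
  if α = β then (if α = 0 then 1 else -1) else 0

/-- The coefficients `g^{αβ}(u)`: smooth and symmetric, with `g^{αβ}(0) ∂_α ∂_β = □`. -/
structure IsWaveMetric (g : Fin 4 → Fin 4 → ℝ → ℝ) : Prop where
  smooth : ∀ α β, ContDiff ℝ ∞ (g α β)
  symm : ∀ α β, g α β = g β α
  at_zero : ∀ α β, g α β 0 = boxCoeff α β

/-- The function `g^{αβ}(u) ∂_α ∂_β u`. -/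
def waveOp (g : Fin 4 → Fin 4 → ℝ → ℝ) (u : Spacetime → ℝ) : Spacetime → ℝ :=
  fun p => ∑ α, ∑ β, g α β (u p) * pd α (pd β u) p

/-- The covector `(-1, ω)`. -/
def omegaHat (θ : Sphere2) : Fin 4 → ℝ :=
  Fin.cons (-1 : ℝ) (fun i : Fin 3 => (θ : Space) i)

/-- `G(ω) = (d/du g^{αβ})(0) ω̂_α ω̂_β` with `ω̂ = (-1, ω)`. -/
def G (g : Fin 4 → Fin 4 → ℝ → ℝ) (θ : Sphere2) : ℝ :=
  ∑ α, ∑ β, deriv (g α β) 0 * omegaHat θ α * omegaHat θ β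

/-! ### The explicit solution of the reduced system -/

/-- `μ(s, q, ω) = -2 exp(½ G(ω) A(q, ω) s)`. -/
def mu (g : Fin 4 → Fin 4 → ℝ → ℝ) (A : ℝ × Sphere2 → ℝ) (s q : ℝ) (θ : Sphere2) : ℝ :=
  -2 * Real.exp (1 / 2 * G g θ * A (q, θ) * s)

/-- `U(s, q, ω) = ∫_{-∞}^q A(p, ω) exp(-½ G(ω) A(p, ω) s) dp`. -/
def profile (g : Fin 4 → Fin 4 → ℝ → ℝ) (A : ℝ × Sphere2 → ℝ) (s q : ℝ) (θ : Sphere2) : ℝ :=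
  ∫ p in Set.Iic q, A (p, θ) * Real.exp (-(1 / 2) * G g θ * A (p, θ) * s)

/-- `q(t, r, ω)` solves `(∂_t - ∂_r) q = μ(ε ln t - δ, q, ω)`, `q(t, 0, ω) = -t`, for `t > 0` and
`r ≥ 0`. The derivative `∂_t - ∂_r` is the derivative along `σ ↦ (t + σ, r - σ)`. -/
structure IsOptical (g : Fin 4 → Fin 4 → ℝ → ℝ) (A : ℝ × Sphere2 → ℝ) (ε δ : ℝ)
    (q : ℝ → ℝ → Sphere2 → ℝ) : Prop where
  continuousOn : ∀ θ, ContinuousOn (fun y : ℝ × ℝ => q y.1 y.2 θ) {y | 0 < y.1 ∧ 0 ≤ y.2}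
  transport : ∀ t r θ, 0 < t → 0 < r →
    HasDerivAt (fun σ => q (t + σ) (r - σ) θ) (mu g A (ε * Real.log t - δ) (q t r θ) θ) 0
  boundary : ∀ t θ, 0 < t → q t 0 θ = -t

/-! ### The approximate solution -/

/-- The direction `ω = x / |x|` of `x ≠ 0` (an irrelevant fixed unit vector at `x = 0`). -/
def dir (x : Space) : Sphere2 :=
  open Classical in
  if h : x = 0 then ⟨EuclideanSpace.single 0 1, by simp⟩
  else ⟨‖x‖⁻¹ • x, by simp [norm_smul, inv_mul_cancel₀ (norm_ne_zero_iff.mpr h)]⟩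

/-- `q` as a function of `(t, x)`: `q(t, |x|, x / |x|)`. -/
def qCart (q : ℝ → ℝ → Sphere2 → ℝ) (p : Spacetime) : ℝ :=
  q p.1 ‖p.2‖ (dir p.2)

/-- `ε r⁻¹ U(ε ln t - δ, q(t, r, ω), ω)` as a function of `(t, x)`. -/
def farField (g : Fin 4 → Fin 4 → ℝ → ℝ) (A : ℝ × Sphere2 → ℝ) (ε δ : ℝ)
    (q : ℝ → ℝ → Sphere2 → ℝ) (p : Spacetime) : ℝ :=
  ε * ‖p.2‖⁻¹ * profile g A (ε * Real.log p.1 - δ) (qCart q p) (dir p.2)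

/-- The time cutoff: `η ∈ C^∞(ℝ)`, `η = 1` on `[2T, ∞)`, `η = 0` on `(-∞, T]`. -/
structure IsTimeCutoff (T : ℝ) (η : ℝ → ℝ) : Prop where
  smooth : ContDiff ℝ ∞ η
  eq_one : ∀ t, 2 * T ≤ t → η t = 1
  eq_zero : ∀ t, t ≤ T → η t = 0

/-- The cutoff to a cone around `r = t`: `ψ ∈ C_c^∞(ℝ)`, `ψ = 1` on `[3/4, 5/4]` and `ψ = 0`
outside `[1/2, 3/2]`. -/
structure IsConeCutoff (ψ : ℝ → ℝ) : Prop where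
  smooth : ContDiff ℝ ∞ ψ
  eq_one : ∀ z ∈ Set.Icc (3 / 4 : ℝ) (5 / 4), ψ z = 1
  eq_zero : ∀ z, z ∉ Set.Icc (1 / 2 : ℝ) (3 / 2) → ψ z = 0

/-- `u_app(t, x) = ε r⁻¹ η(t) ψ(r / t) U(ε ln t - δ, q(t, r, ω), ω)`, `r = |x|`, `ω = x / |x|`. -/
def uApp (g : Fin 4 → Fin 4 → ℝ → ℝ) (A : ℝ × Sphere2 → ℝ) (η ψ : ℝ → ℝ) (ε δ : ℝ)
    (q : ℝ → ℝ → Sphere2 → ℝ) (p : Spacetime) : ℝ :=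
  ε * ‖p.2‖⁻¹ * η p.1 * ψ (‖p.2‖ / p.1) *
    profile g A (ε * Real.log p.1 - δ) (qCart q p) (dir p.2)

end QuasilinearWave

end

noncomputable section

namespace QuasilinearWave

/-! ### A calculus of symbols along families of vector fields -/

/-! The optical function is treated ray by ray. On `t + r = v` the transport equation is a scalar
ODE in `t`, started from `q = -v` on the axis. Since `A` vanishes for `|q| > R`, going back in time
`q = v - 2t` until the time `e^m = (v + R)/2`, when `q = -R`. With `y = t - e^m`, the coordinates
`(y, m, ω)` turn `B = ∂_t - ∂_r` into `∂_y` and `L = ∂_t + ∂_r` into `e^{-m} ∂_m`, and `q` solves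
`∂_y q = μ` with `q = -R` at `y = 0`. The speed is at least `2 exp(-M(εm + 1))` in modulus, so `|q|
< R + 1` confines `y` to an interval of length `O(e^{Mεm})`, that is `t^{O(ε)}` (`flow_lower`,
`exists_near`).

All estimates are phrased as symbol estimates. A symbol of degree `k` is a family of functions,
indexed by `(ε, δ)`, which together with all derivatives along the frame is bounded by `K t^k
t^{Cε}`, with `K` and `C` uniform in the family; `C` may depend on the order of differentiation.
Symbols are stable under sums, products, composition, and solution of linear equations in `y`
(`Frame.Sym.comp`, `Frame.Sym.linear_ode`). Differentiating the equation of `q` gives linear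
equations with coefficient `∂_q μ`. Its integral in `y` would naively be a power of `t^ε`, with a
useless exponential; but `∂_q μ = (∂_q a) s μ` with `a = ½ G A`, and `μ dy = dq`, so the integral is
at most a constant times `|s| ≤ εm + 2`, and its exponential is again `t^{O(ε)}` (`speedP_hexp`).
Hence `q` is a symbol of degree zero (`optP_sym`), also for the commuting fields, because these
differentiate `(y, m, ω)` to symbols of degree zero.

The structural facts are `∂_q U · μ = -2A` and `L q = -¼ ε G U μ / r` up to degree `-2`
(`deficitP_sym`, `symbol_opL_q`). The second holds because both sides solve the same linear equation
in `y` up to a source of size `1/t`, with zero data at `q = -R`. In the null frame `L` and the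
angular derivatives gain a factor `1/t`, so that `□(U/r) = ½ ε G r⁻² (∂_q A) U μ` and `∂_α ∂_β (U/r)
= -½ ω̂_α ω̂_β r⁻¹ (∂_q A) μ`, up to degrees `-3` and `-2`. Multiplying the latter by the linear
Taylor term `ε (dg^{αβ}/du)(0) U/r` gives exactly the negative of the former, and the error has
degree `-3` (`symbol_waveOp`). The same formula for `L q` cancels the leading part of the eikonal
expression, leaving degree `-2` (`symbol_eikonal`).

Away from `|q| < R + 1` no cancellation is needed. For `q < -R` the profile vanishes; for `q > R` it
depends on `(s, ω)` only, so each derivative gains `1/t`. These regions overlap and cover the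
support of the cutoffs (`v_cover`). The first-derivative bound is free of the loss `t^{Cε}` because
`∂_α U = ω̂_α A + O(t^{-1 + Cε})` with `A` bounded (`symbol_pd_U`); making the error harmless fixes
one condition on `ε₀`, and this condition does not involve the cutoffs. -/

/-- Vector fields `X z`, open domains, a scale `ρ` and weights `W`, for a family of functions on `E` indexed by `ι`. -/
structure Frame (ι E : Type) [NormedAddCommGroup E] [NormedSpace ℝ E] where
  κ : Type
  X : κ → E → E
  dom : ι → Set E
  ρ : E → ℝ
  W : ι → E → ℝ
  X_smooth : ∀ z, ContDiff ℝ ∞ (X z)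
  isOpen : ∀ i, IsOpen (dom i)
  ρ_pos : ∀ i, ∀ p ∈ dom i, 0 < ρ p
  one_le_W : ∀ i, ∀ p ∈ dom i, 1 ≤ W i p

namespace Frame

variable {ι E : Type} [NormedAddCommGroup E] [NormedSpace ℝ E] (F : Frame ι E)

/-- The derivative of a family along the field `X z`. -/
def der (z : F.κ) (f : ι → E → ℝ) : ι → E → ℝ := fun i p => fderiv ℝ (f i) p (F.X z p)

/-- Bounds of degree `k`, up to powers of the weight. -/
def Bd (k : ℤ) (f : ι → E → ℝ) : Prop :=
  ∃ K : ℝ, 0 ≤ K ∧ ∃ C : ℕ, ∀ i, ∀ p ∈ F.dom i, |f i p| ≤ K * F.ρ p ^ k * F.W i p ^ C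

/-- Smoothness on the domains. -/
def Smooth (f : ι → E → ℝ) : Prop := ∀ i, ContDiffOn ℝ ∞ (f i) (F.dom i)

/-- Symbols of degree `k`, tested with at most `n` derivatives. -/
def Sym : ℕ → ℤ → (ι → E → ℝ) → Prop
  | 0, k, f => F.Smooth f ∧ F.Bd k f
  | n + 1, k, f => F.Smooth f ∧ F.Bd k f ∧ ∀ z, Sym n k (F.der z f)

variable {F}

theorem Smooth.der {f : ι → E → ℝ} (hf : F.Smooth f) (z : F.κ) : F.Smooth (F.der z f) := fun i =>
  ((hf i).fderiv_of_isOpen (F.isOpen i) (by simp)).clm_apply (F.X_smooth z).contDiffOn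

theorem Smooth.differentiableAt {f : ι → E → ℝ} (hf : F.Smooth f) {i : ι} {p : E}
    (hp : p ∈ F.dom i) : DifferentiableAt ℝ (f i) p :=
  ((hf i).contDiffAt ((F.isOpen i).mem_nhds hp)).differentiableAt (by simp)

theorem Sym.smooth {n : ℕ} {k : ℤ} {f : ι → E → ℝ} (h : F.Sym n k f) : F.Smooth f := by
  cases n <;> exact h.1

theorem Sym.bd {n : ℕ} {k : ℤ} {f : ι → E → ℝ} (h : F.Sym n k f) : F.Bd k f := by
  cases n
  · exact h.2
  · exact h.2.1

theorem Sym.der {n : ℕ} {k : ℤ} {f : ι → E → ℝ} (h : F.Sym (n + 1) k f) (z : F.κ) :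
    F.Sym n k (F.der z f) := h.2.2 z

theorem Sym.pred {n : ℕ} {k : ℤ} {f : ι → E → ℝ} (h : F.Sym (n + 1) k f) : F.Sym n k f := by
  induction n generalizing f with
  | zero => exact ⟨h.1, h.2.1⟩
  | succ n ih => exact ⟨h.1, h.2.1, fun z => ih (h.2.2 z)⟩

theorem Sym.of_le {m n : ℕ} {k : ℤ} {f : ι → E → ℝ} (h : F.Sym n k f) (hmn : m ≤ n) :
    F.Sym m k f := by
  induction n with
  | zero => obtain rfl : m = 0 := by omega
            exact h
  | succ n ih =>
    rcases hmn.eq_or_lt with rfl | hlt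
    · exact h
    · exact ih h.pred (by omega)

theorem Bd.congr {k : ℤ} {f g : ι → E → ℝ} (h : F.Bd k f)
    (hfg : ∀ i, ∀ p ∈ F.dom i, g i p = f i p) : F.Bd k g := by
  obtain ⟨K, hK, C, H⟩ := h
  exact ⟨K, hK, C, fun i p hp => by rw [hfg i p hp]; exact H i p hp⟩

theorem der_congr {f g : ι → E → ℝ} (hfg : ∀ i, ∀ p ∈ F.dom i, g i p = f i p) (z : F.κ) :
    ∀ i, ∀ p ∈ F.dom i, F.der z g i p = F.der z f i p := fun i p hp => by
  have : g i =ᶠ[nhds p] f i := Filter.eventually_of_mem ((F.isOpen i).mem_nhds hp) (hfg i)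
  simp only [Frame.der, this.fderiv_eq]

theorem Sym.congr {n : ℕ} {k : ℤ} {f g : ι → E → ℝ} (h : F.Sym n k f)
    (hfg : ∀ i, ∀ p ∈ F.dom i, g i p = f i p) : F.Sym n k g := by
  induction n generalizing f g with
  | zero => exact ⟨fun i => (h.1 i).congr (hfg i), h.2.congr hfg⟩
  | succ n ih =>
    exact ⟨fun i => (h.1 i).congr (hfg i), h.2.1.congr hfg,
      fun z => ih (h.2.2 z) (der_congr hfg z)⟩

theorem Sym.congr_deg {n : ℕ} {k l : ℤ} {f : ι → E → ℝ} (h : F.Sym n k f) (hkl : k = l) :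
    F.Sym n l f := hkl ▸ h

theorem Sym.zpow_nonneg (F : Frame ι E) {i : ι} {p : E} (hp : p ∈ F.dom i) (k : ℤ) :
    0 < F.ρ p ^ k := zpow_pos (F.ρ_pos i p hp) k

theorem W_pow_pos (F : Frame ι E) {i : ι} {p : E} (hp : p ∈ F.dom i) (C : ℕ) :
    0 < F.W i p ^ C := pow_pos (zero_lt_one.trans_le (F.one_le_W i p hp)) C

theorem Bd.add {k : ℤ} {f g : ι → E → ℝ} (hf : F.Bd k f) (hg : F.Bd k g) :
    F.Bd k (fun i p => f i p + g i p) := by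
  obtain ⟨K, hK, C, H⟩ := hf
  obtain ⟨K', hK', C', H'⟩ := hg
  refine ⟨K + K', add_nonneg hK hK', max C C', fun i p hp => ?_⟩
  have h0 := (Sym.zpow_nonneg F hp k).le
  calc |f i p + g i p| ≤ |f i p| + |g i p| := abs_add_le _ _
    _ ≤ K * F.ρ p ^ k * F.W i p ^ C + K' * F.ρ p ^ k * F.W i p ^ C' :=
        add_le_add (H i p hp) (H' i p hp)
    _ ≤ K * F.ρ p ^ k * F.W i p ^ max C C' + K' * F.ρ p ^ k * F.W i p ^ max C C' := by
        gcongr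
        · exact F.one_le_W i p hp
        · exact le_max_left _ _
        · exact F.one_le_W i p hp
        · exact le_max_right _ _
    _ = _ := by ring

theorem Bd.mul {k l : ℤ} {f g : ι → E → ℝ} (hf : F.Bd k f) (hg : F.Bd l g) :
    F.Bd (k + l) (fun i p => f i p * g i p) := by
  obtain ⟨K, hK, C, H⟩ := hf
  obtain ⟨K', hK', C', H'⟩ := hg
  refine ⟨K * K', mul_nonneg hK hK', C + C', fun i p hp => ?_⟩
  rw [abs_mul, zpow_add₀ (F.ρ_pos i p hp).ne', pow_add]
  refine (mul_le_mul (H i p hp) (H' i p hp) (abs_nonneg _) ?_).trans_eq (by ring)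
  have := (Sym.zpow_nonneg F hp k).le
  have := (F.W_pow_pos hp C).le
  positivity

theorem Bd.const {c : ι → ℝ} {M : ℝ} (hc : ∀ i, |c i| ≤ M) : F.Bd 0 (fun i _ => c i) := by
  refine ⟨|M|, abs_nonneg _, 0, fun i p _ => ?_⟩
  simpa using (hc i).trans (le_abs_self M)

theorem Sym.add {n : ℕ} {k : ℤ} {f g : ι → E → ℝ} (hf : F.Sym n k f) (hg : F.Sym n k g) :
    F.Sym n k (fun i p => f i p + g i p) := by
  induction n generalizing f g with
  | zero => exact ⟨fun i => (hf.1 i).add (hg.1 i), hf.2.add hg.2⟩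
  | succ n ih =>
    refine ⟨fun i => (hf.1 i).add (hg.1 i), hf.2.1.add hg.2.1, fun z => ?_⟩
    refine (ih (hf.2.2 z) (hg.2.2 z)).congr fun i p hp => ?_
    simp only [Frame.der]
    rw [fderiv_fun_add (hf.1.differentiableAt hp) (hg.1.differentiableAt hp)]
    simp

theorem Sym.mul {n : ℕ} {k l : ℤ} {f g : ι → E → ℝ} (hf : F.Sym n k f) (hg : F.Sym n l g) :
    F.Sym n (k + l) (fun i p => f i p * g i p) := by
  induction n generalizing f g with
  | zero => exact ⟨fun i => (hf.1 i).mul (hg.1 i), hf.2.mul hg.2⟩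
  | succ n ih =>
    refine ⟨fun i => (hf.1 i).mul (hg.1 i), hf.2.1.mul hg.2.1, fun z => ?_⟩
    refine ((ih hf.pred (hg.2.2 z)).add (ih (hf.2.2 z) hg.pred)).congr fun i p hp => ?_
    simp only [Frame.der]
    rw [fderiv_fun_mul (hf.1.differentiableAt hp) (hg.1.differentiableAt hp)]
    simp [smul_eq_mul]
    ring

theorem Sym.mul' {n : ℕ} {k l m : ℤ} {f g : ι → E → ℝ} (hf : F.Sym n k f) (hg : F.Sym n l g)
    (h : k + l = m) : F.Sym n m (fun i p => f i p * g i p) := (hf.mul hg).congr_deg h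

theorem Sym.const {c : ι → ℝ} {M : ℝ} (hc : ∀ i, |c i| ≤ M) (n : ℕ) :
    F.Sym n 0 (fun i _ => c i) := by
  have zero : ∀ n, F.Sym n 0 (fun _ _ => 0) := by
    intro n
    induction n with
    | zero => exact ⟨fun i => contDiffOn_const, Bd.const (M := 0) (by simp)⟩
    | succ n ih =>
      refine ⟨fun i => contDiffOn_const, Bd.const (M := 0) (by simp), fun z => ih.congr ?_⟩
      intro i p _
      simp [Frame.der]
  cases n with
  | zero => exact ⟨fun i => contDiffOn_const, Bd.const hc⟩
  | succ n =>
    refine ⟨fun i => contDiffOn_const, Bd.const hc, fun z => (zero n).congr ?_⟩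
    intro i p _
    simp [Frame.der]

theorem Sym.const_mul {n : ℕ} {k : ℤ} {f : ι → E → ℝ} {c : ι → ℝ} {M : ℝ} (hc : ∀ i, |c i| ≤ M)
    (hf : F.Sym n k f) : F.Sym n k (fun i p => c i * f i p) :=
  (Sym.const hc n).mul' hf (zero_add k)

theorem Sym.real_mul {n : ℕ} {k : ℤ} {f : ι → E → ℝ} (c : ℝ)
    (hf : F.Sym n k f) : F.Sym n k (fun i p => c * f i p) :=
  Sym.const_mul (M := |c|) (fun _ => le_rfl) hf

theorem Sym.neg {n : ℕ} {k : ℤ} {f : ι → E → ℝ} (hf : F.Sym n k f) :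
    F.Sym n k (fun i p => - f i p) :=
  (hf.real_mul (-1)).congr fun i p _ => by ring

theorem Sym.sub {n : ℕ} {k : ℤ} {f g : ι → E → ℝ} (hf : F.Sym n k f) (hg : F.Sym n k g) :
    F.Sym n k (fun i p => f i p - g i p) :=
  (hf.add hg.neg).congr fun i p _ => by ring

theorem Sym.zero (n : ℕ) (k : ℤ) : F.Sym n k (fun _ _ => 0) := by
  induction n with
  | zero =>
    exact ⟨fun i => contDiffOn_const, 0, le_rfl, 0, by simp⟩
  | succ n ih =>
    refine ⟨fun i => contDiffOn_const, ⟨0, le_rfl, 0, by simp⟩, fun z => ih.congr ?_⟩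
    intro i p _
    simp [Frame.der]

theorem Sym.sum {n : ℕ} {k : ℤ} {α : Type*} {s : Finset α} {f : α → ι → E → ℝ}
    (hf : ∀ a ∈ s, F.Sym n k (f a)) : F.Sym n k (fun i p => ∑ a ∈ s, f a i p) := by
  classical
  induction s using Finset.induction_on with
  | empty => simpa using Sym.zero n k
  | insert a s ha ih =>
    refine ((hf a (Finset.mem_insert_self a s)).add
      (ih fun b hb => hf b (Finset.mem_insert_of_mem hb))).congr fun i p _ => ?_
    rw [Finset.sum_insert ha]

theorem Sym.intro {n : ℕ} {k : ℤ} {f : ι → E → ℝ} (hs : F.Smooth f) (hb : F.Bd k f)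
    (hd : ∀ m, m < n → ∀ z, F.Sym m k (F.der z f)) : F.Sym n k f := by
  cases n with
  | zero => exact ⟨hs, hb⟩
  | succ n => exact ⟨hs, hb, hd n (by omega)⟩

/-- The derivative of `1/f` is `-(1/f)² Zf`, of degree `-k` again. Nondegeneracy of `f` thus enters
quantitatively only through the bound `hb`. -/
theorem Sym.inv {n : ℕ} {k : ℤ} {f : ι → E → ℝ} (hf : F.Sym n k f)
    (h0 : ∀ i, ∀ p ∈ F.dom i, f i p ≠ 0) (hb : F.Bd (-k) (fun i p => (f i p)⁻¹)) :
    F.Sym n (-k) (fun i p => (f i p)⁻¹) := by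
  have hs : F.Smooth (fun i p => (f i p)⁻¹) := fun i => (hf.smooth i).inv (h0 i)
  induction n with
  | zero => exact ⟨hs, hb⟩
  | succ n ih =>
    refine ⟨hs, hb, fun z => ?_⟩
    have h1 := ih hf.pred
    refine (((h1.mul h1).mul (hf.2.2 z)).neg.congr_deg (by ring)).congr fun i p hp => ?_
    simp only [Frame.der]
    have := ((hasDerivAt_inv (h0 i p hp)).comp_hasFDerivAt p
      (hf.1.differentiableAt hp).hasFDerivAt).fderiv
    simp only [Function.comp_def] at this
    rw [this, smul_apply, smul_eq_mul, ← inv_pow]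
    ring

/-- A symbol of degree zero may grow like a power of the weight, and its exponential is then beyond
all powers. The bound on the exponential must be supplied; derivatives only multiply it by symbols.
-/
theorem Sym.exp {n : ℕ} {f : ι → E → ℝ} (hf : F.Sym n 0 f)
    (hb : F.Bd 0 (fun i p => Real.exp (f i p))) :
    F.Sym n 0 (fun i p => Real.exp (f i p)) := by
  have hs : F.Smooth (fun i p => Real.exp (f i p)) := fun i => (hf.smooth i).exp
  induction n with
  | zero => exact ⟨hs, hb⟩
  | succ n ih =>
    refine ⟨hs, hb, fun z => ?_⟩
    refine ((ih hf.pred).mul' (hf.2.2 z) (add_zero 0)).congr fun i p hp => ?_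
    simp only [Frame.der]
    rw [fderiv_exp (hf.1.differentiableAt hp)]
    simp

/-- Composition of a smooth function of one variable with a bounded symbol of degree zero. -/
theorem Sym.comp_bounded {n : ℕ} {f : ι → E → ℝ} {M : ℝ} (hf : F.Sym n 0 f)
    (hM : ∀ i, ∀ p ∈ F.dom i, |f i p| ≤ M) {h : ℝ → ℝ} (hh : ContDiff ℝ ∞ h) :
    F.Sym n 0 (fun i p => h (f i p)) := by
  induction n generalizing h with
  | zero =>
    refine ⟨fun i => hh.comp_contDiffOn (hf.1 i), ?_⟩
    obtain ⟨B, hB⟩ := isCompact_Icc.exists_bound_of_continuousOn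
      (s := Set.Icc (-M) M) hh.continuous.continuousOn
    refine ⟨|B|, abs_nonneg _, 0, fun i p hp => ?_⟩
    simpa using (hB _ (abs_le.1 (hM i p hp))).trans (le_abs_self B)
  | succ n ih =>
    have hb := ih hf.pred hh
    refine ⟨hb.smooth, hb.bd, fun z => ?_⟩
    have hh' : ContDiff ℝ ∞ (deriv h) := (contDiff_infty_iff_deriv.1 hh).2
    refine ((ih hf.pred hh').mul' (hf.2.2 z) (add_zero 0)).congr fun i p hp => ?_
    simp only [Frame.der]
    have := ((hh.differentiable (by simp)).differentiableAt (x := f i p)).hasDerivAt.comp_hasFDerivAt p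
      (hf.1.differentiableAt hp).hasFDerivAt
    have h2 := this.fderiv
    simp only [Function.comp_def] at h2
    rw [h2]
    simp

/-- The chain rule in coordinates. -/
theorem der_comp {ι' H : Type} [NormedAddCommGroup H] [NormedSpace ℝ H] {F' : Frame ι' H}
    [Fintype F'.κ] {e : F'.κ → H} {c : F'.κ → H →L[ℝ] ℝ} (he : ∀ j p, F'.X j p = e j)
    (hec : ∀ v, v = ∑ j, c j v • e j) {σ : ι → ι'} {φ : ι → E → H}
    (hφ : ∀ i, ContDiffOn ℝ ∞ (φ i) (F.dom i)) (hmaps : ∀ i, ∀ p ∈ F.dom i, φ i p ∈ F'.dom (σ i))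
    {f : ι' → H → ℝ} (hf : F'.Smooth f) (z : F.κ) {i : ι} {p : E} (hp : p ∈ F.dom i) :
    F.der z (fun i p => f (σ i) (φ i p)) i p =
      ∑ j, F'.der j f (σ i) (φ i p) * F.der z (fun i p => c j (φ i p)) i p := by
  have hφd : DifferentiableAt ℝ (φ i) p :=
    ((hφ i).contDiffAt ((F.isOpen i).mem_nhds hp)).differentiableAt (by simp)
  simp only [Frame.der, he]
  have h2 := ((hf.differentiableAt (hmaps i p hp)).hasFDerivAt.comp p hφd.hasFDerivAt).fderiv
  simp only [Function.comp_def] at h2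
  rw [h2, ContinuousLinearMap.comp_apply, hec (fderiv ℝ (φ i) p (F.X z p)), map_sum]
  refine Finset.sum_congr rfl fun j _ => ?_
  have h3 := ((c j).hasFDerivAt.comp p hφd.hasFDerivAt).fderiv
  simp only [Function.comp_def] at h3
  rw [h3, map_smul, smul_eq_mul, ContinuousLinearMap.comp_apply]
  ring

/-- Composition of a symbol for constant vector fields `e j`, with dual coordinates `c j`, and a family of maps. -/
theorem Sym.comp {ι' H : Type} [NormedAddCommGroup H] [NormedSpace ℝ H] {F' : Frame ι' H}
    [Fintype F'.κ] {e : F'.κ → H} {c : F'.κ → H →L[ℝ] ℝ} (he : ∀ j p, F'.X j p = e j)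
    (hec : ∀ v, v = ∑ j, c j v • e j) {σ : ι → ι'} {φ : ι → E → H}
    (hφ : ∀ i, ContDiffOn ℝ ∞ (φ i) (F.dom i)) (hmaps : ∀ i, ∀ p ∈ F.dom i, φ i p ∈ F'.dom (σ i))
    {n : ℕ} {k l : ℤ}
    (hc : ∀ m, m < n → ∀ j z, F.Sym m 0 (F.der z (fun i p => c j (φ i p))))
    (hgrow : ∀ C : ℕ, ∃ K : ℝ, 0 ≤ K ∧ ∃ D : ℕ, ∀ i, ∀ p ∈ F.dom i,
      F'.ρ (φ i p) ^ k * F'.W (σ i) (φ i p) ^ C ≤ K * F.ρ p ^ l * F.W i p ^ D)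
    {f : ι' → H → ℝ} (hf : F'.Sym n k f) :
    F.Sym n l (fun i p => f (σ i) (φ i p)) := by
  have key : ∀ g : ι' → H → ℝ, F'.Smooth g → F'.Bd k g →
      F.Smooth (fun i p => g (σ i) (φ i p)) ∧ F.Bd l (fun i p => g (σ i) (φ i p)) := by
    intro g hg hgb
    refine ⟨fun i => (hg (σ i)).comp (hφ i) (hmaps i), ?_⟩
    obtain ⟨K, hK, C, H1⟩ := hgb
    obtain ⟨K', hK', D, H2⟩ := hgrow C
    refine ⟨K * K', mul_nonneg hK hK', D, fun i p hp => ?_⟩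
    refine (H1 _ _ (hmaps i p hp)).trans ?_
    calc K * F'.ρ (φ i p) ^ k * F'.W (σ i) (φ i p) ^ C
        = K * (F'.ρ (φ i p) ^ k * F'.W (σ i) (φ i p) ^ C) := by ring
      _ ≤ K * (K' * F.ρ p ^ l * F.W i p ^ D) := mul_le_mul_of_nonneg_left (H2 i p hp) hK
      _ = _ := by ring
  induction n generalizing f with
  | zero => exact key f hf.1 hf.2
  | succ n ih =>
    obtain ⟨hs, hb⟩ := key f hf.1 hf.2.1
    refine ⟨hs, hb, fun z => ?_⟩
    -- For `n + 1` derivatives of the composite, the derivatives of the coordinates of `φ` are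
    -- needed only to order `n`, and `hc` asks for no more. An unknown known to order `n` can
    -- therefore be composed into its own equation.
    have h1 : ∀ j, F.Sym n l (fun i p => F'.der j f (σ i) (φ i p) *
        F.der z (fun i p => c j (φ i p)) i p) := fun j =>
      (ih (fun m hm => hc m (by omega)) (hf.2.2 j)).mul' (hc n (by omega) j z) (add_zero l)
    exact (Sym.sum (s := Finset.univ) fun j _ => h1 j).congr fun i p hp =>
      der_comp he hec hφ hmaps hf.1 z hp

/-- Passage to a frame with the same scale whose fields are combinations of the given ones. -/
theorem Sym.change {F₁ F₂ : Frame ι E} [Fintype F₂.κ] (hdom : ∀ i, F₁.dom i = F₂.dom i)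
    (hρ : F₁.ρ = F₂.ρ) (hW : F₁.W = F₂.W) {c : F₁.κ → F₂.κ → ι → E → ℝ}
    (hX : ∀ z i, ∀ p ∈ F₁.dom i, F₁.X z p = ∑ j, c z j i p • F₂.X j p)
    {n : ℕ} (hc : ∀ m, m < n → ∀ z j, F₁.Sym m 0 (c z j)) {k : ℤ} {f : ι → E → ℝ}
    (hf : F₂.Sym n k f) : F₁.Sym n k f := by
  have hs : ∀ g, F₂.Smooth g → F₁.Smooth g := fun g hg i => (hdom i).symm ▸ hg i
  have hb : ∀ g, F₂.Bd k g → F₁.Bd k g := by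
    rintro g ⟨K, hK, C, H⟩
    exact ⟨K, hK, C, fun i p hp => by rw [hρ, hW]; exact H i p (hdom i ▸ hp)⟩
  induction n generalizing f with
  | zero => exact ⟨hs f hf.1, hb f hf.2⟩
  | succ n ih =>
    refine ⟨hs f hf.1, hb f hf.2.1, fun z => ?_⟩
    refine (Sym.sum (s := Finset.univ) fun j _ => (hc n (by omega) z j).mul'
      (ih (fun m hm => hc m (by omega)) (hf.2.2 j)) (zero_add k)).congr fun i p hp => ?_
    simp only [Frame.der]
    rw [hX z i p hp, map_sum]
    simp

/-- Change of degree, where the scale permits it. -/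
theorem Sym.weaken {n : ℕ} {k l : ℤ} {f : ι → E → ℝ} (hf : F.Sym n k f) {K : ℝ}
    (hK : ∀ i, ∀ p ∈ F.dom i, F.ρ p ^ k ≤ K * F.ρ p ^ l) : F.Sym n l f := by
  have hb : ∀ g, F.Bd k g → F.Bd l g := by
    rintro g ⟨K', hK', C, H⟩
    refine ⟨K' * |K|, by positivity, C, fun i p hp => (H i p hp).trans ?_⟩
    have h1 := (F.W_pow_pos hp C).le
    have h2 := (Sym.zpow_nonneg F hp l).le
    have h3 : F.ρ p ^ k ≤ |K| * F.ρ p ^ l :=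
      (hK i p hp).trans (mul_le_mul_of_nonneg_right (le_abs_self K) h2)
    calc K' * F.ρ p ^ k * F.W i p ^ C ≤ K' * (|K| * F.ρ p ^ l) * F.W i p ^ C := by gcongr
      _ = _ := by ring
  induction n generalizing f with
  | zero => exact ⟨hf.1, hb f hf.2⟩
  | succ n ih => exact ⟨hf.1, hb f hf.2.1, fun z => ih (hf.2.2 z)⟩

end Frame

end QuasilinearWave

end

noncomputable section

namespace QuasilinearWave

/-! ### Scalar ordinary differential equations with parameters -/

section ODE

variable {Λ : Type} [NormedAddCommGroup Λ] [NormedSpace ℝ Λ]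

/-- Differentiation under the integral sign, with the supremum over `[0, 1]` times a closed ball as
dominating constant. The target space is generalized in the induction because the derivative takes
values in a space of linear maps. -/
theorem contDiff_nat_parametric_integral [FiniteDimensional ℝ Λ] (n : ℕ) {V : Type} [NormedAddCommGroup V] [NormedSpace ℝ V]
    [CompleteSpace V] {g : ℝ × Λ → V} (hg : ContDiff ℝ n g) :
    ContDiff ℝ n (fun l => ∫ θ in (0 : ℝ)..1, g (θ, l)) := by
  induction n generalizing V with
  | zero =>
    rw [Nat.cast_zero, contDiff_zero] at hg ⊢
    exact intervalIntegral.continuous_parametric_intervalIntegral_of_continuous'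
      (f := fun l θ => g (θ, l)) (hg.comp continuous_swap) 0 1
  | succ n ih =>
    have : ProperSpace Λ := FiniteDimensional.proper ℝ Λ
    have hg' : ContDiff ℝ n (fun q : ℝ × Λ =>
        (fderiv ℝ g q).comp (ContinuousLinearMap.inr ℝ ℝ Λ)) :=
      (hg.fderiv_right (by simp)).clm_comp contDiff_const
    rw [Nat.cast_succ, contDiff_succ_iff_hasFDerivAt]
    refine ⟨_, ih hg', fun l₀ => ?_⟩
    have hcont : Continuous (fun q : ℝ × Λ =>
        (fderiv ℝ g q).comp (ContinuousLinearMap.inr ℝ ℝ Λ)) := hg'.continuous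
    obtain ⟨B, hB⟩ := ((isCompact_Icc (a := (0 : ℝ)) (b := 1)).prod
      (isCompact_closedBall l₀ 1)).exists_bound_of_continuousOn hcont.continuousOn
    refine intervalIntegral.hasFDerivAt_integral_of_dominated_of_fderiv_le
      (F := fun l θ => g (θ, l)) (bound := fun _ => B) (Metric.closedBall_mem_nhds l₀ one_pos)
      (F' := fun l θ => (fderiv ℝ g (θ, l)).comp (ContinuousLinearMap.inr ℝ ℝ Λ))
      ?_ ?_ ?_ ?_ ?_ ?_
    · exact Filter.Eventually.of_forall fun l =>
        (hg.continuous.comp (by fun_prop : Continuous fun θ : ℝ => (θ, l))).aestronglyMeasurable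
    · exact (hg.continuous.comp (by fun_prop : Continuous fun θ : ℝ => (θ, l₀))).intervalIntegrable _ _
    · exact (hcont.comp (by fun_prop : Continuous fun θ : ℝ => (θ, l₀))).aestronglyMeasurable
    · refine Filter.Eventually.of_forall fun θ hθ l hl => hB (θ, l) ⟨?_, hl⟩
      rw [Set.uIoc_of_le zero_le_one] at hθ
      exact ⟨hθ.1.le, hθ.2⟩
    · exact intervalIntegrable_const
    · refine Filter.Eventually.of_forall fun θ _ l _ => ?_
      exact ((hg.differentiable (by simp)).differentiableAt.hasFDerivAt).comp l
        (hasFDerivAt_prodMk_right θ l)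

/-- A primitive in the first variable is as regular as the integrand. -/
theorem contDiff_nat_primitive [FiniteDimensional ℝ Λ] (n : ℕ) {V : Type} [NormedAddCommGroup V] [NormedSpace ℝ V]
    [CompleteSpace V] {g : ℝ × Λ → V} (hg : ContDiff ℝ n g) :
    ContDiff ℝ n (fun q : ℝ × Λ => ∫ θ in (0 : ℝ)..q.1, g (θ, q.2)) := by
  -- Rescaling to the unit interval turns the variable endpoint into a parameter.
  have h : (fun q : ℝ × Λ => ∫ θ in (0 : ℝ)..q.1, g (θ, q.2)) =
      fun q : ℝ × Λ => q.1 • ∫ σ in (0 : ℝ)..1, g (q.1 * σ, q.2) := by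
    ext q
    have := intervalIntegral.smul_integral_comp_mul_left (a := 0) (b := 1)
      (fun θ => g (θ, q.2)) q.1
    simpa using this.symm
  rw [h]
  refine contDiff_fst.smul (contDiff_nat_parametric_integral n
    (g := fun w : ℝ × (ℝ × Λ) => g (w.2.1 * w.1, w.2.2)) ?_)
  exact hg.comp (by fun_prop)

theorem contDiff_primitive [FiniteDimensional ℝ Λ] {V : Type} [NormedAddCommGroup V] [NormedSpace ℝ V]
    [CompleteSpace V] {g : ℝ × Λ → V} (hg : ContDiff ℝ ∞ g) :
    ContDiff ℝ ∞ (fun q : ℝ × Λ => ∫ θ in (0 : ℝ)..q.1, g (θ, q.2)) :=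
  contDiff_infty.2 fun n => contDiff_nat_primitive n (hg.of_le (by exact_mod_cast le_top))

/-- Variation of constants for a scalar linear equation. -/
theorem linear_ode_formula {β b F : ℝ → ℝ} (hβ : Continuous β) (hb : Continuous b)
    (hF : ∀ θ, HasDerivAt F (β θ * F θ + b θ) θ) (h0 : F 0 = 0) (θ : ℝ) :
    F θ = Real.exp (∫ τ in (0 : ℝ)..θ, β τ) *
      ∫ θ' in (0 : ℝ)..θ, Real.exp (-∫ τ in (0 : ℝ)..θ', β τ) * b θ' := by
  have hB : ∀ θ, HasDerivAt (fun θ => ∫ τ in (0 : ℝ)..θ, β τ) (β θ) θ := fun θ =>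
    intervalIntegral.integral_hasDerivAt_right (hβ.intervalIntegrable _ _)
      (hβ.stronglyMeasurableAtFilter _ _) hβ.continuousAt
  have hBc : Continuous (fun θ => ∫ τ in (0 : ℝ)..θ, β τ) :=
    continuous_iff_continuousAt.2 fun θ => (hB θ).continuousAt
  have hE : ∀ θ, HasDerivAt (fun θ => Real.exp (-∫ τ in (0 : ℝ)..θ, β τ) * F θ)
      (Real.exp (-∫ τ in (0 : ℝ)..θ, β τ) * b θ) θ := fun θ => by
    refine ((hB θ).neg.exp.mul (hF θ)).congr_deriv ?_
    simp only [Pi.neg_apply]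
    ring
  have := intervalIntegral.integral_eq_sub_of_hasDerivAt (a := 0) (b := θ) (fun x _ => hE x)
    ((hBc.neg.rexp.mul hb).intervalIntegrable _ _)
  rw [this, h0, mul_zero, sub_zero, ← mul_assoc, ← Real.exp_add]
  simp

variable {f : ℝ × (ℝ × Λ) → ℝ} {Z : ℝ → Λ → ℝ}

/-- The mean of the differential over the segment between two points with the same time. -/
def meanFDeriv (f : ℝ × (ℝ × Λ) → ℝ) (θ y₀ y₁ : ℝ) (l₀ l₁ : Λ) : (ℝ × (ℝ × Λ)) →L[ℝ] ℝ :=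
  ∫ σ in (0 : ℝ)..1, fderiv ℝ f (θ, (y₀ + σ * (y₁ - y₀), l₀ + σ • (l₁ - l₀)))

theorem continuous_meanFDeriv (hf : ContDiff ℝ ∞ f) {T : Type} [TopologicalSpace T]
    {θ y₀ y₁ : T → ℝ} {l₀ l₁ : T → Λ} (hθ : Continuous θ) (h₀ : Continuous y₀) (h₁ : Continuous y₁)
    (hl₀ : Continuous l₀) (hl₁ : Continuous l₁) :
    Continuous fun t => meanFDeriv f (θ t) (y₀ t) (y₁ t) (l₀ t) (l₁ t) := by
  have := hf.continuous_fderiv (by simp)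
  refine intervalIntegral.continuous_parametric_intervalIntegral_of_continuous'
    (f := fun t σ => fderiv ℝ f (θ t, (y₀ t + σ * (y₁ t - y₀ t), l₀ t + σ • (l₁ t - l₀ t)))) ?_ 0 1
  simp only [Function.uncurry_def]
  fun_prop

theorem meanFDeriv_self (θ y : ℝ) (l : Λ) : meanFDeriv f θ y y l l = fderiv ℝ f (θ, (y, l)) := by
  simp [meanFDeriv]

/-- The fundamental theorem of calculus along the segment. Being an identity rather than an
expansion, it makes the difference of two solutions solve a linear equation exactly. -/
theorem meanFDeriv_apply (hf : ContDiff ℝ ∞ f) (θ y₀ y₁ : ℝ) (l₀ l₁ : Λ) :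
    f (θ, (y₁, l₁)) - f (θ, (y₀, l₀)) =
      meanFDeriv f θ y₀ y₁ l₀ l₁ (0, (1, 0)) * (y₁ - y₀) +
        meanFDeriv f θ y₀ y₁ l₀ l₁ (0, (0, l₁ - l₀)) := by
  have hc := hf.continuous_fderiv (by simp)
  have h1 : ∀ σ : ℝ, HasDerivAt
      (fun σ : ℝ => f (θ, (y₀ + σ * (y₁ - y₀), l₀ + σ • (l₁ - l₀))))
      (fderiv ℝ f (θ, (y₀ + σ * (y₁ - y₀), l₀ + σ • (l₁ - l₀))) (0, (y₁ - y₀, l₁ - l₀))) σ := by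
    intro σ
    have e : HasDerivAt (fun σ : ℝ => ((θ, (y₀ + σ * (y₁ - y₀), l₀ + σ • (l₁ - l₀))) : ℝ × (ℝ × Λ)))
        (0, (y₁ - y₀, l₁ - l₀)) σ := by
      refine (hasDerivAt_const σ θ).prodMk (HasDerivAt.prodMk ?_ ?_)
      · simpa using ((hasDerivAt_id σ).mul_const (y₁ - y₀)).const_add y₀
      · simpa using ((hasDerivAt_id σ).smul_const (l₁ - l₀)).const_add l₀
    exact ((hf.differentiable (by simp)).differentiableAt.hasFDerivAt).comp_hasDerivAt σ e
  have hcc : Continuous fun σ : ℝ =>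
      fderiv ℝ f (θ, (y₀ + σ * (y₁ - y₀), l₀ + σ • (l₁ - l₀))) := by fun_prop
  have h2 := intervalIntegral.integral_eq_sub_of_hasDerivAt (a := 0) (b := 1) (fun x _ => h1 x)
    ((hcc.clm_apply continuous_const).intervalIntegrable _ _)
  have h3 : meanFDeriv f θ y₀ y₁ l₀ l₁ (0, (y₁ - y₀, l₁ - l₀)) =
      f (θ, (y₁, l₁)) - f (θ, (y₀, l₀)) := by
    rw [meanFDeriv, ContinuousLinearMap.intervalIntegral_apply (hcc.intervalIntegrable _ _), h2]
    simp
  rw [← h3]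
  have : ((0, (y₁ - y₀, l₁ - l₀)) : ℝ × (ℝ × Λ)) =
      (y₁ - y₀) • (0, (1, 0)) + (0, (0, l₁ - l₀)) := by simp
  rw [this, map_add, map_smul, smul_eq_mul, mul_comm]

/-- The linear map carrying `l - l₀` to `Z θ l - Z θ l₀`. -/
def odeKernel (f : ℝ × (ℝ × Λ) → ℝ) (Z : ℝ → Λ → ℝ) (l₀ l : Λ) (θ : ℝ) : Λ →L[ℝ] ℝ :=
  Real.exp (∫ τ in (0 : ℝ)..θ, meanFDeriv f τ (Z τ l₀) (Z τ l) l₀ l (0, (1, 0))) •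
    ∫ θ' in (0 : ℝ)..θ,
      Real.exp (-∫ τ in (0 : ℝ)..θ', meanFDeriv f τ (Z τ l₀) (Z τ l) l₀ l (0, (1, 0))) •
        (meanFDeriv f θ' (Z θ' l₀) (Z θ' l) l₀ l).comp
          ((ContinuousLinearMap.inr ℝ ℝ (ℝ × Λ)).comp (ContinuousLinearMap.inr ℝ ℝ Λ))

theorem continuous_primitive_param {V : Type} [NormedAddCommGroup V] [NormedSpace ℝ V]
    [CompleteSpace V] [FiniteDimensional ℝ Λ] {g : ℝ × Λ → V} (hg : Continuous g) :
    Continuous (fun q : ℝ × Λ => ∫ θ in (0 : ℝ)..q.1, g (θ, q.2)) := by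
  have := contDiff_nat_primitive 0 (g := g) (by simpa [contDiff_zero] using hg)
  simpa [contDiff_zero] using this

theorem ode_difference (hf : ContDiff ℝ ∞ f) (hZ0 : ∀ l, Z 0 l = 0)
    (hZ : ∀ θ l, HasDerivAt (fun θ => Z θ l) (f (θ, (Z θ l, l))) θ) (l₀ l : Λ) (θ : ℝ) :
    Z θ l - Z θ l₀ =
      Real.exp (∫ τ in (0 : ℝ)..θ, meanFDeriv f τ (Z τ l₀) (Z τ l) l₀ l (0, (1, 0))) *
      ∫ θ' in (0 : ℝ)..θ,
        Real.exp (-∫ τ in (0 : ℝ)..θ', meanFDeriv f τ (Z τ l₀) (Z τ l) l₀ l (0, (1, 0))) *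
          meanFDeriv f θ' (Z θ' l₀) (Z θ' l) l₀ l (0, (0, l - l₀)) := by
  have hc : ∀ l, Continuous fun θ => Z θ l := fun l =>
    continuous_iff_continuousAt.2 fun θ => (hZ θ l).continuousAt
  have hm : Continuous fun θ => meanFDeriv f θ (Z θ l₀) (Z θ l) l₀ l :=
    continuous_meanFDeriv hf continuous_id (hc l₀) (hc l) continuous_const continuous_const
  refine linear_ode_formula (F := fun θ => Z θ l - Z θ l₀)
    (β := fun τ => meanFDeriv f τ (Z τ l₀) (Z τ l) l₀ l (0, (1, 0)))
    (b := fun τ => meanFDeriv f τ (Z τ l₀) (Z τ l) l₀ l (0, (0, l - l₀)))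
    (hm.clm_apply continuous_const) (hm.clm_apply continuous_const) (fun θ => ?_)
    (by simp [hZ0]) θ
  exact ((hZ θ l).sub (hZ θ l₀)).congr_deriv (meanFDeriv_apply hf _ _ _ _ _)

theorem ode_difference_eq_kernel (hf : ContDiff ℝ ∞ f) (hZ0 : ∀ l, Z 0 l = 0)
    (hZ : ∀ θ l, HasDerivAt (fun θ => Z θ l) (f (θ, (Z θ l, l))) θ) (l₀ l : Λ) (θ : ℝ) :
    Z θ l - Z θ l₀ = odeKernel f Z l₀ l θ (l - l₀) := by
  have hc : ∀ l, Continuous fun θ => Z θ l := fun l =>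
    continuous_iff_continuousAt.2 fun θ => (hZ θ l).continuousAt
  have hm : Continuous fun θ => meanFDeriv f θ (Z θ l₀) (Z θ l) l₀ l :=
    continuous_meanFDeriv hf continuous_id (hc l₀) (hc l) continuous_const continuous_const
  have hB : Continuous fun θ => ∫ τ in (0 : ℝ)..θ,
      meanFDeriv f τ (Z τ l₀) (Z τ l) l₀ l (0, (1, 0)) :=
    intervalIntegral.continuous_primitive
      (fun a b => (hm.clm_apply continuous_const).intervalIntegrable a b) 0
  rw [ode_difference hf hZ0 hZ, odeKernel, smul_apply, smul_eq_mul,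
    ContinuousLinearMap.intervalIntegral_apply]
  · simp
  · exact ((hB.neg.rexp).smul (hm.clm_comp continuous_const)).intervalIntegrable _ _

theorem norm_meanFDeriv_le {θ y₀ y₁ : ℝ} {l₀ l : Λ} {L r : ℝ} (hl : l ∈ Metric.ball l₀ r)
    (h : ∀ y, ∀ l ∈ Metric.ball l₀ r, ‖fderiv ℝ f (θ, (y, l))‖ ≤ L) :
    ‖meanFDeriv f θ y₀ y₁ l₀ l‖ ≤ L := by
  have := intervalIntegral.norm_integral_le_of_norm_le_const (a := 0) (b := 1) (C := L)
    (f := fun σ : ℝ => fderiv ℝ f (θ, (y₀ + σ * (y₁ - y₀), l₀ + σ • (l - l₀)))) (fun σ hσ => ?_)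
  · simpa [meanFDeriv] using this
  · rw [Set.uIoc_of_le zero_le_one] at hσ
    refine h _ _ ?_
    rw [Metric.mem_ball, dist_eq_norm] at hl ⊢
    rw [add_sub_cancel_left, norm_smul, Real.norm_of_nonneg hσ.1.le]
    exact (mul_le_of_le_one_left (norm_nonneg _) hσ.2).trans_lt hl

/-- The differential of `f` is bounded uniformly in the unknown, locally uniformly in time and parameters. -/
def LocallyLipschitzODE (f : ℝ × (ℝ × Λ) → ℝ) : Prop :=
  ∀ M l₀, ∃ L, ∃ r > 0, ∀ θ, |θ| ≤ M → ∀ y, ∀ l ∈ Metric.ball l₀ r,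
    ‖fderiv ℝ f (θ, (y, l))‖ ≤ L

/-- Grönwall's inequality read off from the explicit formula. It yields joint continuity of `Z`,
which is needed before the kernel, built from `Z` at two parameters, is known to be continuous. -/
theorem ode_difference_le (hf : ContDiff ℝ ∞ f) (hZ0 : ∀ l, Z 0 l = 0)
    (hZ : ∀ θ l, HasDerivAt (fun θ => Z θ l) (f (θ, (Z θ l, l))) θ)
    (hB : LocallyLipschitzODE f) (M : ℝ) (l₀ : Λ) :
    ∃ K, ∃ r > 0, ∀ θ, |θ| ≤ M → ∀ l ∈ Metric.ball l₀ r, |Z θ l - Z θ l₀| ≤ K * ‖l - l₀‖ := by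
  obtain ⟨L, r, hr, H⟩ := hB M l₀
  refine ⟨Real.exp (L * M) * (Real.exp (L * M) * L * M), r, hr, fun θ hθ l hl => ?_⟩
  have hG : ∀ θ', |θ'| ≤ M → ‖meanFDeriv f θ' (Z θ' l₀) (Z θ' l) l₀ l‖ ≤ L := fun θ' h' =>
    norm_meanFDeriv_le hl (H θ' h')
  have hL : 0 ≤ L := (norm_nonneg _).trans (hG θ hθ)
  have hM : 0 ≤ M := (abs_nonneg _).trans hθ
  have hmem : ∀ θ', |θ'| ≤ M → ∀ τ ∈ Set.uIoc 0 θ', |τ| ≤ |θ'| := by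
    intro θ' _ τ hτ
    rcases le_total 0 θ' with h | h
    · rw [Set.uIoc_of_le h] at hτ
      rw [abs_of_pos hτ.1, abs_of_nonneg h]; exact hτ.2
    · rw [Set.uIoc_of_ge h] at hτ
      rw [abs_of_nonpos hτ.2, abs_of_nonpos h]; linarith [hτ.1]
  have hI : ∀ θ', |θ'| ≤ M →
      |∫ τ in (0 : ℝ)..θ', meanFDeriv f τ (Z τ l₀) (Z τ l) l₀ l (0, (1, 0))| ≤ L * M := by
    intro θ' h'
    have := intervalIntegral.norm_integral_le_of_norm_le_const (a := 0) (b := θ') (C := L)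
      (f := fun τ => meanFDeriv f τ (Z τ l₀) (Z τ l) l₀ l (0, (1, 0))) (fun τ hτ => ?_)
    · rw [Real.norm_eq_abs, sub_zero] at this
      exact this.trans (mul_le_mul_of_nonneg_left h' hL)
    · refine (ContinuousLinearMap.le_opNorm _ _).trans ?_
      have : ‖((0, (1, 0)) : ℝ × (ℝ × Λ))‖ = 1 := by simp [Prod.norm_def]
      rw [this, mul_one]
      exact hG τ ((hmem θ' h' τ hτ).trans h')
  rw [ode_difference hf hZ0 hZ, abs_mul, Real.abs_exp, mul_assoc]
  refine mul_le_mul (Real.exp_le_exp.2 ((le_abs_self _).trans (hI θ hθ))) ?_ (abs_nonneg _)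
    (Real.exp_pos _).le
  have := intervalIntegral.norm_integral_le_of_norm_le_const (a := 0) (b := θ)
    (C := Real.exp (L * M) * (L * ‖l - l₀‖))
    (f := fun θ' => Real.exp (-∫ τ in (0 : ℝ)..θ',
      meanFDeriv f τ (Z τ l₀) (Z τ l) l₀ l (0, (1, 0))) *
          meanFDeriv f θ' (Z θ' l₀) (Z θ' l) l₀ l (0, (0, l - l₀))) (fun τ hτ => ?_)
  · rw [Real.norm_eq_abs, sub_zero] at this
    refine this.trans ?_
    calc Real.exp (L * M) * (L * ‖l - l₀‖) * |θ| ≤ Real.exp (L * M) * (L * ‖l - l₀‖) * M := by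
          gcongr
      _ = _ := by ring
  · have hτ' := (hmem θ hθ τ hτ).trans hθ
    rw [norm_mul, Real.norm_eq_abs, Real.abs_exp]
    refine mul_le_mul (Real.exp_le_exp.2 ((neg_le_abs _).trans (hI τ hτ'))) ?_ (norm_nonneg _)
      (Real.exp_pos _).le
    refine (ContinuousLinearMap.le_opNorm _ _).trans ?_
    have : ‖((0, (0, l - l₀)) : ℝ × (ℝ × Λ))‖ = ‖l - l₀‖ := by simp [Prod.norm_def]
    rw [this]
    exact mul_le_mul_of_nonneg_right (hG τ hτ') (norm_nonneg _)

theorem continuous_ode (hf : ContDiff ℝ ∞ f) (hZ0 : ∀ l, Z 0 l = 0)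
    (hZ : ∀ θ l, HasDerivAt (fun θ => Z θ l) (f (θ, (Z θ l, l))) θ)
    (hB : LocallyLipschitzODE f) : Continuous (fun q : ℝ × Λ => Z q.1 q.2) := by
  rw [continuous_iff_continuousAt]
  rintro ⟨θ₀, l₀⟩
  obtain ⟨K, r, hr, H⟩ := ode_difference_le hf hZ0 hZ hB (|θ₀| + 1) l₀
  have h1 : Filter.Tendsto (fun q : ℝ × Λ => Z q.1 q.2 - Z q.1 l₀) (nhds (θ₀, l₀)) (nhds 0) := by
    have h2 : Filter.Tendsto (fun q : ℝ × Λ => K * ‖q.2 - l₀‖) (nhds (θ₀, l₀)) (nhds 0) := by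
      have : Continuous fun q : ℝ × Λ => K * ‖q.2 - l₀‖ := by fun_prop
      simpa using this.tendsto (θ₀, l₀)
    refine squeeze_zero_norm' ?_ h2
    have : Metric.ball θ₀ 1 ×ˢ Metric.ball l₀ r ∈ nhds (θ₀, l₀) :=
      prod_mem_nhds (Metric.ball_mem_nhds _ one_pos) (Metric.ball_mem_nhds _ hr)
    filter_upwards [this] with q hq
    refine H q.1 ?_ q.2 hq.2
    have h3 := hq.1
    rw [Metric.mem_ball, Real.dist_eq] at h3
    have := abs_sub_abs_le_abs_sub q.1 θ₀
    linarith
  have h2 : Filter.Tendsto (fun q : ℝ × Λ => Z q.1 l₀) (nhds (θ₀, l₀)) (nhds (Z θ₀ l₀)) :=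
    ((hZ θ₀ l₀).continuousAt.tendsto).comp (continuous_fst.tendsto (θ₀, l₀))
  have := h1.add h2
  simpa [ContinuousAt] using this

theorem continuous_odeKernel [FiniteDimensional ℝ Λ] (hf : ContDiff ℝ ∞ f)
    (hc : Continuous (fun q : ℝ × Λ => Z q.1 q.2)) (l₀ : Λ) :
    Continuous (fun q : ℝ × Λ => odeKernel f Z l₀ q.2 q.1) := by
  have hc0 : Continuous fun q : ℝ × Λ => Z q.1 l₀ :=
    hc.comp (by fun_prop : Continuous fun q : ℝ × Λ => (q.1, l₀))
  have hm : Continuous fun q : ℝ × Λ => meanFDeriv f q.1 (Z q.1 l₀) (Z q.1 q.2) l₀ q.2 :=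
    continuous_meanFDeriv hf continuous_fst hc0 hc continuous_const continuous_snd
  have hI := continuous_primitive_param (hm.clm_apply (continuous_const (y := (0, (1, 0)))))
  exact (hI.rexp).smul (continuous_primitive_param
    (g := fun q : ℝ × Λ => Real.exp (-∫ τ in (0 : ℝ)..q.1,
        meanFDeriv f τ (Z τ l₀) (Z τ q.2) l₀ q.2 (0, (1, 0))) •
        (meanFDeriv f q.1 (Z q.1 l₀) (Z q.1 q.2) l₀ q.2).comp
          ((ContinuousLinearMap.inr ℝ ℝ (ℝ × Λ)).comp (ContinuousLinearMap.inr ℝ ℝ Λ)))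
    (hI.neg.rexp.smul (hm.clm_comp continuous_const)))

/-- Carathéodory's form of differentiability: an increment that is a continuous family of linear
maps applied to `l - l₀`. -/
theorem hasFDerivAt_of_kernel {h : Λ → ℝ} {Ψ : Λ → Λ →L[ℝ] ℝ} {l₀ : Λ}
    (hΨ : ContinuousAt Ψ l₀) (hh : ∀ l, h l - h l₀ = Ψ l (l - l₀)) : HasFDerivAt h (Ψ l₀) l₀ := by
  rw [hasFDerivAt_iff_isLittleO, Asymptotics.isLittleO_iff]
  intro c hcpos
  have : ∀ᶠ l in nhds l₀, ‖Ψ l - Ψ l₀‖ < c := by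
    have h1 : Filter.Tendsto (fun l => ‖Ψ l - Ψ l₀‖) (nhds l₀) (nhds 0) := by
      have := (hΨ.tendsto.sub_const (Ψ l₀)).norm
      simpa using this
    exact h1.eventually (gt_mem_nhds hcpos)
  filter_upwards [this] with l hl
  rw [hh l, ← sub_apply]
  exact (ContinuousLinearMap.le_opNorm _ _).trans
    (mul_le_mul_of_nonneg_right hl.le (norm_nonneg _))

/-- Solutions of a scalar equation depend smoothly on time and parameters. -/
theorem contDiff_ode [FiniteDimensional ℝ Λ] (hf : ContDiff ℝ ∞ f) (hZ0 : ∀ l, Z 0 l = 0)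
    (hZ : ∀ θ l, HasDerivAt (fun θ => Z θ l) (f (θ, (Z θ l, l))) θ)
    (hB : LocallyLipschitzODE f) : ContDiff ℝ ∞ (fun q : ℝ × Λ => Z q.1 q.2) := by
  have hc := continuous_ode hf hZ0 hZ hB
  have hd1 : ∀ q : ℝ × Λ, HasFDerivAt (fun l => Z q.1 l) (odeKernel f Z q.2 q.2 q.1) q.2 := by
    intro q
    refine hasFDerivAt_of_kernel (Ψ := fun l => odeKernel f Z q.2 l q.1) ?_
      fun l => ode_difference_eq_kernel hf hZ0 hZ _ _ _
    exact ((continuous_odeKernel hf hc q.2).comp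
      (by fun_prop : Continuous fun l : Λ => (q.1, l))).continuousAt
  -- On the diagonal the kernel is the parameter derivative of `Z`, and it is made from `Z` by
  -- composition and primitives, so it is as regular as `Z`. Each order of regularity thus yields
  -- the next.
  have hker : ∀ n : ℕ, ContDiff ℝ n (fun q : ℝ × Λ => Z q.1 q.2) →
      ContDiff ℝ n (fun q : ℝ × Λ => odeKernel f Z q.2 q.2 q.1) := by
    intro n hn
    have hm : ContDiff ℝ n fun q : ℝ × Λ => fderiv ℝ f (q.1, (Z q.1 q.2, q.2)) :=
      (((hf.fderiv_right (m := ∞) (by simp)).of_le (by exact_mod_cast le_top)).comp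
        (contDiff_fst.prodMk (hn.prodMk contDiff_snd)))
    have hI := contDiff_nat_primitive n (hm.clm_apply (contDiff_const (c := (0, (1, 0)))))
    simp only [odeKernel, meanFDeriv_self]
    exact hI.exp.smul (contDiff_nat_primitive n
      (g := fun q : ℝ × Λ => Real.exp (-∫ τ in (0 : ℝ)..q.1,
        fderiv ℝ f (τ, (Z τ q.2, q.2)) (0, (1, 0))) •
        (fderiv ℝ f (q.1, (Z q.1 q.2, q.2))).comp
          ((ContinuousLinearMap.inr ℝ ℝ (ℝ × Λ)).comp (ContinuousLinearMap.inr ℝ ℝ Λ)))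
      (hI.neg.exp.smul (hm.clm_comp contDiff_const)))
  have hft : ∀ n : ℕ, ContDiff ℝ n (fun q : ℝ × Λ => Z q.1 q.2) →
      ContDiff ℝ n (fun q : ℝ × Λ =>
        (1 : ℝ →L[ℝ] ℝ).smulRight (f (q.1, (Z q.1 q.2, q.2)))) := fun n hn =>
    contDiff_const.smulRight ((hf.of_le (by exact_mod_cast le_top)).comp
      (contDiff_fst.prodMk (hn.prodMk contDiff_snd)))
  refine contDiff_infty.2 fun n => ?_
  induction n with
  | zero => simpa [contDiff_zero] using hc
  | succ n ih =>
    rw [Nat.cast_succ, contDiff_succ_iff_hasFDerivAt]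
    refine ⟨fun q => ((1 : ℝ →L[ℝ] ℝ).smulRight (f (q.1, (Z q.1 q.2, q.2)))).coprod
      (odeKernel f Z q.2 q.2 q.1), ?_, fun q => ?_⟩
    · have := ((hft n ih).clm_comp (contDiff_const (c := ContinuousLinearMap.fst ℝ ℝ Λ))).add
        ((hker n ih).clm_comp (contDiff_const (c := ContinuousLinearMap.snd ℝ ℝ Λ)))
      have e : ∀ q : ℝ × Λ, ((1 : ℝ →L[ℝ] ℝ).smulRight (f (q.1, (Z q.1 q.2, q.2)))).coprod
          (odeKernel f Z q.2 q.2 q.1) = ((1 : ℝ →L[ℝ] ℝ).smulRight (f (q.1, (Z q.1 q.2, q.2)))).comp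
          (ContinuousLinearMap.fst ℝ ℝ Λ) + (odeKernel f Z q.2 q.2 q.1).comp
          (ContinuousLinearMap.snd ℝ ℝ Λ) := fun q => by ext <;> simp
      simp only [e]
      exact this
    · exact (hasStrictFDerivAt_uncurry_coprod (f := Z)
        (f₁ := fun θ l => (1 : ℝ →L[ℝ] ℝ).smulRight (f (θ, (Z θ l, l))))
        (f₂ := fun θ l => odeKernel f Z l l θ) (u := q)
        (Filter.Eventually.of_forall fun v => (hZ v.1 v.2).hasFDerivAt)
        (Filter.Eventually.of_forall fun v => hd1 v)
        (hft n ih).continuous.continuousAt (hker n ih).continuous.continuousAt).hasFDerivAt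

/-- Global existence for a scalar equation with a smooth, locally bounded right-hand side. -/
theorem exists_global_ode {f : ℝ → ℝ → ℝ} (hf : ContDiff ℝ 1 (Function.uncurry f))
    (hb : ∀ M, ∃ L, ∀ θ, |θ| ≤ M → ∀ y, |f θ y| ≤ L)
    (hl : ∀ M, ∃ L, ∀ θ, |θ| ≤ M → ∀ y y', |f θ y - f θ y'| ≤ L * |y - y'|) :
    ∃ Z : ℝ → ℝ, Z 0 = 0 ∧ ∀ θ, HasDerivAt Z (f θ (Z θ)) θ := by
  have hex : ∀ n : ℕ, ∃ α : ℝ → ℝ, α 0 = 0 ∧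
      ∀ t ∈ Set.Ioo (-(n + 1 : ℝ)) (n + 1), HasDerivAt α (f t (α t)) t := by
    intro n
    have hn : (0 : ℝ) < n + 1 := by positivity
    obtain ⟨L, hL⟩ := hb (n + 1)
    obtain ⟨K, hK⟩ := hl (n + 1)
    have habs : ∀ t ∈ Set.Icc (-(n + 1 : ℝ)) (n + 1), |t| ≤ n + 1 := fun t ht => abs_le.2 ht
    -- The bound `L` on the field keeps solutions in the ball of radius `L (n + 1)` over the whole
    -- interval, so no short time is needed.
    have hPL : IsPicardLindelof f (tmin := -(n + 1 : ℝ)) (tmax := n + 1)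
        ⟨0, by constructor <;> linarith⟩ (0 : ℝ) (L.toNNReal * (n + 1)) 0 L.toNNReal K.toNNReal := by
      refine ⟨fun t ht => ?_, fun x _ => ?_, fun t ht x _ => ?_, ?_⟩
      · refine LipschitzOnWith.of_dist_le_mul fun x _ y _ => ?_
        rw [Real.dist_eq, Real.dist_eq]
        exact (hK t (habs t ht) x y).trans
          (mul_le_mul_of_nonneg_right (Real.le_coe_toNNReal K) (abs_nonneg _))
      · exact (hf.continuous.comp (by fun_prop : Continuous fun t : ℝ => (t, x))).continuousOn
      · exact (hL t (habs t ht) x).trans (Real.le_coe_toNNReal L)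
      · simp
    obtain ⟨α, h0, hα⟩ := hPL.exists_eq_forall_mem_Icc_hasDerivWithinAt₀
    exact ⟨α, h0, fun t ht => (hα t (Set.Ioo_subset_Icc_self ht)).hasDerivAt
      (Icc_mem_nhds ht.1 ht.2)⟩
  choose α hα0 hα using hex
  have huniq : ∀ m n : ℕ, m ≤ n → ∀ t ∈ Set.Ioo (-(m + 1 : ℝ)) (m + 1), α m t = α n t := by
    intro m n hmn
    obtain ⟨K, hK⟩ := hl (m + 1)
    have hm : (0 : ℝ) < m + 1 := by positivity
    have hmn' : (m : ℝ) ≤ n := by exact_mod_cast hmn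
    refine ODE_solution_unique_of_mem_Ioo (v := f) (s := fun _ => Set.univ) (K := K.toNNReal)
      (t₀ := 0) (fun t ht => ?_) ⟨by linarith, hm⟩ (fun t ht => ⟨hα m t ht, trivial⟩)
      (fun t ht => ⟨hα n t ⟨by linarith [ht.1], by linarith [ht.2]⟩, trivial⟩) (by rw [hα0, hα0])
    refine LipschitzOnWith.of_dist_le_mul fun x _ y _ => ?_
    rw [Real.dist_eq, Real.dist_eq]
    exact (hK t (abs_le.2 ⟨ht.1.le, ht.2.le⟩) x y).trans
      (mul_le_mul_of_nonneg_right (Real.le_coe_toNNReal K) (abs_nonneg _))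
  have hZ : ∀ N : ℕ, ∀ t : ℝ, |t| ≤ N → α ⌈|t|⌉₊ t = α N t := fun N t ht => by
    refine huniq _ _ (Nat.ceil_le.2 ht) t ?_
    have h1 := Nat.le_ceil |t|
    exact abs_lt.1 (by linarith)
  refine ⟨fun t => α ⌈|t|⌉₊ t, by simp [hα0], fun t => ?_⟩
  have hN : |t| + 1 ≤ ((⌈|t|⌉₊ + 1 : ℕ) : ℝ) := by
    push_cast
    linarith [Nat.le_ceil |t|]
  -- The index may jump near `t`. By uniqueness every admissible solution agrees there with the one
  -- of index `⌈|t|⌉₊ + 1`, whose interval contains a full neighbourhood.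
  have hev : (fun t => α ⌈|t|⌉₊ t) =ᶠ[nhds t] α (⌈|t|⌉₊ + 1) := by
    filter_upwards [Metric.ball_mem_nhds t one_pos] with s hs
    refine hZ _ s ?_
    rw [Metric.mem_ball, Real.dist_eq] at hs
    have := abs_sub_abs_le_abs_sub s t
    linarith
  refine HasDerivAt.congr_of_eventuallyEq ?_ hev
  rw [show (fun t => α ⌈|t|⌉₊ t) t = α (⌈|t|⌉₊ + 1) t from hev.eq_of_nhds]
  refine hα _ t (abs_lt.1 ?_)
  linarith

/-- The integrating factor is normalized to be one at the endpoint `y`, so only exponentials of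
integrals ending at `y` have to be bounded. Unordered intervals cover both signs of `y - y₀`. -/
theorem linear_ode_bound {β b F : ℝ → ℝ} {U : Set ℝ} (hU : IsOpen U) {y₀ y : ℝ}
    (hsub : Set.uIcc y₀ y ⊆ U) (hβ : ContinuousOn β U)
    (hF : ∀ τ ∈ Set.uIcc y₀ y, HasDerivAt F (β τ * F τ + b τ) τ) (h0 : F y₀ = 0) {M B : ℝ}
    (hb : ∀ τ ∈ Set.uIcc y₀ y, |b τ| ≤ B)
    (hM : ∀ τ ∈ Set.uIcc y₀ y, Real.exp (∫ σ in τ..y, β σ) ≤ M) :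
    |F y| ≤ M * B * |y - y₀| := by
  have hd : ∀ τ ∈ Set.uIcc y₀ y, HasDerivAt (fun τ => Real.exp (∫ σ in τ..y, β σ) * F τ)
      (Real.exp (∫ σ in τ..y, β σ) * b τ) τ := by
    intro τ hτ
    have h1 : HasDerivAt (fun τ => ∫ σ in τ..y, β σ) (-β τ) τ := by
      refine intervalIntegral.integral_hasDerivAt_left ?_ ?_ (hβ.continuousAt (hU.mem_nhds (hsub hτ)))
      · exact (hβ.mono ((Set.uIcc_subset_uIcc hτ Set.right_mem_uIcc).trans hsub)).intervalIntegrable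
      · exact hβ.stronglyMeasurableAtFilter hU τ (hsub hτ)
    exact (h1.exp.mul (hF τ hτ)).congr_deriv (by ring)
  have := (convex_uIcc y₀ y).norm_image_sub_le_of_norm_hasDerivWithin_le (C := M * B)
    (fun τ hτ => (hd τ hτ).hasDerivWithinAt) (fun τ hτ => ?_) Set.left_mem_uIcc Set.right_mem_uIcc
  · simpa [h0] using this
  · rw [norm_mul, Real.norm_eq_abs, Real.abs_exp, Real.norm_eq_abs]
    exact mul_le_mul (hM τ hτ) (hb τ hτ) (abs_nonneg _) ((Real.exp_pos _).le.trans (hM τ hτ))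

end ODE

/-! ### Symbol estimates for linear equations in one of the variables. -/

namespace Frame

variable {ι E : Type} [NormedAddCommGroup E] [NormedSpace ℝ E] {F : Frame ι E}

theorem der_comm {f : ι → E → ℝ} (hf : F.Smooth f) {z z' : F.κ} {v w : E}
    (hv : ∀ p, F.X z p = v) (hw : ∀ p, F.X z' p = w) {i : ι} {p : E} (hp : p ∈ F.dom i) :
    F.der z (F.der z' f) i p = F.der z' (F.der z f) i p := by
  have hc : ContDiffAt ℝ ∞ (f i) p := (hf i).contDiffAt ((F.isOpen i).mem_nhds hp)
  have hd : DifferentiableAt ℝ (fderiv ℝ (f i)) p :=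
    (hc.fderiv_right (m := ∞) (by simp)).differentiableAt (by simp)
  have hs : IsSymmSndFDerivAt ℝ (f i) p := (contDiffAt_infty.1 hc 2).isSymmSndFDerivAt (by simp)
  unfold Frame.der
  simp only [hv, hw]
  rw [fderiv_clm_apply hd (differentiableAt_const _),
    fderiv_clm_apply hd (differentiableAt_const _)]
  simpa using hs v w

/-- The field is tangent to the slice `y = y₀`, on which `f` is constant. -/
theorem der_eq_zero_of_boundary {Λ : Type} [NormedAddCommGroup Λ] [NormedSpace ℝ Λ]
    {F : Frame ι (ℝ × Λ)} {f : ι → ℝ × Λ → ℝ} {y₀ c : ℝ} (hf : F.Smooth f)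
    (hf₀ : ∀ i l, (y₀, l) ∈ F.dom i → f i (y₀, l) = c) {z : F.κ} {w : Λ}
    (hw : ∀ p, F.X z p = (0, w)) {i : ι} {l : Λ} (hl : (y₀, l) ∈ F.dom i) :
    F.der z f i (y₀, l) = 0 := by
  have hd := hf.differentiableAt hl
  have h1 := hd.hasFDerivAt.comp_hasDerivAt_of_eq (0 : ℝ)
    ((hasDerivAt_const (0 : ℝ) y₀).prodMk
      (((hasDerivAt_id (0 : ℝ)).smul_const w).const_add l)) (by simp)
  have hev : (f i ∘ fun x : ℝ => (y₀, l + id x • w)) =ᶠ[nhds 0] fun _ => c := by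
    have hc : Continuous fun x : ℝ => ((y₀, l + x • w) : ℝ × Λ) := by fun_prop
    have : (fun x : ℝ => ((y₀, l + x • w) : ℝ × Λ)) ⁻¹' F.dom i ∈ nhds (0 : ℝ) :=
      hc.continuousAt.preimage_mem_nhds ((F.isOpen i).mem_nhds (by simpa using hl))
    filter_upwards [this] with x hx
    exact hf₀ i _ hx
  have h2 := h1.unique ((hasDerivAt_const (0 : ℝ) c).congr_of_eventuallyEq hev)
  simp only [Frame.der, hw]
  simpa using h2

end Frame

/-- Symbol estimates for solutions of linear equations along the first variable. -/
theorem Frame.Sym.linear_ode {ι Λ : Type} [NormedAddCommGroup Λ] [NormedSpace ℝ Λ]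
    {F : Frame ι (ℝ × Λ)} {z₀ : F.κ} (hz₀ : ∀ p, F.X z₀ p = (1, 0))
    (hz : ∀ z, z ≠ z₀ → ∃ w : Λ, ∀ p, F.X z p = (0, w)) {y₀ : ℝ}
    (hseg : ∀ i y l, (y, l) ∈ F.dom i → ∀ y' ∈ Set.uIcc y₀ y,
      (y', l) ∈ F.dom i ∧ F.ρ (y', l) = F.ρ (y, l) ∧ F.W i (y', l) ≤ F.W i (y, l))
    (hlen : ∃ K : ℝ, 0 ≤ K ∧ ∃ C : ℕ, ∀ i y l, (y, l) ∈ F.dom i →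
      |y - y₀| ≤ K * F.W i (y, l) ^ C)
    {β : ι → ℝ × Λ → ℝ}
    (hexp : ∃ K : ℝ, 0 ≤ K ∧ ∃ C : ℕ, ∀ i y l, (y, l) ∈ F.dom i → ∀ y' ∈ Set.uIcc y₀ y,
      Real.exp (∫ τ in y'..y, β i (τ, l)) ≤ K * F.W i (y, l) ^ C)
    {n : ℕ} {k : ℤ} (hβ : F.Sym n 0 β) {b f : ι → ℝ × Λ → ℝ} (hb : F.Sym n k b)
    (hf : F.Smooth f) (hf₀ : ∀ i l, (y₀, l) ∈ F.dom i → f i (y₀, l) = 0)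
    (hode : ∀ i, ∀ p ∈ F.dom i, F.der z₀ f i p = β i p * f i p + b i p) : F.Sym n k f := by
  have main : ∀ b f : ι → ℝ × Λ → ℝ, F.Bd k b → F.Smooth f →
      (∀ i l, (y₀, l) ∈ F.dom i → f i (y₀, l) = 0) →
      (∀ i, ∀ p ∈ F.dom i, F.der z₀ f i p = β i p * f i p + b i p) → F.Bd k f := by
    rintro b f ⟨K₁, hK₁, C₁, H₁⟩ hf hf₀ hode
    obtain ⟨K₂, hK₂, C₂, H₂⟩ := hlen
    obtain ⟨K₃, hK₃, C₃, H₃⟩ := hexp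
    refine ⟨K₃ * K₁ * K₂, by positivity, C₃ + C₁ + C₂, ?_⟩
    rintro i ⟨y, l⟩ hp
    have hU : IsOpen {τ : ℝ | (τ, l) ∈ F.dom i} :=
      (F.isOpen i).preimage (by fun_prop : Continuous fun τ : ℝ => (τ, l))
    have hbound := linear_ode_bound (β := fun τ => β i (τ, l)) (b := fun τ => b i (τ, l))
      (F := fun τ => f i (τ, l)) hU (y₀ := y₀) (y := y) (fun τ hτ => (hseg i y l hp τ hτ).1)
      ((hβ.smooth i).continuousOn.comp (by fun_prop) (fun τ hτ => hτ)) (fun τ hτ => ?_)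
      (hf₀ i l (hseg i y l hp y₀ Set.left_mem_uIcc).1)
      (B := K₁ * F.ρ (y, l) ^ k * F.W i (y, l) ^ C₁) (fun τ hτ => ?_) (H₃ i y l hp)
    · have h1 := H₂ i y l hp
      have h2 := (zpow_nonneg F hp k).le
      have h3 := fun C => (F.W_pow_pos hp C).le
      refine hbound.trans ?_
      calc _ ≤ K₃ * F.W i (y, l) ^ C₃ * (K₁ * F.ρ (y, l) ^ k * F.W i (y, l) ^ C₁) *
            (K₂ * F.W i (y, l) ^ C₂) := by
              refine mul_le_mul_of_nonneg_left h1 ?_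
              have := h3 C₁; have := h3 C₃
              positivity
        _ = _ := by ring
    · have hd := hf.differentiableAt (hseg i y l hp τ hτ).1
      have := hd.hasFDerivAt.comp_hasDerivAt τ
        ((hasDerivAt_id τ).prodMk (hasDerivAt_const τ l))
      have h2 := hode i _ (hseg i y l hp τ hτ).1
      simp only [Frame.der, hz₀] at h2
      rw [h2] at this
      exact this
    · obtain ⟨hm, hρ, hW⟩ := hseg i y l hp τ hτ
      refine (H₁ i _ hm).trans ?_
      rw [hρ]
      have h2 := (zpow_nonneg F hp k).le
      have := F.one_le_W i _ hm
      gcongr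
  induction n generalizing b f with
  | zero => exact ⟨hf, main b f hb.2 hf hf₀ hode⟩
  | succ n ih =>
    have hf' := ih hβ.pred hb.pred hf hf₀ hode
    refine ⟨hf, hf'.bd, fun z => ?_⟩
    -- Along `z₀` the equation itself is the derivative. Any other field is constant and commutes
    -- with `z₀`, so the derivative of `f` solves an equation with the same coefficient `β`, zero
    -- data, and a source involving only `f`, which is already controlled. The exponential bound is
    -- reused unchanged.
    by_cases h : z = z₀
    · subst h
      exact ((hβ.pred.mul' hf' (zero_add k)).add hb.pred).congr hode
    · obtain ⟨w, hw⟩ := hz z h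
      refine ih hβ.pred (((hβ.2.2 z).mul' hf' (zero_add k)).add (hb.2.2 z)) (hf.der z)
        (fun i l hl => ?_) (fun i p hp => ?_)
      · exact der_eq_zero_of_boundary hf hf₀ hw hl
      · rw [der_comm hf hz₀ hw hp, der_congr hode z i p hp]
        have e1 := fderiv_fun_add ((hβ.smooth.differentiableAt hp).fun_mul (hf.differentiableAt hp))
          (hb.smooth.differentiableAt hp)
        have e2 := fderiv_fun_mul (hβ.smooth.differentiableAt hp) (hf.differentiableAt hp)
        simp only [Frame.der]
        rw [e1, e2]
        simp only [add_apply, smul_apply, smul_eq_mul]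
        ring

end QuasilinearWave

end

noncomputable section

namespace QuasilinearWave

/-! ### The characteristic equation with coefficients extended off the sphere -/

/-- Smooth compactly supported coefficients, vanishing for `|p| > R`. -/
structure IsCoeff (R : ℝ) (a : ℝ × Space → ℝ) : Prop where
  smooth : ContDiff ℝ ∞ a
  compact : HasCompactSupport a
  supp : ∀ p x, p ∉ Set.Icc (-R) R → a (p, x) = 0

/-- The speed `-2 exp (a(q, x) s)`. -/
def speed (a : ℝ × Space → ℝ) (s q : ℝ) (x : Space) : ℝ := -2 * Real.exp (a (q, x) * s)

/-- The characteristic equation in logarithmic time. -/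
def logField (a : ℝ × Space → ℝ) (ε δ : ℝ) (w : ℝ × (ℝ × (ℝ × Space))) : ℝ :=
  Real.exp (w.2.2.1 + w.1) *
    speed a (ε * (w.2.2.1 + w.1) - δ) (-Real.exp w.2.2.1 + w.2.1) w.2.2.2

variable {R : ℝ} {a : ℝ × Space → ℝ}

theorem IsCoeff.logField_smooth (ha : IsCoeff R a) (ε δ : ℝ) : ContDiff ℝ ∞ (logField a ε δ) := by
  have := ha.smooth
  unfold logField speed
  fun_prop

/-- Where the coefficient vanishes the field is `-2 exp` of a linear form that does not involve the
unknown `y`. The other values of the unknown lie in a compact set, locally uniformly in time and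
parameters. -/
theorem IsCoeff.logField_lipschitz (ha : IsCoeff R a) (ε δ : ℝ) :
    LocallyLipschitzODE (logField a ε δ) := by
  intro M l₀
  have hc : Continuous (fderiv ℝ (logField a ε δ)) :=
    (ha.logField_smooth ε δ).continuous_fderiv (by simp)
  -- The unknown is `y = q + e^{l.1}`, and `l.1 ≤ l₀.1 + 1` on the unit ball; hence `|y| > Y` forces
  -- `|q| > R`.
  set Y : ℝ := |R| + Real.exp (l₀.1 + 1)
  obtain ⟨B, hB⟩ := ((isCompact_Icc (a := -M) (b := M)).prod
    ((isCompact_Icc (a := -Y) (b := Y)).prod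
      (isCompact_closedBall l₀ 1))).exists_bound_of_continuousOn hc.continuousOn
  let c : (ℝ × (ℝ × (ℝ × Space))) →L[ℝ] ℝ :=
    (ContinuousLinearMap.fst ℝ ℝ Space).comp ((ContinuousLinearMap.snd ℝ ℝ (ℝ × Space)).comp
      (ContinuousLinearMap.snd ℝ ℝ (ℝ × (ℝ × Space)))) +
      ContinuousLinearMap.fst ℝ ℝ (ℝ × (ℝ × Space))
  refine ⟨max B (2 * Real.exp (l₀.1 + 1 + M) * ‖c‖), 1, one_pos, fun θ hθ y l hl => ?_⟩
  have hl1 : |l.1 - l₀.1| ≤ 1 := by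
    have h1 : dist l l₀ < 1 := hl
    have h2 : dist l.1 l₀.1 ≤ dist l l₀ := le_max_left _ _
    rw [Real.dist_eq] at h2
    linarith
  by_cases hy : |y| ≤ Y
  · exact (hB (θ, (y, l)) ⟨abs_le.1 hθ, abs_le.1 hy, Metric.ball_subset_closedBall hl⟩).trans
      (le_max_left _ _)
  · have hopen : IsOpen {w : ℝ × (ℝ × (ℝ × Space)) | R < |-Real.exp w.2.2.1 + w.2.1|} :=
      isOpen_lt continuous_const (by fun_prop)
    have hmem : R < |-Real.exp l.1 + y| := by
      have h1 : Real.exp l.1 ≤ Real.exp (l₀.1 + 1) :=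
        Real.exp_le_exp.2 (by linarith [(abs_le.1 hl1).2])
      have h2 := abs_sub_abs_le_abs_sub y (Real.exp l.1)
      rw [abs_of_pos (Real.exp_pos l.1)] at h2
      have h3 : |-Real.exp l.1 + y| = |y - Real.exp l.1| := by congr 1; ring
      rw [h3]
      have := le_abs_self R
      simp only [Y] at hy
      linarith
    have hev : logField a ε δ =ᶠ[nhds (θ, (y, l))] fun w => -2 * Real.exp (c w) := by
      filter_upwards [hopen.mem_nhds hmem] with w hw
      have : a (-Real.exp w.2.2.1 + w.2.1, w.2.2.2) = 0 := by
        refine ha.supp _ _ fun h => ?_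
        exact absurd (abs_le.2 h) (not_le.2 hw)
      simp only [logField, speed, this, c]
      simp
      ring
    have hfd : HasFDerivAt (fun w => -2 * Real.exp (c w))
        ((-2 : ℝ) • (Real.exp (c (θ, (y, l))) • c)) (θ, (y, l)) :=
      (c.hasFDerivAt.exp).const_mul (-2)
    rw [hev.fderiv_eq, hfd.fderiv]
    refine le_trans ?_ (le_max_right _ _)
    rw [norm_smul, norm_smul, Real.norm_eq_abs, Real.norm_eq_abs, Real.abs_exp, ← mul_assoc]
    norm_num
    refine mul_le_mul_of_nonneg_right ?_ (norm_nonneg _)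
    refine mul_le_mul_of_nonneg_left (Real.exp_le_exp.2 ?_) zero_le_two
    simp only [c]
    simp
    linarith [(abs_le.1 hl1).2, (abs_le.1 hθ).2]

/-- This is the Lipschitz bound for `logField` on the ray `v = 1`, where the logarithmic time is
`log t` and the unknown is `q + 1`. -/
theorem IsCoeff.speed_lipschitz (ha : IsCoeff R a) (ε δ M : ℝ) (x : Space) :
    ∃ L, ∀ t, 0 < t → |Real.log t| ≤ M → ∀ q q',
      |t * speed a (ε * Real.log t - δ) q x - t * speed a (ε * Real.log t - δ) q' x|
        ≤ L * |q - q'| := by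
  obtain ⟨L, r, hr, H⟩ := ha.logField_lipschitz ε δ M (0, x)
  refine ⟨L, fun t ht hM q q' => ?_⟩
  have h1 := meanFDeriv_apply (ha.logField_smooth ε δ) (Real.log t) (q' + 1) (q + 1)
    ((0, x) : ℝ × Space) (0, x)
  have h2 := norm_meanFDeriv_le (f := logField a ε δ) (y₀ := q' + 1) (y₁ := q + 1)
    (Metric.mem_ball_self hr) (H (Real.log t) hM)
  have h3 : ‖((0, (1, 0)) : ℝ × (ℝ × (ℝ × Space)))‖ = 1 := by simp [Prod.norm_def]
  have h4 := (ContinuousLinearMap.le_opNorm (meanFDeriv (logField a ε δ) (Real.log t) (q' + 1)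
    (q + 1) ((0, x) : ℝ × Space) (0, x)) (0, (1, 0))).trans
    (mul_le_mul_of_nonneg_right h2 (norm_nonneg _))
  rw [h3, mul_one, Real.norm_eq_abs] at h4
  simp only [logField, zero_add, Real.exp_log ht, sub_self, Real.exp_zero] at h1
  rw [show ((0 : ℝ), ((0 : ℝ), (0 : ℝ × Space))) = 0 from rfl, map_zero, add_zero] at h1
  rw [show (-1 : ℝ) + (q + 1) = q by ring, show (-1 : ℝ) + (q' + 1) = q' by ring,
    show q + 1 - (q' + 1) = q - q' by ring] at h1
  rw [h1, abs_mul]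
  exact mul_le_mul_of_nonneg_right h4 (abs_nonneg _)

/-- With `t = v e^θ` and `q = -v + Z` the equation becomes an ODE for `Z` on the whole line, with `Z
= 0` at `θ = 0` and parameters `(log v, x)` ranging over a vector space. The constraints `t > 0` and
`v > 0` disappear, and global existence and smooth dependence apply directly. -/
theorem IsCoeff.exists_flow (ha : IsCoeff R a) (ε δ : ℝ) :
    ∃ Q : ℝ × (ℝ × Space) → ℝ, ContDiffOn ℝ ∞ Q {w | 0 < w.1 ∧ 0 < w.2.1} ∧
      (∀ v x, 0 < v → Q (v, (v, x)) = -v) ∧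
      ∀ t v x, 0 < t → 0 < v → HasDerivAt (fun t => Q (t, (v, x)))
        (speed a (ε * Real.log t - δ) (Q (t, (v, x))) x) t := by
  have hsm := ha.logField_smooth ε δ
  have hZ : ∀ l : ℝ × Space, ∃ Z : ℝ → ℝ, Z 0 = 0 ∧
      ∀ θ, HasDerivAt Z (logField a ε δ (θ, (Z θ, l))) θ := by
    intro l
    have hlip : ∀ M, ∃ L, ∀ θ, |θ| ≤ M → ∀ y y',
        |logField a ε δ (θ, (y, l)) - logField a ε δ (θ, (y', l))| ≤ L * |y - y'| := by
      intro M
      obtain ⟨L, r, hr, H⟩ := ha.logField_lipschitz ε δ M l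
      refine ⟨L, fun θ hθ y y' => ?_⟩
      have h1 := meanFDeriv_apply hsm θ y' y l l
      have h2 := norm_meanFDeriv_le (f := logField a ε δ) (y₀ := y') (y₁ := y)
        (Metric.mem_ball_self hr) (H θ hθ)
      have h3 : ‖((0, (1, 0)) : ℝ × (ℝ × (ℝ × Space)))‖ = 1 := by simp [Prod.norm_def]
      have h4 := (ContinuousLinearMap.le_opNorm (meanFDeriv (logField a ε δ) θ y' y l l)
        (0, (1, 0))).trans (mul_le_mul_of_nonneg_right h2 (norm_nonneg _))
      rw [h3, mul_one, Real.norm_eq_abs] at h4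
      rw [sub_self, show ((0 : ℝ), ((0 : ℝ), (0 : ℝ × Space))) = 0 from rfl, map_zero,
        add_zero] at h1
      rw [h1, abs_mul]
      exact mul_le_mul_of_nonneg_right h4 (abs_nonneg _)
    refine exists_global_ode (f := fun θ y => logField a ε δ (θ, (y, l)))
      ((hsm.of_le (by simp)).comp (by fun_prop)) (fun M => ?_) hlip
    obtain ⟨B, hB⟩ := ha.compact.exists_bound_of_continuous ha.smooth.continuous
    refine ⟨Real.exp (l.1 + M) * (2 * Real.exp (B * (|ε| * (|l.1| + M) + |δ|))),
      fun θ hθ y => ?_⟩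
    simp only [logField, speed]
    have hB0 : 0 ≤ B := (norm_nonneg _).trans (hB 0)
    rw [abs_mul, abs_mul, Real.abs_exp, Real.abs_exp, abs_neg, abs_two]
    refine mul_le_mul (Real.exp_le_exp.2 ?_)
      (mul_le_mul_of_nonneg_left (Real.exp_le_exp.2 ?_) zero_le_two) (by positivity)
      (by positivity)
    · linarith [(abs_le.1 hθ).2]
    · refine (le_abs_self _).trans ?_
      rw [abs_mul]
      refine mul_le_mul (hB _) ?_ (abs_nonneg _) hB0
      refine (abs_sub _ _).trans ?_
      rw [abs_mul]
      gcongr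
      exact (abs_add_le _ _).trans (by linarith)
  choose Z hZ0 hZd using hZ
  have hZs : ContDiff ℝ ∞ (fun q : ℝ × (ℝ × Space) => Z q.2 q.1) :=
    contDiff_ode (Z := fun θ l => Z l θ) hsm hZ0 (fun θ l => hZd l θ)
      (ha.logField_lipschitz ε δ)
  refine ⟨fun w => -w.2.1 + Z (Real.log w.2.1, w.2.2) (Real.log w.1 - Real.log w.2.1), ?_, ?_, ?_⟩
  · refine ContDiffOn.add (by fun_prop) ?_
    refine hZs.comp_contDiffOn (g := fun q : ℝ × (ℝ × Space) => Z q.2 q.1)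
      (f := fun w : ℝ × (ℝ × Space) =>
        (Real.log w.1 - Real.log w.2.1, (Real.log w.2.1, w.2.2))) ?_
    have h1 : ContDiffOn ℝ ∞ (fun w : ℝ × (ℝ × Space) => Real.log w.1)
        {w | 0 < w.1 ∧ 0 < w.2.1} := contDiffOn_fst.log fun w hw => hw.1.ne'
    have h2 : ContDiffOn ℝ ∞ (fun w : ℝ × (ℝ × Space) => Real.log w.2.1)
        {w | 0 < w.1 ∧ 0 < w.2.1} := ContDiffOn.log (by fun_prop) fun w hw => hw.2.ne'
    exact (h1.sub h2).prodMk (h2.prodMk (by fun_prop))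
  · intro v x _
    simp [hZ0]
  · intro t v x ht hv
    have h1 : HasDerivAt (fun t => Real.log t - Real.log v) t⁻¹ t :=
      (Real.hasDerivAt_log ht.ne').sub_const _
    have h2 := ((hZd (Real.log v, x) (Real.log t - Real.log v)).comp t h1).const_add (-v)
    refine h2.congr_deriv ?_
    simp only [logField]
    rw [add_sub_cancel, Real.exp_log ht, Real.exp_log hv]
    field_simp

/-- The solution of the characteristic equation at time `t` on the ray `t + r = v`. -/
def IsCoeff.flow (ha : IsCoeff R a) (ε δ : ℝ) : ℝ × (ℝ × Space) → ℝ :=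
  (ha.exists_flow ε δ).choose

theorem IsCoeff.flow_smooth (ha : IsCoeff R a) (ε δ : ℝ) :
    ContDiffOn ℝ ∞ (ha.flow ε δ) {w | 0 < w.1 ∧ 0 < w.2.1} := (ha.exists_flow ε δ).choose_spec.1

theorem IsCoeff.flow_boundary (ha : IsCoeff R a) (ε δ : ℝ) {v : ℝ} (hv : 0 < v) (x : Space) :
    ha.flow ε δ (v, (v, x)) = -v := (ha.exists_flow ε δ).choose_spec.2.1 v x hv

theorem IsCoeff.flow_deriv (ha : IsCoeff R a) (ε δ : ℝ) {t v : ℝ} (ht : 0 < t) (hv : 0 < v)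
    (x : Space) : HasDerivAt (fun t => ha.flow ε δ (t, (v, x)))
      (speed a (ε * Real.log t - δ) (ha.flow ε δ (t, (v, x))) x) t :=
  (ha.exists_flow ε δ).choose_spec.2.2 t v x ht hv

/-- Grönwall's inequality run backwards: `(φ₁ - φ₂)² e^{2Kτ}` is nondecreasing, so its vanishing at
`v` forces it to vanish earlier. Derivatives are taken only in the open interval because an optical
function is merely continuous up to the axis `r = 0`, which corresponds to `t = v`. -/
theorem IsCoeff.speed_unique (ha : IsCoeff R a) {ε δ t₀ v : ℝ} {x : Space} (ht₀ : 0 < t₀)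
    {φ₁ φ₂ : ℝ → ℝ} (hc₁ : ContinuousOn φ₁ (Set.Icc t₀ v)) (hc₂ : ContinuousOn φ₂ (Set.Icc t₀ v))
    (hd₁ : ∀ t ∈ Set.Ioo t₀ v, HasDerivAt φ₁ (speed a (ε * Real.log t - δ) (φ₁ t) x) t)
    (hd₂ : ∀ t ∈ Set.Ioo t₀ v, HasDerivAt φ₂ (speed a (ε * Real.log t - δ) (φ₂ t) x) t)
    (hv : φ₁ v = φ₂ v) : ∀ t ∈ Set.Icc t₀ v, φ₁ t = φ₂ t := by
  intro t ht
  obtain ⟨L, hL⟩ := ha.speed_lipschitz ε δ (max |Real.log t₀| |Real.log v|) x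
  have hLt : ∀ τ ∈ Set.Ioo t₀ v, ∀ q q', |speed a (ε * Real.log τ - δ) q x -
      speed a (ε * Real.log τ - δ) q' x| ≤ |L| / t₀ * |q - q'| := by
    intro τ hτ q q'
    have hτ0 : 0 < τ := ht₀.trans hτ.1
    have hlog : |Real.log τ| ≤ max |Real.log t₀| |Real.log v| :=
      abs_le_max_abs_abs (Real.log_le_log ht₀ hτ.1.le) (Real.log_le_log hτ0 hτ.2.le)
    have h1 := hL τ hτ0 hlog q q'
    rw [← mul_sub, abs_mul, abs_of_pos hτ0] at h1
    rw [div_mul_eq_mul_div, le_div_iff₀ ht₀]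
    calc _ ≤ |speed a (ε * Real.log τ - δ) q x - speed a (ε * Real.log τ - δ) q' x| * τ := by
          gcongr; exact hτ.1.le
      _ ≤ L * |q - q'| := by linarith
      _ ≤ |L| * |q - q'| := by gcongr; exact le_abs_self L
  set K := |L| / t₀
  set h : ℝ → ℝ := fun τ => (φ₁ τ - φ₂ τ) ^ 2 * Real.exp (2 * K * τ) with hh
  have hmono : MonotoneOn h (Set.Icc t₀ v) := by
    refine monotoneOn_of_hasDerivWithinAt_nonneg (convex_Icc t₀ v)
      (((hc₁.sub hc₂).pow 2).mul (by fun_prop)) (f' := fun τ =>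
        (2 * (φ₁ τ - φ₂ τ) * (speed a (ε * Real.log τ - δ) (φ₁ τ) x -
          speed a (ε * Real.log τ - δ) (φ₂ τ) x) + 2 * K * (φ₁ τ - φ₂ τ) ^ 2) *
          Real.exp (2 * K * τ)) (fun τ hτ => ?_) (fun τ hτ => ?_)
    · rw [interior_Icc] at hτ
      have h1 := ((hd₁ τ hτ).sub (hd₂ τ hτ)).pow 2
      have h2 : HasDerivAt (fun τ : ℝ => Real.exp (2 * K * τ)) (Real.exp (2 * K * τ) * (2 * K)) τ := by
        simpa using ((hasDerivAt_id τ).const_mul (2 * K)).exp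
      refine ((h1.mul h2).congr_deriv ?_).hasDerivWithinAt
      simp
      ring
    · rw [interior_Icc] at hτ
      refine mul_nonneg ?_ (Real.exp_pos _).le
      have h1 := hLt τ hτ (φ₁ τ) (φ₂ τ)
      have h2 := mul_le_mul_of_nonneg_left h1 (abs_nonneg (φ₁ τ - φ₂ τ))
      rw [← abs_mul] at h2
      have h3 := neg_abs_le ((φ₁ τ - φ₂ τ) * (speed a (ε * Real.log τ - δ) (φ₁ τ) x -
          speed a (ε * Real.log τ - δ) (φ₂ τ) x))
      have h4 := sq_abs (φ₁ τ - φ₂ τ)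
      have h5 : |φ₁ τ - φ₂ τ| * (K * |φ₁ τ - φ₂ τ|) = K * (φ₁ τ - φ₂ τ) ^ 2 := by
        rw [← h4]
        ring
      linarith
  have hle := hmono ht (Set.right_mem_Icc.2 (ht.1.trans ht.2)) ht.2
  have h0 : h v = 0 := by simp [hh, hv]
  rw [h0] at hle
  have h1 : (φ₁ t - φ₂ t) ^ 2 ≤ 0 := by
    by_contra hcon
    push Not at hcon
    exact absurd hle (not_le.2 (mul_pos hcon (Real.exp_pos _)))
  have := pow_eq_zero_iff (two_ne_zero) |>.1 (le_antisymm h1 (sq_nonneg _))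
  linarith

/-- Going back in time from the axis, the characteristic has speed `-2` as long as `v - 2t` stays
below `-R`. The time `(v + R)/2` at which it reaches the support of `a` is the origin of the
coordinate `y` of `frameP`. -/
theorem IsCoeff.flow_eq_linear (ha : IsCoeff R a) (ε δ : ℝ) {t v : ℝ} (x : Space) (hv : 0 < v)
    (hR : 0 < v + R) (ht : (v + R) / 2 ≤ t) (htv : t ≤ v) : ha.flow ε δ (t, (v, x)) = v - 2 * t := by
  refine ha.speed_unique (ε := ε) (δ := δ) (x := x) (t₀ := (v + R) / 2) (v := v) (by linarith)
    (φ₁ := fun t => ha.flow ε δ (t, (v, x))) (φ₂ := fun t => v - 2 * t)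
    (fun τ hτ => (ha.flow_deriv ε δ (by linarith [hτ.1]) hv x).continuousAt.continuousWithinAt)
    (by fun_prop) (fun τ hτ => ha.flow_deriv ε δ (by linarith [hτ.1]) hv x) (fun τ hτ => ?_)
    (by rw [ha.flow_boundary ε δ hv]; ring) t ⟨ht, htv⟩
  have h0 : a (v - 2 * τ, x) = 0 := ha.supp _ _ fun h => by linarith [h.1, hτ.1]
  refine (((hasDerivAt_id τ).const_mul 2).const_sub v).congr_deriv ?_
  simp [speed, h0]

end QuasilinearWave

end

noncomputable section

namespace QuasilinearWave

/-! ### Extension of the data from the sphere -/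

/-- Smoothness of `A` is available only on the sphere as a manifold, so `x/|x|` is replaced near
`x₀` by a globally smooth map into the sphere. Damping the displacement `x - x₀` by a bump function
keeps it shorter than `|x₀|`, and the vector to be normalized never vanishes. -/
theorem exists_local_direction {x₀ : Space} (h₀ : x₀ ≠ 0) :
    ∃ N : Space → Sphere2, ContMDiff 𝓘(ℝ, Space) (𝓡 2) ∞ N ∧ N =ᶠ[nhds x₀] dir := by
  have hn : 0 < ‖x₀‖ := norm_pos_iff.2 h₀
  let φ : ContDiffBump x₀ := ⟨‖x₀‖ / 4, ‖x₀‖ / 2, by linarith, by linarith⟩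
  let w : Space → Space := fun x => x₀ + φ x • (x - x₀)
  have hws : ContDiff ℝ ∞ w := contDiff_const.add (φ.contDiff.smul (by fun_prop))
  have hw : ∀ x, w x ≠ 0 := by
    intro x hx
    have h1 : ‖φ x • (x - x₀)‖ < ‖x₀‖ := by
      by_cases hxm : x ∈ Metric.ball x₀ φ.rOut
      · rw [norm_smul, Real.norm_of_nonneg φ.nonneg]
        have h2 : ‖x - x₀‖ < ‖x₀‖ / 2 := by simpa [dist_eq_norm] using hxm
        have := mul_le_of_le_one_left (norm_nonneg (x - x₀)) (φ.le_one (x := x))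
        linarith
      · rw [φ.zero_of_le_dist (by simpa using hxm)]
        simpa using hn
    have h3 : x₀ = -(φ x • (x - x₀)) := eq_neg_of_add_eq_zero_left hx
    rw [← norm_neg, ← h3] at h1
    exact lt_irrefl _ h1
  have hu : ContDiff ℝ ∞ fun x => ‖w x‖⁻¹ • w x :=
    (((hws.norm ℝ hw).inv fun x => norm_ne_zero_iff.2 (hw x))).smul hws
  have : Fact (Module.finrank ℝ Space = 2 + 1) := ⟨by simp⟩
  have hmem : ∀ x, ‖w x‖⁻¹ • w x ∈ Metric.sphere (0 : Space) 1 := fun x => by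
    simp [norm_smul, inv_mul_cancel₀ (norm_ne_zero_iff.mpr (hw x))]
  refine ⟨Set.codRestrict _ _ hmem, ContMDiff.codRestrict_sphere hu.contMDiff hmem, ?_⟩
  filter_upwards [Metric.ball_mem_nhds x₀ φ.rIn_pos] with x hx
  have h1 : φ x = 1 := φ.one_of_mem_closedBall (Metric.ball_subset_closedBall hx)
  have h2 : w x = x := by simp [w, h1]
  have h3 : x ≠ 0 := h2 ▸ hw x
  apply Subtype.ext
  simp [Set.codRestrict, h2, dir, h3]

/-- The extension is homogeneous of degree zero near the sphere and is cut off away from it. It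
allows the parameter `ω` to be replaced by `x` in a vector space, where partial derivatives make
sense. -/
theorem exists_extension {A : ℝ × Sphere2 → ℝ}
    (hA : ContMDiff (𝓘(ℝ, ℝ).prod (𝓡 2)) 𝓘(ℝ, ℝ) ∞ A) {R : ℝ}
    (hsupp : tsupport A ⊆ Set.Icc (-R) R ×ˢ Set.univ) :
    ∃ b : ℝ × Space → ℝ, IsCoeff R b ∧ ∀ p (θ : Sphere2), b (p, (θ : Space)) = A (p, θ) := by
  -- These radii make `χ(|x|²)` vanish unless `½ < |x|² < 3/2`, hence near the origin, where the
  -- direction is singular.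
  let χ : ContDiffBump (1 : ℝ) := ⟨1 / 4, 1 / 2, by norm_num, by norm_num⟩
  have hA0 : ∀ p θ, p ∉ Set.Icc (-R) R → A (p, θ) = 0 := fun p θ hp => by
    by_contra hne
    exact hp (hsupp (subset_tsupport A (Function.mem_support.2 hne))).1
  have hχ0 : ∀ x : Space, ‖x‖ ^ 2 ≤ 1 / 2 ∨ 3 / 2 ≤ ‖x‖ ^ 2 → χ (‖x‖ ^ 2) = 0 := fun x hx => by
    refine χ.zero_of_le_dist ?_
    rw [Real.dist_eq]
    change (1 : ℝ) / 2 ≤ _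
    rcases hx with h | h
    · exact le_abs.2 (Or.inr (by linarith))
    · exact le_abs.2 (Or.inl (by linarith))
  refine ⟨fun w => χ (‖w.2‖ ^ 2) * A (w.1, dir w.2), ⟨?_, ?_, ?_⟩, ?_⟩
  · rw [contDiff_iff_contDiffAt]
    rintro ⟨p, x⟩
    by_cases hx : x = 0
    · have : (fun w : ℝ × Space => χ (‖w.2‖ ^ 2) * A (w.1, dir w.2)) =ᶠ[nhds (p, x)] fun _ => 0 := by
        have hopen : IsOpen {w : ℝ × Space | ‖w.2‖ ^ 2 < 1 / 2} :=
          isOpen_lt (by fun_prop) continuous_const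
        filter_upwards [hopen.mem_nhds (show ‖((p, x) : ℝ × Space).2‖ ^ 2 < 1 / 2 by simp [hx])]
          with w hw
        rw [hχ0 _ (Or.inl hw.le), zero_mul]
      exact contDiffAt_const.congr_of_eventuallyEq this
    · obtain ⟨N, hN, hNe⟩ := exists_local_direction hx
      have h1 : ContDiff ℝ ∞ fun w : ℝ × Space => A (w.1, N w.2) := by
        rw [← contMDiff_iff_contDiff]
        exact hA.comp (ContMDiff.prodMk contDiff_fst.contMDiff (hN.comp contDiff_snd.contMDiff))
      have h2 : (fun w : ℝ × Space => χ (‖w.2‖ ^ 2) * A (w.1, dir w.2)) =ᶠ[nhds (p, x)]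
          fun w => χ (‖w.2‖ ^ 2) * A (w.1, N w.2) := by
        have : ∀ᶠ w : ℝ × Space in nhds (p, x), N w.2 = dir w.2 :=
          (continuous_snd.tendsto (p, x)).eventually hNe
        filter_upwards [this] with w hw
        rw [hw]
      refine ContDiffAt.congr_of_eventuallyEq ?_ h2
      exact ((χ.contDiff.comp (contDiff_snd.norm_sq ℝ)).mul h1).contDiffAt
  · refine HasCompactSupport.intro ((isCompact_Icc (a := -R) (b := R)).prod
      (isCompact_closedBall (0 : Space) 2)) fun w hw => ?_
    by_cases h : w.1 ∈ Set.Icc (-R) R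
    · have h2 : 2 < ‖w.2‖ := by
        by_contra hcon
        exact hw ⟨h, by simpa using hcon⟩
      have : χ (‖w.2‖ ^ 2) = 0 := hχ0 _ (Or.inr (by nlinarith))
      simp [this]
    · simp [hA0 _ _ h]
  · intro p x hp
    simp [hA0 _ _ hp]
  · intro p θ
    have h1 : ‖(θ : Space)‖ = 1 := by simp
    have h0 : (θ : Space) ≠ 0 := norm_ne_zero_iff.1 (by rw [h1]; exact one_ne_zero)
    have h2 : dir (θ : Space) = θ := Subtype.ext (by simp [dir, h0, h1])
    have h3 : χ (‖(θ : Space)‖ ^ 2) = 1 :=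
      χ.one_of_mem_closedBall (by rw [h1, one_pow]; exact Metric.mem_closedBall_self (by positivity))
    simp only [h2, h3, one_mul]

/-- The covector `(-1, x)`. -/
def hat (x : Space) : Fin 4 → ℝ := Fin.cons (-1 : ℝ) (fun i : Fin 3 => x i)

/-- The quadratic polynomial extending `G`. -/
def quadG (g : Fin 4 → Fin 4 → ℝ → ℝ) (x : Space) : ℝ :=
  ∑ α, ∑ β, deriv (g α β) 0 * hat x α * hat x β

theorem quadG_smooth (g : Fin 4 → Fin 4 → ℝ → ℝ) : ContDiff ℝ ∞ (quadG g) := by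
  unfold quadG
  refine ContDiff.sum fun α _ => ContDiff.sum fun β _ => ?_
  have : ∀ γ, ContDiff ℝ ∞ fun x => hat x γ := by
    intro γ
    refine Fin.cases ?_ (fun i => ?_) γ
    · simpa [hat] using contDiff_const
    · simp only [hat, Fin.cons_succ]
      fun_prop
  exact (contDiff_const.mul (this α)).mul (this β)

theorem IsCoeff.half_quadG_mul {R : ℝ} {b : ℝ × Space → ℝ} (hb : IsCoeff R b)
    (g : Fin 4 → Fin 4 → ℝ → ℝ) : IsCoeff R fun w => 1 / 2 * quadG g w.2 * b w := by
  have := quadG_smooth g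
  have := hb.smooth
  refine ⟨by fun_prop, ?_, fun p x hp => by simp [hb.supp p x hp]⟩
  exact hb.compact.mul_left (f := fun w : ℝ × Space => 1 / 2 * quadG g w.2)

/-- The profile `∫_{-R}^q b(p, x) exp (-a(p, x) s) dp` at `(q, s, x)`. -/
def prof (a b : ℝ × Space → ℝ) (R : ℝ) (w : ℝ × (ℝ × Space)) : ℝ :=
  ∫ p in (-R)..w.1, b (p, w.2.2) * Real.exp (-(a (p, w.2.2) * w.2.1))

/-! ### The radiation profile, integrated from `-R` instead of `-∞`. -/

section Profile

variable {R : ℝ} {a b : ℝ × Space → ℝ}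

theorem prof_integrand_smooth (ha : IsCoeff R a) (hb : IsCoeff R b) :
    ContDiff ℝ ∞ fun w : ℝ × (ℝ × Space) => b (w.1, w.2.2) * Real.exp (-(a (w.1, w.2.2) * w.2.1)) := by
  have := ha.smooth
  have := hb.smooth
  fun_prop

theorem prof_smooth (ha : IsCoeff R a) (hb : IsCoeff R b) : ContDiff ℝ ∞ (prof a b R) := by
  have h := prof_integrand_smooth ha hb
  have h1 := contDiff_primitive h
  have h2 : ContDiff ℝ ∞ fun w : ℝ × (ℝ × Space) => ∫ p in (0 : ℝ)..(-R),
      b (p, w.2.2) * Real.exp (-(a (p, w.2.2) * w.2.1)) :=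
    h1.comp (f := fun w : ℝ × (ℝ × Space) => (-R, w.2)) (by fun_prop)
  have e : prof a b R = fun w => (∫ p in (0 : ℝ)..w.1,
      b (p, w.2.2) * Real.exp (-(a (p, w.2.2) * w.2.1))) - ∫ p in (0 : ℝ)..(-R),
      b (p, w.2.2) * Real.exp (-(a (p, w.2.2) * w.2.1)) := by
    ext w
    have hc : Continuous fun p : ℝ => b (p, w.2.2) * Real.exp (-(a (p, w.2.2) * w.2.1)) :=
      h.continuous.comp (by fun_prop : Continuous fun p : ℝ => ((p, w.2) : ℝ × (ℝ × Space)))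
    rw [intervalIntegral.integral_interval_sub_left (hc.intervalIntegrable _ _)
      (hc.intervalIntegrable _ _), prof]
  rw [e]
  exact h1.sub h2

theorem integral_Iic_of_support {h : ℝ → ℝ} (hc : Continuous h)
    (h0 : ∀ p, p ∉ Set.Icc (-R) R → h p = 0) (q : ℝ) :
    ∫ p in Set.Iic q, h p = ∫ p in (-R)..q, h p := by
  have hi : MeasureTheory.Integrable h := hc.integrable_of_hasCompactSupport
    (HasCompactSupport.intro isCompact_Icc fun p hp => h0 p hp)
  have h1 : ∫ p in Set.Iic (-R), h p = 0 := by
    rw [MeasureTheory.integral_Iic_eq_integral_Iio]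
    exact MeasureTheory.setIntegral_eq_zero_of_forall_eq_zero fun p hp =>
      h0 p fun h => not_lt.2 h.1 hp
  rw [← intervalIntegral.integral_Iic_sub_Iic hi.integrableOn hi.integrableOn, h1, sub_zero]

theorem prof_of_ge (hb : IsCoeff R b) (ha : IsCoeff R a) {q : ℝ} (hq : R ≤ q) (l : ℝ × Space) :
    prof a b R (q, l) = prof a b R (R, l) := by
  have hc : Continuous fun p : ℝ => b (p, l.2) * Real.exp (-(a (p, l.2) * l.1)) :=
    (prof_integrand_smooth ha hb).continuous.comp
      (by fun_prop : Continuous fun p : ℝ => ((p, l) : ℝ × (ℝ × Space)))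
  simp only [prof]
  rw [← intervalIntegral.integral_add_adjacent_intervals (hc.intervalIntegrable (-R) R)
    (hc.intervalIntegrable R q), add_eq_left]
  refine intervalIntegral.integral_zero_ae (Filter.Eventually.of_forall fun p hp => ?_)
  rw [Set.uIoc_of_le hq] at hp
  rw [hb.supp p l.2 fun h => not_lt.2 h.2 hp.1, zero_mul]

theorem prof_of_le (hb : IsCoeff R b) {q : ℝ} (hq : q ≤ -R) (l : ℝ × Space) :
    prof a b R (q, l) = 0 := by
  simp only [prof]
  rw [intervalIntegral.integral_symm, neg_eq_zero, intervalIntegral.integral_of_le hq,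
    MeasureTheory.integral_Ioc_eq_integral_Ioo]
  refine MeasureTheory.setIntegral_eq_zero_of_forall_eq_zero fun p hp => ?_
  rw [hb.supp p l.2 fun h => not_lt.2 h.1 hp.2, zero_mul]

end Profile

/-! ### The optical function -/

section Optical

variable {g : Fin 4 → Fin 4 → ℝ → ℝ} {A : ℝ × Sphere2 → ℝ} {R : ℝ} {b : ℝ × Space → ℝ}

theorem mu_eq_speed (hbA : ∀ p (θ : Sphere2), b (p, (θ : Space)) = A (p, θ)) (s q : ℝ)
    (θ : Sphere2) : mu g A s q θ = speed (fun w => 1 / 2 * quadG g w.2 * b w) s q θ := by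
  simp only [mu, speed, hbA]
  rfl

theorem profile_eq_prof (hb : IsCoeff R b) (hbA : ∀ p (θ : Sphere2), b (p, (θ : Space)) = A (p, θ))
    (s q : ℝ) (θ : Sphere2) :
    profile g A s q θ = prof (fun w => 1 / 2 * quadG g w.2 * b w) b R (q, (s, θ)) := by
  have hc : Continuous fun p : ℝ => b (p, (θ : Space)) *
      Real.exp (-((1 / 2 * quadG g θ * b (p, (θ : Space))) * s)) :=
    (prof_integrand_smooth (hb.half_quadG_mul g) hb).continuous.comp
      (by fun_prop : Continuous fun p : ℝ => ((p, (s, (θ : Space))) : ℝ × (ℝ × Space)))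
  rw [prof, ← integral_Iic_of_support hc (fun p hp => by simp [hb.supp p θ hp]), profile]
  congr 1
  ext p
  rw [hbA, show quadG g (θ : Space) = G g θ from rfl]
  congr 2
  ring

theorem isOptical_flow (hb : IsCoeff R b) (hbA : ∀ p (θ : Sphere2), b (p, (θ : Space)) = A (p, θ))
    (ε δ : ℝ) : IsOptical g A ε δ
      fun t r θ => (hb.half_quadG_mul g).flow ε δ (t, (t + r, (θ : Space))) := by
  refine ⟨fun θ => ?_, fun t r θ ht hr => ?_, fun t θ ht => ?_⟩
  · refine ((hb.half_quadG_mul g).flow_smooth ε δ).continuousOn.comp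
      (f := fun y : ℝ × ℝ => ((y.1, (y.1 + y.2, (θ : Space))) : ℝ × (ℝ × Space))) (by fun_prop) ?_
    intro y hy
    exact ⟨hy.1, add_pos_of_pos_of_nonneg hy.1 hy.2⟩
  · rw [mu_eq_speed hbA]
    have h := (hb.half_quadG_mul g).flow_deriv ε δ ht (add_pos ht hr) (θ : Space)
    rw [← add_zero t] at h
    simpa using h.comp_const_add t 0
  · simpa using (hb.half_quadG_mul g).flow_boundary ε δ ht (θ : Space)

/-- Restricted to a ray `t + r = v`, an optical function solves the characteristic ODE with the axis
value as terminal datum. -/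
theorem IsOptical.eq_flow (hb : IsCoeff R b)
    (hbA : ∀ p (θ : Sphere2), b (p, (θ : Space)) = A (p, θ)) {ε δ : ℝ} {q : ℝ → ℝ → Sphere2 → ℝ}
    (hq : IsOptical g A ε δ q) {t r : ℝ} (ht : 0 < t) (hr : 0 ≤ r) (θ : Sphere2) :
    q t r θ = (hb.half_quadG_mul g).flow ε δ (t, (t + r, (θ : Space))) := by
  have hv : 0 < t + r := add_pos_of_pos_of_nonneg ht hr
  have := (hb.half_quadG_mul g).speed_unique (ε := ε) (δ := δ) (x := (θ : Space)) (t₀ := t)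
    (v := t + r) ht (φ₁ := fun τ => q τ (t + r - τ) θ)
    (φ₂ := fun τ => (hb.half_quadG_mul g).flow ε δ (τ, (t + r, (θ : Space)))) ?_ ?_ ?_ ?_ ?_ t
    ⟨le_rfl, by linarith⟩
  · simpa using this
  · refine (hq.continuousOn θ).comp (f := fun τ : ℝ => ((τ, t + r - τ) : ℝ × ℝ)) (by fun_prop) ?_
    intro τ hτ
    exact ⟨ht.trans_le hτ.1, by simpa using hτ.2⟩
  · exact fun τ hτ => ((hb.half_quadG_mul g).flow_deriv ε δ (ht.trans_le hτ.1) hv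
      (θ : Space)).continuousAt.continuousWithinAt
  · intro τ hτ
    have h := hq.transport τ (t + r - τ) θ (ht.trans hτ.1) (by linarith [hτ.2])
    rw [mu_eq_speed hbA] at h
    have h2 : HasDerivAt (fun τ' : ℝ => τ' - τ) 1 τ := (hasDerivAt_id τ).sub_const τ
    have h3 := HasDerivAt.comp_of_eq τ h h2 (by simp)
    simp only [Function.comp_def, mul_one] at h3
    refine h3.congr_of_eventuallyEq (Filter.Eventually.of_forall fun τ' => ?_)
    simp only
    congr 1
    · ring
    · ring
  · exact fun τ hτ => (hb.half_quadG_mul g).flow_deriv ε δ (ht.trans hτ.1) hv (θ : Space)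
  · simp only [sub_self]
    rw [hq.boundary _ _ hv, (hb.half_quadG_mul g).flow_boundary ε δ hv]

/-- The optical function in Cartesian coordinates. -/
def IsCoeff.optical {a : ℝ × Space → ℝ} (ha : IsCoeff R a) (ε δ : ℝ) (p : Spacetime) : ℝ :=
  ha.flow ε δ (p.1, (p.1 + ‖p.2‖, ‖p.2‖⁻¹ • p.2))

theorem coe_dir {x : Space} (hx : x ≠ 0) : (dir x : Space) = ‖x‖⁻¹ • x := by
  simp [dir, hx]

theorem IsOptical.qCart_eq (hb : IsCoeff R b)
    (hbA : ∀ p (θ : Sphere2), b (p, (θ : Space)) = A (p, θ)) {ε δ : ℝ} {q : ℝ → ℝ → Sphere2 → ℝ}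
    (hq : IsOptical g A ε δ q) {p : Spacetime} (ht : 0 < p.1) (hx : p.2 ≠ 0) :
    qCart q p = (hb.half_quadG_mul g).optical ε δ p := by
  rw [qCart, hq.eq_flow hb hbA ht (norm_nonneg _), coe_dir hx, IsCoeff.optical]

theorem contDiffOn_norm_snd : ContDiffOn ℝ ∞ (fun p : Spacetime => ‖p.2‖) {p | p.2 ≠ 0} :=
  fun _ hp => (contDiffAt_snd.norm ℝ hp).contDiffWithinAt

theorem contDiffOn_direction :
    ContDiffOn ℝ ∞ (fun p : Spacetime => ‖p.2‖⁻¹ • p.2) {p | p.2 ≠ 0} :=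
  (contDiffOn_norm_snd.inv fun _ hp => norm_ne_zero_iff.2 hp).smul contDiffOn_snd

theorem IsCoeff.optical_smooth {a : ℝ × Space → ℝ} (ha : IsCoeff R a) (ε δ : ℝ) :
    ContDiffOn ℝ ∞ (ha.optical ε δ) {p | 0 < p.1 ∧ p.2 ≠ 0} := by
  have hsub : {p : Spacetime | 0 < p.1 ∧ p.2 ≠ 0} ⊆ {p | p.2 ≠ 0} := fun p hp => hp.2
  refine (ha.flow_smooth ε δ).comp (f := fun p : Spacetime =>
    ((p.1, (p.1 + ‖p.2‖, ‖p.2‖⁻¹ • p.2)) : ℝ × (ℝ × Space))) ?_ ?_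
  · exact contDiffOn_fst.prodMk ((contDiffOn_fst.add (contDiffOn_norm_snd.mono hsub)).prodMk
      (contDiffOn_direction.mono hsub))
  · exact fun p hp => ⟨hp.1, add_pos_of_pos_of_nonneg hp.1 (norm_nonneg _)⟩

end Optical

end QuasilinearWave

end

noncomputable section

namespace QuasilinearWave

/-! ### Symbols on `ℝ × (ℝ × ℝ³)` -/

/-- Labels of the coordinates of `ℝ × (ℝ × ℝ³)`. -/
abbrev CoordLabel := Option (Option (Fin 3))

/-- The coordinate directions of `ℝ × (ℝ × ℝ³)`. -/
def cdir : CoordLabel → ℝ × (ℝ × Space)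
  | none => (1, 0)
  | some none => (0, (1, 0))
  | some (some i) => (0, (0, EuclideanSpace.single i 1))

/-- The coordinates of `ℝ × (ℝ × ℝ³)`. -/
def ccoord : CoordLabel → (ℝ × (ℝ × Space)) →L[ℝ] ℝ
  | none => ContinuousLinearMap.fst ℝ ℝ (ℝ × Space)
  | some none => (ContinuousLinearMap.fst ℝ ℝ Space).comp (ContinuousLinearMap.snd ℝ ℝ (ℝ × Space))
  | some (some i) => ((EuclideanSpace.proj i : Space →L[ℝ] ℝ).comp
      (ContinuousLinearMap.snd ℝ ℝ Space)).comp (ContinuousLinearMap.snd ℝ ℝ (ℝ × Space))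

theorem space_sum_single (x : Space) : x = ∑ i : Fin 3, x i • EuclideanSpace.single i (1 : ℝ) := by
  ext j
  simp [Finset.sum_apply, Pi.single_apply]

theorem ccoord_sum (v : ℝ × (ℝ × Space)) : v = ∑ j, ccoord j v • cdir j := by
  obtain ⟨q, s, x⟩ := v
  rw [Fintype.sum_option, Fintype.sum_option]
  have h : ∑ i : Fin 3, ccoord (some (some i)) (q, s, x) • cdir (some (some i)) =
      (0, (0, x)) := by
    conv_rhs => rw [space_sum_single x]
    simp [cdir, ccoord, Fin.sum_univ_three]
  rw [h]
  simp [cdir, ccoord]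

theorem cdir_ne {z : CoordLabel} (hz : z ≠ none) : ∃ w : ℝ × Space, cdir z = (0, w) := by
  match z with
  | none => exact absurd rfl hz
  | some none => exact ⟨_, rfl⟩
  | some (some i) => exact ⟨_, rfl⟩

/-- The frame of functions of `(q, s, x)` of exponential growth in `s`. -/
def frameH (R : ℝ) : Frame Unit (ℝ × (ℝ × Space)) where
  κ := CoordLabel
  X z _ := cdir z
  dom _ := Set.univ
  ρ _ := 1
  W _ w := (1 + |w.1 + R|) * Real.exp |w.2.1|
  X_smooth _ := contDiff_const
  isOpen _ := isOpen_univ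
  ρ_pos _ _ _ := one_pos
  one_le_W _ w _ := one_le_mul_of_one_le_of_one_le (by simp) (Real.one_le_exp (abs_nonneg _))

instance (R : ℝ) : Fintype (frameH R).κ := inferInstanceAs (Fintype CoordLabel)

section

variable {R : ℝ} {a b : ℝ × Space → ℝ}

theorem frameH_W_ge (R : ℝ) (w : ℝ × (ℝ × Space)) : Real.exp |w.2.1| ≤ (frameH R).W () w :=
  le_mul_of_one_le_left (Real.exp_pos _).le (by simp)

theorem frameH_coeff (R : ℝ) (n : ℕ) {h : ℝ × Space → ℝ} (hs : ContDiff ℝ ∞ h)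
    (hc : HasCompactSupport h) : (frameH R).Sym n 0 fun _ w => h (w.1, w.2.2) := by
  induction n generalizing h with
  | zero =>
    obtain ⟨B, hB⟩ := hc.exists_bound_of_continuous hs.continuous
    refine ⟨fun _ => (hs.comp (by fun_prop)).contDiffOn, |B|, abs_nonneg _, 0, fun i p _ => ?_⟩
    simpa using (hB _).trans (le_abs_self B)
  | succ n ih =>
    have h0 := ih hs hc
    refine ⟨h0.smooth, h0.bd, fun z => ?_⟩
    refine (ih (h := fun y => fderiv ℝ h y ((cdir z).1, (cdir z).2.2))
      ((hs.fderiv_right (m := ∞) (by simp)).clm_apply contDiff_const)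
      (hc.fderiv_apply (𝕜 := ℝ) _)).congr fun i p _ => ?_
    let c : (ℝ × (ℝ × Space)) →L[ℝ] ℝ × Space := (ContinuousLinearMap.fst ℝ ℝ (ℝ × Space)).prod
      ((ContinuousLinearMap.snd ℝ ℝ Space).comp (ContinuousLinearMap.snd ℝ ℝ (ℝ × Space)))
    have := ((hs.differentiable (by simp)).differentiableAt (x := c p)).hasFDerivAt.comp p
      c.hasFDerivAt
    have h2 := this.fderiv
    simp only [Function.comp_def] at h2
    change fderiv ℝ (fun w => h (c w)) p (cdir z) = _
    rw [h2]
    rfl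

theorem frameH_time (R : ℝ) (n : ℕ) : (frameH R).Sym n 0 fun _ w => w.2.1 := by
  refine Frame.Sym.intro (fun _ => by fun_prop) ⟨1, zero_le_one, 1, fun i p _ => ?_⟩
    fun m _ z => ?_
  · rw [zpow_zero, one_mul, one_mul, pow_one]
    exact (by linarith [Real.add_one_le_exp |p.2.1|] : |p.2.1| ≤ Real.exp |p.2.1|).trans
      (frameH_W_ge R p)
  · refine (Frame.Sym.const (c := fun _ => (cdir z).2.1) (M := |(cdir z).2.1|)
      (fun _ => le_rfl) m).congr fun i p _ => ?_
    have := (ccoord (some none)).hasFDerivAt (x := p)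
    have h2 := this.fderiv
    change fderiv ℝ (ccoord (some none)) p (cdir z) = _
    rw [h2]
    rfl

theorem exp_mul_le {u s B W : ℝ} (hu : |u| ≤ B) (hW : Real.exp |s| ≤ W) :
    Real.exp (u * s) ≤ W ^ ⌈B⌉₊ := by
  calc Real.exp (u * s) ≤ Real.exp (⌈B⌉₊ * |s|) := by
        refine Real.exp_le_exp.2 ((le_abs_self _).trans ?_)
        rw [abs_mul]
        exact mul_le_mul_of_nonneg_right (hu.trans (Nat.le_ceil B)) (abs_nonneg _)
    _ = Real.exp |s| ^ ⌈B⌉₊ := by rw [← Real.exp_nat_mul]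
    _ ≤ W ^ ⌈B⌉₊ := pow_le_pow_left₀ (Real.exp_pos _).le hW _

theorem frameH_exp (n : ℕ) (ha : IsCoeff R a) :
    (frameH R).Sym n 0 fun _ w => Real.exp (a (w.1, w.2.2) * w.2.1) := by
  refine Frame.Sym.exp ((frameH_coeff R n ha.smooth ha.compact).mul' (frameH_time R n)
    (add_zero 0)) ?_
  obtain ⟨B, hB⟩ := ha.compact.exists_bound_of_continuous ha.smooth.continuous
  refine ⟨1, zero_le_one, ⌈B⌉₊, fun i p _ => ?_⟩
  rw [Real.abs_exp, zpow_zero, one_mul, one_mul]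
  exact exp_mul_le (hB _) (frameH_W_ge R p)

theorem IsCoeff.neg (ha : IsCoeff R a) : IsCoeff R fun w => -a w :=
  ⟨ha.smooth.neg, HasCompactSupport.intro ha.compact fun w hw => by
    simp [image_eq_zero_of_notMem_tsupport hw], fun p x hp => by simp [ha.supp p x hp]⟩

/-- The speed as a function of `(q, s, x)`. -/
def speedH (a : ℝ × Space → ℝ) (w : ℝ × (ℝ × Space)) : ℝ := speed a w.2.1 w.1 w.2.2

theorem frameH_speed (n : ℕ) (ha : IsCoeff R a) : (frameH R).Sym n 0 fun _ => speedH a :=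
  (frameH_exp n ha).real_mul (-2)

theorem frameH_density (n : ℕ) (ha : IsCoeff R a) (hb : IsCoeff R b) :
    (frameH R).Sym n 0 fun _ w => b (w.1, w.2.2) * Real.exp (-(a (w.1, w.2.2) * w.2.1)) :=
  ((frameH_coeff R n hb.smooth hb.compact).mul' (frameH_exp n ha.neg) (add_zero 0)).congr
    fun i p _ => by simp only [neg_mul]

theorem prof_der_none (ha : IsCoeff R a) (hb : IsCoeff R b) (w : ℝ × (ℝ × Space)) :
    fderiv ℝ (prof a b R) w (cdir none) =
      b (w.1, w.2.2) * Real.exp (-(a (w.1, w.2.2) * w.2.1)) := by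
  have h1 := ((prof_smooth ha hb).differentiable (by simp)).differentiableAt (x := w)
    |>.hasFDerivAt.comp_hasDerivAt w.1 ((hasDerivAt_id w.1).prodMk (hasDerivAt_const w.1 w.2))
  have hc : Continuous fun p : ℝ => b (p, w.2.2) * Real.exp (-(a (p, w.2.2) * w.2.1)) :=
    (prof_integrand_smooth ha hb).continuous.comp
      (by fun_prop : Continuous fun p : ℝ => ((p, w.2) : ℝ × (ℝ × Space)))
  exact h1.unique (intervalIntegral.integral_hasDerivAt_right (hc.intervalIntegrable _ _)
    (hc.stronglyMeasurableAtFilter _ _) hc.continuousAt)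

/-- In the variable `q` the profile is a primitive vanishing at `q = -R`, so the symbol estimate for
linear equations applies with coefficient zero. The length of the interval of integration accounts
for the factor `1 + |q + R|` in the weight of `frameH`. -/
theorem frameH_prof (n : ℕ) (ha : IsCoeff R a) (hb : IsCoeff R b) :
    (frameH R).Sym n 0 fun _ => prof a b R := by
  refine Frame.Sym.linear_ode (F := frameH R) (z₀ := (none : CoordLabel)) (fun _ => rfl)
    (fun z hz => ?_) (y₀ := -R) (fun i y l _ y' hy' => ⟨trivial, rfl, ?_⟩)
    ⟨1, zero_le_one, 1, fun i y l _ => ?_⟩ (β := fun _ _ => 0)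
    ⟨1, zero_le_one, 0, fun i y l _ y' _ => by simp⟩ (Frame.Sym.zero n 0)
    (frameH_density n ha hb) (fun _ => (prof_smooth ha hb).contDiffOn)
    (fun i l _ => prof_of_le hb le_rfl l) (fun i p _ => ?_)
  · obtain ⟨w, hw⟩ := cdir_ne hz
    exact ⟨w, fun _ => hw⟩
  · refine mul_le_mul_of_nonneg_right ?_ (Real.exp_pos _).le
    have h1 : |y' - -R| ≤ |y - -R| := Set.abs_sub_left_of_mem_uIcc hy'
    rw [sub_neg_eq_add, sub_neg_eq_add] at h1
    simpa using h1
  · rw [one_mul, pow_one, sub_neg_eq_add]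
    refine (by linarith : |y + R| ≤ 1 + |y + R|).trans (le_mul_of_one_le_right ?_ ?_)
    · positivity
    · exact Real.one_le_exp (abs_nonneg _)
  · simp only [zero_mul, zero_add]
    exact prof_der_none ha hb p

end

end QuasilinearWave

end

noncomputable section

namespace QuasilinearWave

/-! ### The optical function in characteristic coordinates -/

/-- Admissible values of `(ε, δ)`. -/
structure Idx (e₀ : ℝ) where
  ε : ℝ
  δ : ℝ
  ε_pos : 0 < ε
  ε_lt : ε < e₀
  δ_pos : 0 < δ
  δ_lt : δ < 1

/-- Parameters of the region near the light cone. -/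
structure Params (R : ℝ) where
  M : ℝ
  K₁ : ℝ
  m₀ : ℝ
  e₀ : ℝ
  R_pos : 0 < R
  M_nonneg : 0 ≤ M
  K₁_pos : 0 < K₁
  e₀_pos : 0 < e₀
  e₀_le : e₀ ≤ 1
  m₀_nonneg : 0 ≤ m₀
  R_le : R ≤ Real.exp m₀ / 32
  small : ∀ ε m, 0 < ε → ε < e₀ → m₀ < m → K₁ * Real.exp (M * ε * m) ≤ Real.exp m / 32

variable {R : ℝ}

/-- The frame in the coordinates `(y, m, x)`, where `t = e^m + y` and `t + r = 2 e^m - R`. -/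
def frameP (P : Params R) : Frame (Idx P.e₀) (ℝ × (ℝ × Space)) where
  κ := CoordLabel
  X z _ := cdir z
  dom i := {w | P.m₀ < w.2.1 ∧ |w.1| < P.K₁ * Real.exp (P.M * i.ε * w.2.1) ∧ ‖w.2.2‖ < 2}
  ρ w := Real.exp w.2.1
  W i w := Real.exp (i.ε * w.2.1)
  X_smooth _ := contDiff_const
  isOpen i := by
    simp only [Set.ofPred_and]
    refine (isOpen_lt ?_ ?_).inter ((isOpen_lt ?_ ?_).inter (isOpen_lt ?_ ?_)) <;> fun_prop
  ρ_pos _ _ _ := Real.exp_pos _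
  one_le_W i w hw := Real.one_le_exp (mul_nonneg i.ε_pos.le (P.m₀_nonneg.trans hw.1.le))

instance (P : Params R) : Fintype (frameP P).κ := inferInstanceAs (Fintype CoordLabel)

section

variable {P : Params R} {i : Idx P.e₀} {w : ℝ × (ℝ × Space)}

theorem frameP_y (hw : w ∈ (frameP P).dom i) : |w.1| ≤ Real.exp w.2.1 / 32 :=
  hw.2.1.le.trans (P.small i.ε w.2.1 i.ε_pos i.ε_lt hw.1)

theorem frameP_R (hw : w ∈ (frameP P).dom i) : R ≤ Real.exp w.2.1 / 32 :=
  P.R_le.trans (div_le_div_of_nonneg_right (Real.exp_le_exp.2 hw.1.le) (by norm_num))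

theorem frameP_t_ge (hw : w ∈ (frameP P).dom i) : Real.exp w.2.1 / 2 ≤ Real.exp w.2.1 + w.1 := by
  have := frameP_y hw
  have := (abs_le.1 this).1
  have := Real.exp_pos w.2.1
  linarith

theorem frameP_t_le (hw : w ∈ (frameP P).dom i) : Real.exp w.2.1 + w.1 ≤ 2 * Real.exp w.2.1 := by
  have := frameP_y hw
  have := (abs_le.1 this).2
  have := Real.exp_pos w.2.1
  linarith

theorem frameP_t_pos (hw : w ∈ (frameP P).dom i) : 0 < Real.exp w.2.1 + w.1 :=
  (half_pos (Real.exp_pos _)).trans_le (frameP_t_ge hw)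

theorem frameP_v_pos (hw : w ∈ (frameP P).dom i) : 0 < 2 * Real.exp w.2.1 - R := by
  have := frameP_R hw
  have := Real.exp_pos w.2.1
  linarith

theorem frameP_seg {y : ℝ} {l : ℝ × Space} (hw : (y, l) ∈ (frameP P).dom i) {y' : ℝ}
    (hy' : y' ∈ Set.uIcc 0 y) : (y', l) ∈ (frameP P).dom i := by
  refine ⟨hw.1, ?_, hw.2.2⟩
  have h1 := Set.abs_sub_left_of_mem_uIcc hy'
  rw [sub_zero, sub_zero] at h1
  exact h1.trans_lt hw.2.1

/-- The slow time `ε ln t - δ`. -/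
def slowP (P : Params R) (i : Idx P.e₀) (w : ℝ × (ℝ × Space)) : ℝ :=
  i.ε * Real.log (Real.exp w.2.1 + w.1) - i.δ

/-- Here `½ e^m ≤ t ≤ 2 e^m`, whence `|log t| ≤ m + 1`; the constant `2` absorbs this `1`,
multiplied by `ε ≤ 1`, and `δ < 1`. -/
theorem slowP_le (hw : w ∈ (frameP P).dom i) : |slowP P i w| ≤ i.ε * w.2.1 + 2 := by
  have hm : 0 ≤ w.2.1 := P.m₀_nonneg.trans hw.1.le
  have hl2 : Real.log 2 ≤ 1 := by linarith [Real.log_two_lt_d9]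
  have h1 : Real.log (Real.exp w.2.1 + w.1) ≤ w.2.1 + 1 := by
    refine (Real.log_le_log (frameP_t_pos hw) (frameP_t_le hw)).trans ?_
    rw [Real.log_mul two_ne_zero (Real.exp_pos _).ne', Real.log_exp]
    linarith
  have h2 : -1 ≤ Real.log (Real.exp w.2.1 + w.1) := by
    refine le_trans ?_ (Real.log_le_log (half_pos (Real.exp_pos _)) (frameP_t_ge hw))
    rw [Real.log_div (Real.exp_pos _).ne' two_ne_zero, Real.log_exp]
    linarith
  have hε1 : i.ε ≤ 1 := i.ε_lt.le.trans P.e₀_le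
  have h3 : |Real.log (Real.exp w.2.1 + w.1)| ≤ w.2.1 + 1 := abs_le.2 ⟨by linarith, h1⟩
  calc |slowP P i w| ≤ |i.ε * Real.log (Real.exp w.2.1 + w.1)| + |i.δ| := abs_sub _ _
    _ ≤ i.ε * (w.2.1 + 1) + 1 := by
        rw [abs_mul, abs_of_pos i.ε_pos, abs_of_pos i.δ_pos]
        exact add_le_add (mul_le_mul_of_nonneg_left h3 i.ε_pos.le) i.δ_lt.le
    _ ≤ _ := by linarith

/-- Exponentials of the slow time are powers of the weight. All losses `t^{Cε}` originate here. -/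
theorem slowP_exp (hw : w ∈ (frameP P).dom i) {c : ℝ} (hc : 0 ≤ c) :
    Real.exp (c * |slowP P i w|) ≤ Real.exp (2 * c) * (frameP P).W i w ^ ⌈c⌉₊ := by
  have hm : 0 ≤ i.ε * w.2.1 := mul_nonneg i.ε_pos.le (P.m₀_nonneg.trans hw.1.le)
  change _ ≤ _ * Real.exp (i.ε * w.2.1) ^ ⌈c⌉₊
  rw [← Real.exp_nat_mul, ← Real.exp_add]
  refine Real.exp_le_exp.2 ?_
  calc c * |slowP P i w| ≤ c * (i.ε * w.2.1 + 2) := mul_le_mul_of_nonneg_left (slowP_le hw) hc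
    _ = 2 * c + c * (i.ε * w.2.1) := by ring
    _ ≤ _ := by gcongr; exact Nat.le_ceil c

end

/-! ### Elementary symbols in characteristic coordinates. -/

section

variable (P : Params R)

theorem frameP_coord (n : ℕ) (z : CoordLabel) (j : CoordLabel) :
    (frameP P).Sym n 0 ((frameP P).der z fun _ w => ccoord j w) := by
  refine (Frame.Sym.const (c := fun _ => ccoord j (cdir z)) (M := |ccoord j (cdir z)|)
    (fun _ => le_rfl) n).congr fun i p _ => ?_
  change fderiv ℝ (ccoord j) p (cdir z) = _
  rw [(ccoord j).fderiv]

theorem frameP_coord_sym (n : ℕ) (j : CoordLabel)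
    (hb : (frameP P).Bd 0 fun _ w => ccoord j w) : (frameP P).Sym n 0 fun _ w => ccoord j w :=
  Frame.Sym.intro (fun _ => (ccoord j).contDiff.contDiffOn) hb fun m _ z => frameP_coord P m z j

theorem frameP_x (n : ℕ) (k : Fin 3) : (frameP P).Sym n 0 fun _ w => w.2.2 k := by
  refine frameP_coord_sym P n (some (some k)) ⟨2, zero_le_two, 0, fun i p hp => ?_⟩
  rw [zpow_zero, pow_zero, mul_one, mul_one]
  exact (PiLp.norm_apply_le p.2.2 k).trans hp.2.2.le

theorem frameP_y_sym (n : ℕ) : (frameP P).Sym n 0 fun _ w => w.1 := by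
  refine frameP_coord_sym P n none ⟨P.K₁, P.K₁_pos.le, ⌈P.M⌉₊, fun i p hp => ?_⟩
  rw [zpow_zero, mul_one]
  refine hp.2.1.le.trans (mul_le_mul_of_nonneg_left ?_ P.K₁_pos.le)
  change _ ≤ Real.exp (i.ε * p.2.1) ^ ⌈P.M⌉₊
  rw [← Real.exp_nat_mul]
  refine Real.exp_le_exp.2 ?_
  rw [mul_assoc]
  exact mul_le_mul_of_nonneg_right (Nat.le_ceil _)
    (mul_nonneg i.ε_pos.le (P.m₀_nonneg.trans hp.1.le))

theorem hasFDerivAt_exp_m (w : ℝ × (ℝ × Space)) :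
    HasFDerivAt (fun w : ℝ × (ℝ × Space) => Real.exp w.2.1)
      (Real.exp w.2.1 • ccoord (some none)) w :=
  (ccoord (some none)).hasFDerivAt.exp

theorem frameP_exp (n : ℕ) : (frameP P).Sym n 1 fun _ w => Real.exp w.2.1 := by
  have hb : (frameP P).Bd 1 fun _ w => Real.exp w.2.1 :=
    ⟨1, zero_le_one, 0, fun i p _ => by
      rw [Real.abs_exp, zpow_one, pow_zero, one_mul, mul_one]; exact le_rfl⟩
  induction n with
  | zero => exact ⟨fun _ => by fun_prop, hb⟩
  | succ n ih =>
    refine ⟨fun _ => by fun_prop, hb, fun z => ?_⟩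
    refine (ih.mul' (Frame.Sym.const (c := fun _ => ccoord (some none) (cdir z))
      (M := |ccoord (some none) (cdir z)|) (fun _ => le_rfl) n) (add_zero 1)).congr
      fun i p _ => ?_
    change fderiv ℝ _ p (cdir z) = _
    rw [(hasFDerivAt_exp_m p).fderiv]
    rfl

theorem frameP_weaken_one {n : ℕ} {f : Idx P.e₀ → ℝ × (ℝ × Space) → ℝ} {k l : ℤ} (hkl : k ≤ l)
    (hf : (frameP P).Sym n k f) : (frameP P).Sym n l f := by
  refine hf.weaken (K := 1) fun i p hp => ?_
  rw [one_mul]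
  exact zpow_le_zpow_right₀ (Real.one_le_exp (P.m₀_nonneg.trans hp.1.le)) hkl

theorem frameP_t (n : ℕ) : (frameP P).Sym n 1 fun _ w => Real.exp w.2.1 + w.1 :=
  (frameP_exp P n).add (frameP_weaken_one P (by norm_num) (frameP_y_sym P n))

theorem frameP_t_inv (n : ℕ) : (frameP P).Sym n (-1) fun _ w => (Real.exp w.2.1 + w.1)⁻¹ := by
  refine (frameP_t P n).inv (fun i p hp => (frameP_t_pos hp).ne') ⟨2, zero_le_two, 0,
    fun i p hp => ?_⟩
  have h1 := frameP_t_ge hp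
  rw [abs_of_pos (inv_pos.2 (frameP_t_pos hp)), pow_zero, mul_one, zpow_neg_one]
  change _ ≤ 2 * (Real.exp p.2.1)⁻¹
  have h2 := inv_anti₀ (half_pos (Real.exp_pos p.2.1)) h1
  rwa [inv_div, div_eq_mul_inv] at h2

theorem frameP_slow_smooth : (frameP P).Smooth (slowP P) := fun i =>
  (contDiffOn_const.mul (ContDiffOn.log (by fun_prop) fun _ hp => (frameP_t_pos hp).ne')).sub
    contDiffOn_const

theorem Idx.abs_ε_le {P : Params R} (i : Idx P.e₀) : |i.ε| ≤ 1 := by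
  rw [abs_of_pos i.ε_pos]
  exact i.ε_lt.le.trans P.e₀_le

theorem slowP_der (z : CoordLabel) {i : Idx P.e₀} {w : ℝ × (ℝ × Space)}
    (hw : w ∈ (frameP P).dom i) : (frameP P).der z (slowP P) i w =
      i.ε * ((Real.exp w.2.1 + w.1)⁻¹ *
        (Real.exp w.2.1 * ccoord (some none) (cdir z) + ccoord none (cdir z))) := by
  have h := ((((hasFDerivAt_exp_m w).add (ccoord none).hasFDerivAt).log
    (frameP_t_pos hw).ne').const_mul i.ε).sub_const i.δ
  change fderiv ℝ _ w (cdir z) = _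
  have h2 := h.fderiv
  change fderiv ℝ (slowP P i) w = _ at h2
  rw [h2]
  rfl

theorem frameP_slow (n : ℕ) : (frameP P).Sym n 0 (slowP P) := by
  refine Frame.Sym.intro (frameP_slow_smooth P) ⟨3, by norm_num, 1, fun i p hp => ?_⟩
    fun m _ z => ?_
  · rw [zpow_zero, mul_one, pow_one]
    have h1 := slowP_le hp
    have h2 := Real.add_one_le_exp (i.ε * p.2.1)
    have h3 := (frameP P).one_le_W i p hp
    change 1 ≤ Real.exp (i.ε * p.2.1) at h3
    change _ ≤ 3 * Real.exp (i.ε * p.2.1)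
    linarith
  · refine (((frameP_t_inv P m).mul' ((((frameP_exp P m).mul'
      (Frame.Sym.const (c := fun _ => ccoord (some none) (cdir z))
        (M := |ccoord (some none) (cdir z)|) (fun _ => le_rfl) m) (add_zero 1))).add
      (frameP_weaken_one P (by norm_num) (Frame.Sym.const (c := fun _ => ccoord none (cdir z))
        (M := |ccoord none (cdir z)|) (fun _ => le_rfl) m))) (by norm_num : (-1 : ℤ) + 1 = 0)).const_mul
      (c := fun i : Idx P.e₀ => i.ε) (fun i => i.abs_ε_le)).congr fun i p hp => slowP_der P z hp

end

/-! ### Estimates for the optical function -/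

section

variable {a b : ℝ × Space → ℝ} (P : Params R) (ha : IsCoeff R a)

/-- The optical function in the coordinates `(y, m, x)`. -/
def optP (i : Idx P.e₀) (w : ℝ × (ℝ × Space)) : ℝ :=
  ha.flow i.ε i.δ (Real.exp w.2.1 + w.1, (2 * Real.exp w.2.1 - R, w.2.2))

/-- The arguments `(q, s, x)` of the profile. -/
def argP (i : Idx P.e₀) (w : ℝ × (ℝ × Space)) : ℝ × (ℝ × Space) :=
  (optP P ha i w, (slowP P i w, w.2.2))

theorem optP_smooth : (frameP P).Smooth (optP P ha) := fun i =>
  (ha.flow_smooth i.ε i.δ).comp (f := fun w : ℝ × (ℝ × Space) =>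
    ((Real.exp w.2.1 + w.1, (2 * Real.exp w.2.1 - R, w.2.2)) : ℝ × (ℝ × Space))) (by fun_prop)
    fun _ hw => ⟨frameP_t_pos hw, frameP_v_pos hw⟩

theorem argP_smooth (i : Idx P.e₀) : ContDiffOn ℝ ∞ (argP P ha i) ((frameP P).dom i) :=
  (optP_smooth P ha i).prodMk ((frameP_slow_smooth P i).prodMk (by fun_prop))

theorem optP_deriv {i : Idx P.e₀} {y : ℝ} {l : ℝ × Space} (hw : (y, l) ∈ (frameP P).dom i) :
    HasDerivAt (fun y => optP P ha i (y, l)) (speedH a (argP P ha i (y, l))) y :=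
  HasDerivAt.comp_const_add (f := fun t => ha.flow i.ε i.δ (t, (2 * Real.exp l.1 - R, l.2)))
    (Real.exp l.1) y (ha.flow_deriv i.ε i.δ (frameP_t_pos hw) (frameP_v_pos hw) l.2)

theorem der_none_eq {f : Idx P.e₀ → ℝ × (ℝ × Space) → ℝ} (hf : (frameP P).Smooth f) {i : Idx P.e₀}
    {y : ℝ} {l : ℝ × Space} (hw : (y, l) ∈ (frameP P).dom i) {d : ℝ}
    (hd : HasDerivAt (fun y => f i (y, l)) d y) :
    (frameP P).der (none : CoordLabel) f i (y, l) = d := by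
  have h := (hf.differentiableAt hw).hasFDerivAt.comp_hasDerivAt y
    ((hasDerivAt_id y).prodMk (hasDerivAt_const y l))
  exact h.unique hd

theorem optP_der_none {i : Idx P.e₀} {w : ℝ × (ℝ × Space)} (hw : w ∈ (frameP P).dom i) :
    (frameP P).der (none : CoordLabel) (optP P ha) i w = speedH a (argP P ha i w) :=
  der_none_eq P (optP_smooth P ha) hw (optP_deriv P ha hw)

theorem optP_zero {i : Idx P.e₀} {l : ℝ × Space} (hw : (0, l) ∈ (frameP P).dom i) :
    optP P ha i (0, l) = -R := by
  have h1 := frameP_R hw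
  have h2 := Real.exp_pos l.1
  have h3 := P.R_pos
  simp only at h1
  simp only [optP, add_zero]
  rw [ha.flow_eq_linear i.ε i.δ l.2 (frameP_v_pos hw) (by simpa using h2) (by simp) (by linarith)]
  ring

theorem frameP_len : ∃ K : ℝ, 0 ≤ K ∧ ∃ C : ℕ, ∀ (i : Idx P.e₀) (y : ℝ) (l : ℝ × Space),
    (y, l) ∈ (frameP P).dom i → |y - 0| ≤ K * (frameP P).W i (y, l) ^ C := by
  obtain ⟨K, hK, C, H⟩ := (frameP_y_sym P 0).bd
  exact ⟨K, hK, C, fun i y l h => by simpa using H i (y, l) h⟩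

theorem frameP_linear {β b f : Idx P.e₀ → ℝ × (ℝ × Space) → ℝ} {n : ℕ} {k : ℤ}
    (hexp : ∃ K : ℝ, 0 ≤ K ∧ ∃ C : ℕ, ∀ (i : Idx P.e₀) (y : ℝ) (l : ℝ × Space),
      (y, l) ∈ (frameP P).dom i → ∀ y' ∈ Set.uIcc 0 y,
      Real.exp (∫ τ in y'..y, β i (τ, l)) ≤ K * (frameP P).W i (y, l) ^ C)
    (hβ : (frameP P).Sym n 0 β) (hb : (frameP P).Sym n k b) (hf : (frameP P).Smooth f)
    (hf₀ : ∀ i l, (0, l) ∈ (frameP P).dom i → f i (0, l) = 0)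
    (hode : ∀ i, ∀ p ∈ (frameP P).dom i,
      (frameP P).der (none : CoordLabel) f i p = β i p * f i p + b i p) :
    (frameP P).Sym n k f := by
  refine Frame.Sym.linear_ode (F := frameP P) (z₀ := (none : CoordLabel)) (fun _ => rfl)
    (fun z hz => ?_) (fun i y l h y' hy' => ⟨frameP_seg h hy', rfl, le_rfl⟩) (frameP_len P)
    hexp hβ hb hf hf₀ hode
  obtain ⟨w, hw⟩ := cdir_ne hz
  exact ⟨w, fun _ => hw⟩

theorem argP_comp_zero {f : ℝ × (ℝ × Space) → ℝ} (hf : ContDiff ℝ ∞ f) :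
    (frameP P).Smooth fun i w => f (argP P ha i w) := fun i =>
  hf.comp_contDiffOn (argP_smooth P ha i)

theorem speedH_smooth {a : ℝ × Space → ℝ} (ha : IsCoeff R a) : ContDiff ℝ ∞ (speedH a) := by
  have := ha.smooth
  unfold speedH speed
  fun_prop

/-- The speed is a power of the weight, and so is the length of the `y`-interval; the integration
starts from `q = -R`, so it is applied to `q + R`. -/
theorem optP_bd : (frameP P).Bd 0 (optP P ha) := by
  obtain ⟨B, hB⟩ := ha.compact.exists_bound_of_continuous ha.smooth.continuous
  have hB0 : 0 ≤ B := (norm_nonneg _).trans (hB 0)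
  have h1 : (frameP P).Sym 0 0 fun i w => speedH a (argP P ha i w) := by
    refine ⟨argP_comp_zero P ha (speedH_smooth ha), 2 * Real.exp (2 * B), by positivity, ⌈B⌉₊,
      fun i w hw => ?_⟩
    rw [zpow_zero, mul_one]
    simp only [speedH, speed, argP, abs_mul, abs_neg, abs_two, Real.abs_exp]
    rw [mul_assoc]
    refine mul_le_mul_of_nonneg_left (le_trans (Real.exp_le_exp.2 ((le_abs_self _).trans ?_))
      (slowP_exp hw hB0)) zero_le_two
    rw [abs_mul]
    exact mul_le_mul_of_nonneg_right (hB _) (abs_nonneg _)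
  have h2 : (frameP P).Sym 0 0 fun i w => optP P ha i w + R := by
    refine frameP_linear P (β := fun _ _ => 0) ⟨1, zero_le_one, 0, by simp⟩
      (Frame.Sym.zero 0 0) h1 (fun i => (optP_smooth P ha i).add contDiffOn_const)
      (fun i l h => by rw [optP_zero P ha h]; ring) (fun i w hw => ?_)
    rw [zero_mul, zero_add, ← optP_der_none P ha hw]
    simp only [Frame.der]
    rw [fderiv_add_const]
  refine (h2.bd.add (Frame.Bd.const (c := fun _ => -R) (M := |R|) fun _ => by simp)).congr
    fun i w _ => by ring

theorem argP_grow (C : ℕ) : ∃ K : ℝ, 0 ≤ K ∧ ∃ D : ℕ, ∀ i, ∀ w ∈ (frameP P).dom i,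
    (frameH R).ρ (argP P ha i w) ^ (0 : ℤ) * (frameH R).W () (argP P ha i w) ^ C ≤
      K * (frameP P).ρ w ^ (0 : ℤ) * (frameP P).W i w ^ D := by
  obtain ⟨K, hK, D, H⟩ := optP_bd P ha
  refine ⟨((1 + K + |R|) * Real.exp 2) ^ C, by positivity, (D + 1) * C, fun i w hw => ?_⟩
  rw [zpow_zero, zpow_zero, one_mul, mul_one, pow_mul, ← mul_pow]
  have hW := (frameP P).one_le_W i w hw
  have hWD : 1 ≤ (frameP P).W i w ^ D := one_le_pow₀ hW
  have h1 := H i w hw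
  rw [zpow_zero, mul_one] at h1
  have h2 := slowP_exp hw zero_le_one
  rw [one_mul, mul_one, Nat.ceil_one, pow_one] at h2
  refine pow_le_pow_left₀ (mul_nonneg (by positivity) (Real.exp_pos _).le) ?_ C
  calc (1 + |optP P ha i w + R|) * Real.exp |slowP P i w|
      ≤ ((1 + K + |R|) * (frameP P).W i w ^ D) * (Real.exp 2 * (frameP P).W i w) := by
        refine mul_le_mul ?_ h2 (Real.exp_pos _).le (by positivity)
        have h3 := abs_add_le (optP P ha i w) R
        have h4 := abs_nonneg R
        nlinarith
    _ = _ := by ring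

theorem argP_coord (n : ℕ) (hQ : (frameP P).Sym n 0 (optP P ha)) (j z : CoordLabel) :
    ∀ m, m < n → (frameP P).Sym m 0 ((frameP P).der z fun i w => ccoord j (argP P ha i w)) := by
  intro m hm
  match j with
  | none => exact (hQ.of_le (Nat.succ_le_of_lt hm)).der z
  | some none => exact (frameP_slow P (m + 1)).der z
  | some (some k) => exact frameP_coord P m z (some (some k))

theorem argP_comp {n : ℕ} (hQ : (frameP P).Sym n 0 (optP P ha)) {f : Unit → ℝ × (ℝ × Space) → ℝ}
    (hf : (frameH R).Sym n 0 f) : (frameP P).Sym n 0 fun i w => f () (argP P ha i w) :=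
  Frame.Sym.comp (F' := frameH R) (e := cdir) (c := ccoord) (fun _ _ => rfl) ccoord_sum
    (σ := fun _ => ()) (argP_smooth P ha) (fun _ _ _ => trivial)
    (fun m hm j z => argP_coord P ha n hQ j z m hm) (argP_grow P ha) hf

theorem argP_der {f : Unit → ℝ × (ℝ × Space) → ℝ} (hf : (frameH R).Smooth f) (z : CoordLabel)
    {i : Idx P.e₀} {w : ℝ × (ℝ × Space)} (hw : w ∈ (frameP P).dom i) :
    (frameP P).der z (fun i w => f () (argP P ha i w)) i w =
      (frameH R).der (none : CoordLabel) f () (argP P ha i w) * (frameP P).der z (optP P ha) i w +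
      ((frameH R).der (some none : CoordLabel) f () (argP P ha i w) *
          (frameP P).der z (slowP P) i w +
        ∑ k : Fin 3, (frameH R).der (some (some k) : CoordLabel) f () (argP P ha i w) *
          (frameP P).der z (fun _ w => ccoord (some (some k)) w) i w) := by
  have := Frame.der_comp (F := frameP P) (F' := frameH R) (e := cdir) (c := ccoord)
    (fun _ _ => rfl) ccoord_sum (σ := fun _ => ()) (argP_smooth P ha) (fun _ _ _ => trivial) hf z hw
  rw [this]
  have h2 := Fintype.sum_option (fun j : CoordLabel =>
    (frameH R).der j f () (argP P ha i w) *
      (frameP P).der z (fun i w => ccoord j (argP P ha i w)) i w)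
  rw [Fintype.sum_option] at h2
  exact h2

theorem abs_integral_le_of_hasDerivAt {β ψ ψ' : ℝ → ℝ} {y' y : ℝ}
    (hψ : ∀ τ ∈ Set.uIcc y' y, HasDerivAt ψ (ψ' τ) τ)
    (hc : ContinuousOn ψ' (Set.uIcc y' y)) (h : ∀ τ ∈ Set.uIcc y' y, |β τ| ≤ ψ' τ) :
    |∫ τ in y'..y, β τ| ≤ |ψ y - ψ y'| := by
  have hi : IntervalIntegrable ψ' MeasureTheory.volume y' y := hc.intervalIntegrable
  rw [← intervalIntegral.integral_eq_sub_of_hasDerivAt hψ hi]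
  refine intervalIntegral.norm_integral_le_abs_of_norm_le (μ := MeasureTheory.volume) (f := β) ?_ hi
  refine (MeasureTheory.ae_restrict_iff' measurableSet_uIoc).2
    (Filter.Eventually.of_forall fun τ hτ => h τ (Set.uIoc_subset_uIcc hτ))

theorem speedH_der_none {a : ℝ × Space → ℝ} (ha : IsCoeff R a) (w : ℝ × (ℝ × Space)) :
    (frameH R).der (none : CoordLabel) (fun _ => speedH a) () w =
      fderiv ℝ a (w.1, w.2.2) (1, 0) * w.2.1 * speedH a w := by
  have h1 := ((speedH_smooth ha).differentiable (by simp)).differentiableAt (x := w)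
    |>.hasFDerivAt.comp_hasDerivAt w.1 ((hasDerivAt_id w.1).prodMk (hasDerivAt_const w.1 w.2))
  have h2 := (ha.smooth.differentiable (by simp)).differentiableAt (x := (w.1, w.2.2))
    |>.hasFDerivAt.comp_hasDerivAt w.1 ((hasDerivAt_id w.1).prodMk (hasDerivAt_const w.1 w.2.2))
  have h3 := ((h2.mul_const w.2.1).exp).const_mul (-2)
  refine h1.unique (h3.congr_deriv ?_)
  simp only [speedH, speed, Function.comp_def, id]
  ring

/-- The integrand is `(∂_q a) s μ` and `μ dy = dq`. As `∂_q a` is bounded by an integrable function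
of `q`, the integral is at most a constant times the bound `εm + 2` for `|s|`, however long the
interval is. This keeps the linearized equation from losing more than a power of the weight. -/
theorem speedP_hexp : ∃ K : ℝ, 0 ≤ K ∧ ∃ C : ℕ, ∀ (i : Idx P.e₀) (y : ℝ) (l : ℝ × Space),
    (y, l) ∈ (frameP P).dom i → ∀ y' ∈ Set.uIcc 0 y,
    Real.exp (∫ τ in y'..y, (frameH R).der (none : CoordLabel) (fun _ => speedH a) ()
      (argP P ha i (τ, l))) ≤ K * (frameP P).W i (y, l) ^ C := by
  have hs1 : Continuous fun w : ℝ × Space => (1 + w.1 ^ 2) * fderiv ℝ a w (1, 0) := by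
    have := (ha.smooth.continuous_fderiv (by simp))
    fun_prop
  obtain ⟨c, hc⟩ := (HasCompactSupport.mul_left (f := fun w : ℝ × Space => 1 + w.1 ^ 2)
    (ha.compact.fderiv_apply (𝕜 := ℝ) ((1, 0) : ℝ × Space))).exists_bound_of_continuous hs1
  have hc0 : 0 ≤ c := (norm_nonneg _).trans (hc 0)
  have haq : ∀ w : ℝ × Space, |fderiv ℝ a w (1, 0)| ≤ c * (1 + w.1 ^ 2)⁻¹ := by
    intro w
    have h1 := hc w
    have h2 : 0 < 1 + w.1 ^ 2 := by positivity
    rw [← div_eq_mul_inv, le_div_iff₀ h2]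
    simp only [Pi.mul_apply] at h1
    rw [Real.norm_eq_abs, abs_mul, abs_of_pos h2] at h1
    linarith
  refine ⟨Real.exp (2 * (c * Real.pi)), (Real.exp_pos _).le, ⌈c * Real.pi⌉₊,
    fun i y l hw y' hy' => ?_⟩
  have hmem : ∀ τ ∈ Set.uIcc y' y, (τ, l) ∈ (frameP P).dom i := fun τ hτ =>
    frameP_seg hw (Set.uIcc_subset_uIcc hy' Set.right_mem_uIcc hτ)
  set S := i.ε * l.1 + 2
  have hS0 : 0 ≤ S := add_nonneg (mul_nonneg i.ε_pos.le (P.m₀_nonneg.trans hw.1.le)) zero_le_two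
  have key : |∫ τ in y'..y, (frameH R).der (none : CoordLabel) (fun _ => speedH a) ()
      (argP P ha i (τ, l))| ≤ S * c * Real.pi := by
    -- Since `|∂_q a| ≤ c/(1 + q²)`, a multiple of `arctan q` is a primitive of a majorant, and its
    -- variation is at most `π` times that multiple.
    refine (abs_integral_le_of_hasDerivAt
      (ψ := fun τ => -(S * c) * Real.arctan (optP P ha i (τ, l)))
      (ψ' := fun τ => -(S * c) * ((1 + optP P ha i (τ, l) ^ 2)⁻¹ * speedH a (argP P ha i (τ, l))))
      (fun τ hτ => ?_) ?_ (fun τ hτ => ?_)).trans ?_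
    · have := (optP_deriv P ha (hmem τ hτ)).arctan.const_mul (-(S * c))
      simpa [one_div] using this
    · have h1 : ContinuousOn (fun τ => optP P ha i (τ, l)) (Set.uIcc y' y) := fun τ hτ =>
        (optP_deriv P ha (hmem τ hτ)).continuousAt.continuousWithinAt
      have h2 : ContinuousOn (fun τ => speedH a (argP P ha i (τ, l))) (Set.uIcc y' y) :=
        (argP_comp_zero P ha (speedH_smooth ha) i).continuousOn.comp (by fun_prop) hmem
      exact continuousOn_const.mul (((continuousOn_const.add (h1.pow 2)).inv₀
        fun τ _ =>
          ne_of_gt (add_pos_of_pos_of_nonneg one_pos (sq_nonneg _))).mul h2)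
    · rw [speedH_der_none ha, abs_mul, abs_mul]
      have h1 : |speedH a (argP P ha i (τ, l))| = -speedH a (argP P ha i (τ, l)) := by
        refine abs_of_nonpos ?_
        simp only [speedH, speed]
        have := Real.exp_pos (a ((argP P ha i (τ, l)).1, (argP P ha i (τ, l)).2.2) *
          (argP P ha i (τ, l)).2.1)
        linarith
      have h2 := haq ((argP P ha i (τ, l)).1, (argP P ha i (τ, l)).2.2)
      have h3 : |(argP P ha i (τ, l)).2.1| ≤ S := slowP_le (hmem τ hτ)
      calc _ ≤ c * (1 + (optP P ha i (τ, l)) ^ 2)⁻¹ * S * |speedH a (argP P ha i (τ, l))| := by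
            refine mul_le_mul_of_nonneg_right (mul_le_mul h2 h3 (abs_nonneg _) ?_) (abs_nonneg _)
            exact (abs_nonneg _).trans h2
        _ = _ := by rw [h1]; simp only [argP]; ring
    · rw [← mul_sub, abs_mul, abs_neg, abs_of_nonneg (mul_nonneg hS0 hc0)]
      refine mul_le_mul_of_nonneg_left ?_ (mul_nonneg hS0 hc0)
      have h1 := Real.arctan_lt_pi_div_two (optP P ha i (y, l))
      have h2 := Real.neg_pi_div_two_lt_arctan (optP P ha i (y, l))
      have h3 := Real.arctan_lt_pi_div_two (optP P ha i (y', l))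
      have h4 := Real.neg_pi_div_two_lt_arctan (optP P ha i (y', l))
      rw [abs_le]
      constructor <;> linarith
  change _ ≤ _ * Real.exp (i.ε * l.1) ^ ⌈c * Real.pi⌉₊
  rw [← Real.exp_nat_mul, ← Real.exp_add]
  refine Real.exp_le_exp.2 ((le_abs_self _).trans (key.trans ?_))
  have h5 := Nat.le_ceil (c * Real.pi)
  have h6 : 0 ≤ i.ε * l.1 := mul_nonneg i.ε_pos.le (P.m₀_nonneg.trans hw.1.le)
  have h7 := mul_le_mul_of_nonneg_right h5 h6
  simp only [S]
  linarith

/-- The optical function is a symbol in characteristic coordinates. -/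
theorem optP_sym (n : ℕ) : (frameP P).Sym n 0 (optP P ha) := by
  induction n with
  | zero => exact ⟨optP_smooth P ha, optP_bd P ha⟩
  | succ n ih =>
    refine ⟨optP_smooth P ha, optP_bd P ha, fun z => ?_⟩
    -- The derivative in `y` is the speed evaluated at `(q, s, x)`, a composition that needs `q`
    -- only to the order already reached. In the other directions the derivative vanishes at `y =
    -- 0`, where `q = -R` identically, and solves the linearized equation with source `μ_s ∂s + μ_x
    -- ∂x`.
    by_cases hz : z = (none : CoordLabel)
    · subst hz
      exact (argP_comp P ha ih (frameH_speed n ha)).congr fun i w hw => optP_der_none P ha hw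
    · obtain ⟨v, hv⟩ := cdir_ne hz
      have hβ := argP_comp P ha ih ((frameH_speed (n + 1) ha).der (none : CoordLabel))
      have hb1 := (argP_comp P ha ih ((frameH_speed (n + 1) ha).der
        (some none : CoordLabel))).mul' ((frameP_slow P (n + 1)).der z) (add_zero 0)
      have hb2 : ∀ k : Fin 3, (frameP P).Sym n 0 fun i w =>
          (frameH R).der (some (some k) : CoordLabel) (fun _ => speedH a) () (argP P ha i w) *
          (frameP P).der z (fun _ w => ccoord (some (some k)) w) i w := fun k =>
        (argP_comp P ha ih ((frameH_speed (n + 1) ha).der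
          (some (some k) : CoordLabel))).mul' (frameP_coord P n z (some (some k))) (add_zero 0)
      refine frameP_linear P (speedP_hexp P ha) hβ
        (hb1.add (Frame.Sym.sum (s := Finset.univ) fun k _ => hb2 k))
        ((optP_smooth P ha).der z) (fun i l h => ?_) (fun i w hw => ?_)
      · exact Frame.der_eq_zero_of_boundary (optP_smooth P ha) (fun i l h => optP_zero P ha h)
          (fun _ => hv) h
      · refine (Frame.der_comm (F := frameP P) (optP_smooth P ha) (z := (none : CoordLabel))
          (z' := z) (v := cdir none) (w := cdir z) (fun _ => rfl) (fun _ => rfl) hw).trans ?_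
        refine (Frame.der_congr (fun i w hw => optP_der_none P ha hw) z i w hw).trans ?_
        exact argP_der P ha (frameH_speed 0 ha).smooth z hw

/-- Symbols in `(q, s, x)` give symbols in characteristic coordinates. -/
theorem argP_sym (n : ℕ) {f : Unit → ℝ × (ℝ × Space) → ℝ} (hf : (frameH R).Sym n 0 f) :
    (frameP P).Sym n 0 fun i w => f () (argP P ha i w) := argP_comp P ha (optP_sym P ha n) hf

end

end QuasilinearWave

end

noncomputable section

namespace QuasilinearWave

/-! ### The outgoing derivative of the optical function -/

section

variable {R : ℝ} {a b : ℝ × Space → ℝ} (P : Params R) (ha : IsCoeff R a)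

theorem hasDerivAt_line {f : Idx P.e₀ → ℝ × (ℝ × Space) → ℝ} (hf : (frameP P).Smooth f)
    {i : Idx P.e₀} {y : ℝ} {l : ℝ × Space} (hw : (y, l) ∈ (frameP P).dom i) :
    HasDerivAt (fun y => f i (y, l)) ((frameP P).der (none : CoordLabel) f i (y, l)) y :=
  (hf.differentiableAt hw).hasFDerivAt.comp_hasDerivAt y
    ((hasDerivAt_id y).prodMk (hasDerivAt_const y l))

theorem argP_der_none {f : Unit → ℝ × (ℝ × Space) → ℝ} (hf : (frameH R).Smooth f)
    {i : Idx P.e₀} {w : ℝ × (ℝ × Space)} (hw : w ∈ (frameP P).dom i) :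
    (frameP P).der (none : CoordLabel) (fun i w => f () (argP P ha i w)) i w =
      (frameH R).der (none : CoordLabel) f () (argP P ha i w) * speedH a (argP P ha i w) +
      (frameH R).der (some none : CoordLabel) f () (argP P ha i w) *
          (i.ε * (Real.exp w.2.1 + w.1)⁻¹) := by
  rw [argP_der P ha hf none hw, optP_der_none P ha hw, slowP_der P none hw]
  have h : ∀ k : Fin 3, (frameP P).der (none : CoordLabel)
      (fun _ w => ccoord (some (some k)) w) i w = 0 := fun k => by
    change fderiv ℝ (ccoord (some (some k))) w (cdir none) = 0
    rw [(ccoord (some (some k))).fderiv]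
    simp [ccoord, cdir]
  simp only [h, mul_zero, Finset.sum_const_zero, add_zero]
  simp [ccoord, cdir]

theorem speedH_der_time {a : ℝ × Space → ℝ} (ha : IsCoeff R a) (w : ℝ × (ℝ × Space)) :
    (frameH R).der (some none : CoordLabel) (fun _ => speedH a) () w =
      a (w.1, w.2.2) * speedH a w := by
  have h1 := ((speedH_smooth ha).differentiable (by simp)).differentiableAt (x := w)
    |>.hasFDerivAt.comp_hasDerivAt w.2.1 ((hasDerivAt_const w.2.1 w.1).prodMk
      ((hasDerivAt_id w.2.1).prodMk (hasDerivAt_const w.2.1 w.2.2)))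
  have h3 := (((hasDerivAt_id w.2.1).const_mul (a (w.1, w.2.2))).exp).const_mul (-2)
  refine h1.unique (h3.congr_deriv ?_)
  simp only [speedH, speed, id]
  ring

theorem prof_mul_speed (ha : IsCoeff R a) (hb : IsCoeff R b) (w : ℝ × (ℝ × Space)) :
    (frameH R).der (none : CoordLabel) (fun _ => prof a b R) () w * speedH a w =
      -2 * b (w.1, w.2.2) := by
  change fderiv ℝ (prof a b R) w (cdir none) * speedH a w = _
  rw [prof_der_none ha hb, speedH, speed, Real.exp_neg]
  field_simp

/-- The difference between `∂_m q` and its leading part. -/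
def deficitP (b : ℝ × Space → ℝ) (c : Space → ℝ) (i : Idx P.e₀) (w : ℝ × (ℝ × Space)) : ℝ :=
  (frameP P).der (some none : CoordLabel) (optP P ha) i w +
    1 / 4 * (i.ε * (c w.2.2 * (prof a b R (argP P ha i w) * speedH a (argP P ha i w))))

/-- Both terms satisfy `∂_y N = (∂_q μ) N + source`. For `∂_m q` the source is `μ_s ∂_m s = ε a μ
e^m / t`. For `¼ ε c U μ` the identity `U_q μ = -2b` and `a = ½ c b` give `-ε a μ`, plus terms
carrying `∂_y s = ε/t`. The sum has a source of degree `-1`, and linear equations preserve the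
degree. -/
theorem deficitP_sym (hb : IsCoeff R b) {c : Space → ℝ} (hcs : ContDiff ℝ ∞ c)
    (hc : ∀ n, (frameP P).Sym n 0 fun _ w => c w.2.2)
    (hac : ∀ p x, a (p, x) = 1 / 2 * c x * b (p, x)) (n : ℕ) :
    (frameP P).Sym n (-1) (deficitP P ha b c) := by
  have hQ := optP_smooth P ha
  have hU := fun n => argP_sym P ha n (frameH_prof n ha hb)
  have hμ := fun n => argP_sym P ha n (frameH_speed n ha)
  have hA := argP_sym P ha n (frameH_coeff R n ha.smooth ha.compact)
  have hUs := argP_sym P ha n ((frameH_prof (n + 1) ha hb).der (some none : CoordLabel))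
  have hβ := argP_sym P ha n ((frameH_speed (n + 1) ha).der (none : CoordLabel))
  have hεt := (frameP_t_inv P n).const_mul (c := fun i : Idx P.e₀ => i.ε) (fun i => i.abs_ε_le)
  have hsmooth : (frameP P).Smooth (deficitP P ha b c) := fun i =>
    ((hQ.der (some none : CoordLabel)) i).add (contDiffOn_const.mul (contDiffOn_const.mul
      ((hcs.comp_contDiffOn (by fun_prop)).mul (((hU 0).smooth i).mul ((hμ 0).smooth i)))))
  have hsource : (frameP P).Sym n (-1) fun i w =>
      (-(a ((argP P ha i w).1, (argP P ha i w).2.2) * (speedH a (argP P ha i w) * w.1)) +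
        1 / 4 * (i.ε * (c w.2.2 * (((frameH R).der (some none : CoordLabel)
          (fun _ => prof a b R) () (argP P ha i w) * speedH a (argP P ha i w)) +
          prof a b R (argP P ha i w) * (a ((argP P ha i w).1, (argP P ha i w).2.2) *
          speedH a (argP P ha i w)))))) * (i.ε * (Real.exp w.2.1 + w.1)⁻¹) := by
    refine Frame.Sym.mul' (k := 0) (Frame.Sym.add ?_ ?_) hεt (by norm_num)
    · exact (hA.mul' ((hμ n).mul' (frameP_y_sym P n) (add_zero 0)) (add_zero 0)).neg
    · refine Frame.Sym.real_mul _ (Frame.Sym.const_mul (c := fun i : Idx P.e₀ => i.ε)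
        (fun i => i.abs_ε_le) ?_)
      exact (hc n).mul' ((hUs.mul' (hμ n) (add_zero 0)).add
        ((hU n).mul' (hA.mul' (hμ n) (add_zero 0)) (add_zero 0))) (add_zero 0)
  refine frameP_linear P (speedP_hexp P ha) hβ hsource hsmooth (fun i l h => ?_) ?_
  -- At `y = 0` one has `q = -R` for every `m`, so `∂_m q = 0`, and the profile vanishes there as
  -- well.
  · have h1 := Frame.der_eq_zero_of_boundary (F := frameP P) (z := (some none : CoordLabel)) hQ
      (fun i l h => optP_zero P ha h) (w := (1, 0)) (fun _ => rfl) h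
    have h2 : prof a b R (argP P ha i (0, l)) = 0 :=
      prof_of_le hb (optP_zero P ha h).le _
    rw [deficitP, h1, h2]
    simp
  · rintro i ⟨y, l⟩ hw
    have d1 := hasDerivAt_line P (hQ.der (some none : CoordLabel)) hw
    have d2 := hasDerivAt_line P (hU 0).smooth hw
    have d3 := hasDerivAt_line P (hμ 0).smooth hw
    have d := d1.add ((((d2.mul d3).const_mul (c l.2)).const_mul i.ε).const_mul (1 / 4))
    refine (der_none_eq P hsmooth hw d).trans ?_
    have e1 : (frameP P).der (none : CoordLabel)
        ((frameP P).der (some none : CoordLabel) (optP P ha)) i (y, l) =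
        (frameP P).der (some none : CoordLabel) (fun i w => speedH a (argP P ha i w)) i (y, l) :=
      (Frame.der_comm (F := frameP P) hQ (z := (none : CoordLabel))
        (z' := (some none : CoordLabel)) (v := cdir none) (w := cdir (some none))
        (fun _ => rfl) (fun _ => rfl) hw).trans
        (Frame.der_congr (F := frameP P) (fun i w hw => optP_der_none P ha hw)
          (some none : CoordLabel) i _ hw)
    have e2 := argP_der P ha (frameH_speed 0 ha).smooth (some none) hw
    have e3 : ∀ k : Fin 3, (frameP P).der (some none : CoordLabel)
        (fun _ w => ccoord (some (some k)) w) i (y, l) = 0 := fun k => by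
      change fderiv ℝ (ccoord (some (some k))) (y, l) (cdir (some none)) = 0
      rw [(ccoord (some (some k))).fderiv]
      simp [ccoord, cdir]
    have e4 := slowP_der P (some none) hw
    have e5 := argP_der_none P ha (frameH_prof 0 ha hb).smooth hw
    have e6 := argP_der_none P ha (frameH_speed 0 ha).smooth hw
    have e7 := prof_mul_speed ha hb (argP P ha i (y, l))
    have e8 : a ((argP P ha i (y, l)).1, (argP P ha i (y, l)).2.2) =
        1 / 2 * c l.2 * b ((argP P ha i (y, l)).1, (argP P ha i (y, l)).2.2) := hac _ _
    simp only [e3, mul_zero, Finset.sum_const_zero, add_zero] at e2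
    rw [e1, e2, e4, e5, e6, e7, speedH_der_time ha]
    have e9 : ccoord (some none) (cdir (some none)) = 1 := by simp [ccoord, cdir]
    have e10 : ccoord none (cdir (some none)) = 0 := by simp [ccoord, cdir]
    have ht := (frameP_t_pos hw).ne'
    simp only at ht
    -- Writing `e^m / t = 1 - y/t` isolates the part that cancels; the remainder `y/t` has degree
    -- `-1`, since `y` is only as large as a power of the weight.
    have e11 : (Real.exp l.1 + y)⁻¹ * Real.exp l.1 = 1 - y * (Real.exp l.1 + y)⁻¹ := by
      field_simp
      ring
    simp only [deficitP, e9, e10, mul_one, add_zero, e11]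
    generalize (frameP P).der (some none : CoordLabel) (optP P ha) i (y, l) = N
    generalize (frameH R).der (none : CoordLabel) (fun _ => speedH a) () (argP P ha i (y, l)) = μq
    generalize (frameH R).der (some none : CoordLabel) (fun _ => prof a b R) ()
      (argP P ha i (y, l)) = Us
    generalize speedH a (argP P ha i (y, l)) = μ
    generalize prof a b R (argP P ha i (y, l)) = U
    generalize (Real.exp l.1 + y)⁻¹ = τ
    rw [e8]
    ring

end

end QuasilinearWave

end

noncomputable section

namespace QuasilinearWave

namespace Frame

variable {ι E : Type} [NormedAddCommGroup E] [NormedSpace ℝ E] {F : Frame ι E}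
  {f g : ι → E → ℝ} {i : ι} {p : E}

theorem der_mul (hf : F.Smooth f) (hg : F.Smooth g) (z : F.κ) (hp : p ∈ F.dom i) :
    F.der z (fun i p => f i p * g i p) i p = f i p * F.der z g i p + F.der z f i p * g i p := by
  simp only [Frame.der]
  rw [fderiv_fun_mul (hf.differentiableAt hp) (hg.differentiableAt hp)]
  simp only [add_apply, smul_apply, smul_eq_mul]
  ring

theorem der_add (hf : F.Smooth f) (hg : F.Smooth g) (z : F.κ) (hp : p ∈ F.dom i) :
    F.der z (fun i p => f i p + g i p) i p = F.der z f i p + F.der z g i p := by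
  simp only [Frame.der]
  rw [fderiv_fun_add (hf.differentiableAt hp) (hg.differentiableAt hp)]
  simp only [add_apply]

theorem der_sub (hf : F.Smooth f) (hg : F.Smooth g) (z : F.κ) (hp : p ∈ F.dom i) :
    F.der z (fun i p => f i p - g i p) i p = F.der z f i p - F.der z g i p := by
  simp only [Frame.der]
  rw [fderiv_fun_sub (hf.differentiableAt hp) (hg.differentiableAt hp)]
  simp only [sub_apply]

theorem der_sum {α : Type} {s : Finset α} {f : α → ι → E → ℝ} (hf : ∀ a, F.Smooth (f a)) (z : F.κ)
    (hp : p ∈ F.dom i) :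
    F.der z (fun i p => ∑ a ∈ s, f a i p) i p = ∑ a ∈ s, F.der z (f a) i p := by
  simp only [Frame.der]
  rw [fderiv_fun_sum fun a _ => (hf a).differentiableAt hp]
  simp only [sum_apply]

theorem Smooth.mul (hf : F.Smooth f) (hg : F.Smooth g) : F.Smooth fun i p => f i p * g i p :=
  fun i => (hf i).mul (hg i)

theorem Smooth.sum {α : Type} {s : Finset α} {f : α → ι → E → ℝ} (hf : ∀ a, F.Smooth (f a)) :
    F.Smooth fun i p => ∑ a ∈ s, f a i p := fun i => ContDiffOn.sum fun a _ => hf a i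

end Frame

/-! ### Frames on conic regions of spacetime -/

/-- A family of open regions where `r` is comparable to `t`; the weight is `t ^ (θ ε)`. -/
structure Cone (e₀ : ℝ) where
  θ : ℝ
  θ_nonneg : 0 ≤ θ
  dom : Idx e₀ → Set Spacetime
  isOpen : ∀ i, IsOpen (dom i)
  time : ∀ i, ∀ p ∈ dom i, 1 ≤ p.1
  lower : ∀ i, ∀ p ∈ dom i, p.1 ≤ 4 * ‖p.2‖
  upper : ∀ i, ∀ p ∈ dom i, ‖p.2‖ ≤ 2 * p.1

/-- The vector of a commuting field. -/
def VField.vec : VField → Spacetime → Spacetime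
  | .translation α, _ => coordDir α
  | .scaling, p => p.1 • coordDir 0 + ∑ i : Fin 3, p.2 i • coordDir i.succ
  | .rotation i j, p => p.2 j • coordDir i.succ - p.2 i • coordDir j.succ
  | .boost i, p => p.2 i • coordDir 0 + p.1 • coordDir i.succ

theorem VField.act_eq (z : VField) (φ : Spacetime → ℝ) (p : Spacetime) :
    z.act φ p = fderiv ℝ φ p (z.vec p) := by
  cases z <;> simp [VField.act, VField.vec, pd]

theorem VField.vec_smooth (z : VField) : ContDiff ℝ ∞ z.vec := by
  have hx : ∀ i : Fin 3, ContDiff ℝ ∞ fun p : Spacetime => p.2 i := fun i => by fun_prop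
  have ht : ContDiff ℝ ∞ fun p : Spacetime => p.1 := contDiff_fst
  cases z with
  | translation α => exact contDiff_const
  | scaling =>
    exact (ht.smul contDiff_const).add (ContDiff.sum fun i _ => (hx i).smul contDiff_const)
  | rotation i j => exact ((hx j).smul contDiff_const).sub ((hx i).smul contDiff_const)
  | boost i => exact ((hx i).smul contDiff_const).add (ht.smul contDiff_const)

variable {e₀ : ℝ}

/-- The frame of the commuting vector fields. -/
def frameZ (D : Cone e₀) : Frame (Idx e₀) Spacetime where
  κ := VField
  X z := z.vec
  dom := D.dom
  ρ p := p.1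
  W i p := p.1 ^ (D.θ * i.ε)
  X_smooth z := z.vec_smooth
  isOpen := D.isOpen
  ρ_pos i p hp := one_pos.trans_le (D.time i p hp)
  one_le_W i p hp := Real.one_le_rpow (D.time i p hp) (mul_nonneg D.θ_nonneg i.ε_pos.le)

/-- The frame of the scaled coordinate fields `t ∂_α`. -/
def frameD (D : Cone e₀) : Frame (Idx e₀) Spacetime where
  κ := Fin 4
  X α p := p.1 • coordDir α
  dom := D.dom
  ρ p := p.1
  W i p := p.1 ^ (D.θ * i.ε)
  X_smooth _ := contDiff_fst.smul contDiff_const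
  isOpen := D.isOpen
  ρ_pos i p hp := one_pos.trans_le (D.time i p hp)
  one_le_W i p hp := Real.one_le_rpow (D.time i p hp) (mul_nonneg D.θ_nonneg i.ε_pos.le)

instance (D : Cone e₀) : Fintype (frameD D).κ := inferInstanceAs (Fintype (Fin 4))

/-- The Cartesian coordinates. -/
def coordS : Fin 4 → Spacetime →L[ℝ] ℝ :=
  Fin.cons (ContinuousLinearMap.fst ℝ ℝ Space) fun i =>
    (EuclideanSpace.proj i : Space →L[ℝ] ℝ).comp (ContinuousLinearMap.snd ℝ ℝ Space)

theorem coordS_zero (p : Spacetime) : coordS 0 p = p.1 := rfl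

theorem coordS_succ (k : Fin 3) (p : Spacetime) : coordS k.succ p = p.2 k := rfl

theorem coordDir_zero : coordDir 0 = ((1 : ℝ), (0 : Space)) := rfl

theorem coordDir_succ (k : Fin 3) :
    coordDir k.succ = ((0 : ℝ), EuclideanSpace.single k (1 : ℝ)) := rfl

theorem coordS_sum (v : Spacetime) : v = ∑ α, coordS α v • coordDir α := by
  rw [Fin.sum_univ_succ]
  obtain ⟨t, x⟩ := v
  have h : ∑ k : Fin 3, coordS k.succ (t, x) • coordDir k.succ = ((0 : ℝ), x) := by
    conv_rhs => rw [space_sum_single x]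
    simp [coordS_succ, coordDir_succ, Fin.sum_univ_three]
  rw [h]
  simp [coordS_zero, coordDir_zero]

section

variable {D : Cone e₀}

theorem frameD_weaken {n : ℕ} {f : Idx e₀ → Spacetime → ℝ} {k l : ℤ} (hkl : k ≤ l)
    (hf : (frameD D).Sym n k f) : (frameD D).Sym n l f := by
  refine hf.weaken (K := 1) fun i p hp => ?_
  rw [one_mul]
  exact zpow_le_zpow_right₀ (D.time i p hp) hkl

theorem frameZ_weaken {n : ℕ} {f : Idx e₀ → Spacetime → ℝ} {k l : ℤ} (hkl : k ≤ l)
    (hf : (frameZ D).Sym n k f) : (frameZ D).Sym n l f := by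
  refine hf.weaken (K := 1) fun i p hp => ?_
  rw [one_mul]
  exact zpow_le_zpow_right₀ (D.time i p hp) hkl

variable (D)

theorem Cone.t_pos {i : Idx e₀} {p : Spacetime} (hp : p ∈ D.dom i) : 0 < p.1 :=
  one_pos.trans_le (D.time i p hp)

theorem Cone.r_pos {i : Idx e₀} {p : Spacetime} (hp : p ∈ D.dom i) : 0 < ‖p.2‖ := by
  have := D.t_pos hp
  have := D.lower i p hp
  linarith

theorem frameD_const (n : ℕ) (c : ℝ) : (frameD D).Sym n 0 fun _ _ => c :=
  Frame.Sym.const (c := fun _ => c) (M := |c|) (fun _ => le_rfl) n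

theorem frameZ_const (n : ℕ) (c : ℝ) : (frameZ D).Sym n 0 fun _ _ => c :=
  Frame.Sym.const (c := fun _ => c) (M := |c|) (fun _ => le_rfl) n

theorem frameD_t (n : ℕ) : (frameD D).Sym n 1 fun _ p => p.1 := by
  have hb : (frameD D).Bd 1 fun _ p => p.1 := ⟨1, zero_le_one, 0, fun i p hp => by
    rw [pow_zero, mul_one, one_mul, zpow_one, abs_of_pos (D.t_pos hp)]; exact le_rfl⟩
  induction n with
  | zero => exact ⟨fun _ => contDiffOn_fst, hb⟩
  | succ n ih =>
    refine ⟨fun _ => contDiffOn_fst, hb, fun α => ?_⟩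
    refine (ih.mul' (frameD_const D n (coordDir α).1) (add_zero 1)).congr fun i p _ => ?_
    change fderiv ℝ Prod.fst p (p.1 • coordDir α) = _
    rw [fderiv_fst]
    rfl

theorem frameD_coord (n : ℕ) (β : Fin 4) : (frameD D).Sym n 1 fun _ p => coordS β p := by
  refine Frame.Sym.intro (fun _ => (coordS β).contDiff.contDiffOn) ?_ fun m _ α => ?_
  · refine ⟨2, zero_le_two, 0, fun i p hp => ?_⟩
    rw [pow_zero, mul_one, zpow_one]
    change _ ≤ 2 * p.1
    have h1 := D.upper i p hp
    have h2 := D.t_pos hp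
    refine Fin.cases ?_ (fun k => ?_) β
    · change |p.1| ≤ _
      rw [abs_of_pos h2]; linarith
    · exact (PiLp.norm_apply_le p.2 k).trans h1
  · refine ((frameD_t D m).mul' (frameD_const D m (coordS β (coordDir α))) (add_zero 1)).congr
      fun i p _ => ?_
    change fderiv ℝ (coordS β) p (p.1 • coordDir α) = _
    rw [(coordS β).fderiv, map_smul, smul_eq_mul]

theorem frameD_t_inv (n : ℕ) : (frameD D).Sym n (-1) fun _ p => p.1⁻¹ := by
  refine (frameD_t D n).inv (fun i p hp => (D.t_pos hp).ne') ⟨1, zero_le_one, 0, fun i p hp => ?_⟩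
  rw [pow_zero, mul_one, one_mul, zpow_neg_one, abs_of_pos (inv_pos.2 (D.t_pos hp))]
  exact le_rfl

theorem fderiv_r {p : Spacetime} (hp : p.2 ≠ 0) (v : Spacetime) :
    fderiv ℝ (fun p : Spacetime => ‖p.2‖) p v = ‖p.2‖⁻¹ * ∑ k : Fin 3, p.2 k * v.2 k := by
  have hd : DifferentiableAt ℝ (fun p : Spacetime => ‖p.2‖) p :=
    (contDiffAt_snd.norm ℝ hp (n := 1)).differentiableAt (by simp)
  have h1 := (hd.hasFDerivAt.pow 2)
  have h2 : HasFDerivAt (fun p : Spacetime => ‖p.2‖ ^ 2) _ p :=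
    (hasFDerivAt_snd (𝕜 := ℝ) (E := ℝ) (F := Space) (p := p)).norm_sq
  have h3 := congrArg (fun L => L v) (h1.unique h2)
  have h4 : ‖p.2‖ ≠ 0 := norm_ne_zero_iff.2 hp
  have h5 : inner ℝ p.2 v.2 = ∑ k : Fin 3, p.2 k * v.2 k := by
    simp [PiLp.inner_apply, mul_comm]
  simp at h3
  rw [h5] at h3
  field_simp
  linarith

theorem frameD_r_smooth : (frameD D).Smooth fun _ p => ‖p.2‖ := fun _ =>
  contDiffOn_norm_snd.mono fun _ hp => norm_pos_iff.1 (D.r_pos hp)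

theorem frameD_r (n : ℕ) : (frameD D).Sym n 1 (fun _ p => ‖p.2‖) ∧
    (frameD D).Sym n (-1) fun _ p => ‖p.2‖⁻¹ := by
  have hb : (frameD D).Bd 1 fun _ p => ‖p.2‖ := ⟨2, zero_le_two, 0, fun i p hp => by
    rw [pow_zero, mul_one, zpow_one, abs_of_nonneg (norm_nonneg _)]
    exact D.upper i p hp⟩
  have hbi : (frameD D).Bd (-1) fun _ p => ‖p.2‖⁻¹ := ⟨4, by norm_num, 0, fun i p hp => by
    rw [pow_zero, mul_one, zpow_neg_one, abs_of_nonneg (inv_nonneg.2 (norm_nonneg _))]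
    change _ ≤ 4 * p.1⁻¹
    have h1 := D.lower i p hp
    have h2 := D.t_pos hp
    have h3 := D.r_pos hp
    field_simp
    linarith⟩
  have hinv : ∀ n, (frameD D).Sym n 1 (fun _ p => ‖p.2‖) →
      (frameD D).Sym n (-1) fun _ p => ‖p.2‖⁻¹ := fun n h =>
    h.inv (fun i p hp => (D.r_pos hp).ne') hbi
  suffices h : (frameD D).Sym n 1 (fun _ p => ‖p.2‖) from ⟨h, hinv n h⟩
  induction n with
  | zero => exact ⟨frameD_r_smooth D, hb⟩
  | succ n ih =>
    refine ⟨frameD_r_smooth D, hb, fun α => ?_⟩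
    refine ((hinv n ih).mul' (Frame.Sym.sum (s := Finset.univ) fun k _ =>
      (frameD_coord D n (Fin.succ k)).mul' ((frameD_t D n).mul'
        (frameD_const D n ((coordDir α).2 k)) (add_zero 1)) (by norm_num : (1 : ℤ) + 1 = 2))
      (by norm_num)).congr fun i p hp => ?_
    change fderiv ℝ (fun p : Spacetime => ‖p.2‖) p (p.1 • coordDir α) = _
    rw [fderiv_r (norm_pos_iff.1 (D.r_pos hp))]
    rfl

theorem frameD_r_inv (n : ℕ) : (frameD D).Sym n (-1) fun _ p => ‖p.2‖⁻¹ := (frameD_r D n).2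

/-- The components of `x / |x|`. -/
def om (k : Fin 3) (p : Spacetime) : ℝ := ‖p.2‖⁻¹ * p.2 k

theorem frameD_om (n : ℕ) (k : Fin 3) : (frameD D).Sym n 0 fun _ p => om k p :=
  (frameD_r_inv D n).mul' (frameD_coord D n k.succ) (by norm_num)

theorem frameD_vec (n : ℕ) (z : VField) (α : Fin 4) :
    (frameD D).Sym n 1 fun _ p => coordS α (z.vec p) := by
  have ht := frameD_coord D n 0
  have hx := fun k : Fin 3 => frameD_coord D n k.succ
  have hc := fun β => frameD_const D n (coordS α (coordDir β))
  cases z with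
  | translation β => exact frameD_weaken (by norm_num) (hc β)
  | scaling =>
    refine (frameD_coord D n α).congr fun i p _ => ?_
    congr 1
    conv_rhs => rw [coordS_sum p, Fin.sum_univ_succ]
    rfl
  | rotation i j =>
    refine (((hx j).mul' (hc i.succ) (add_zero 1)).sub
      ((hx i).mul' (hc j.succ) (add_zero 1))).congr fun _ p _ => ?_
    simp [VField.vec, coordS_succ]
  | boost i =>
    refine (((hx i).mul' (hc 0) (add_zero 1)).add
      (ht.mul' (hc i.succ) (add_zero 1))).congr fun _ p _ => ?_
    simp [VField.vec, coordS_succ, coordS_zero]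

/-- Symbols for the fields `t ∂_α` are symbols for the commuting fields. -/
theorem frameZ_of_frameD {n : ℕ} {k : ℤ} {f : Idx e₀ → Spacetime → ℝ} (hf : (frameD D).Sym n k f) :
    (frameZ D).Sym n k f := by
  -- Passing to the commuting fields requires the coefficients `Z^α / t` to be symbols for those
  -- fields to lower orders; they are symbols for `t ∂_α`, so the statement itself provides this.
  induction n using Nat.strong_induction_on generalizing k f with
  | _ n ih =>
    refine Frame.Sym.change (F₁ := frameZ D) (F₂ := frameD D) (fun _ => rfl) rfl rfl
      (c := fun z α _ p => coordS α (VField.vec z p) * p.1⁻¹) (fun z i p hp => ?_)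
      (fun m hm z α => ih m hm ((frameD_vec D m z α).mul' (frameD_t_inv D m) (by norm_num))) hf
    change VField.vec z p = ∑ α, (coordS α (VField.vec z p) * p.1⁻¹) • (p.1 • coordDir α)
    have h := (D.t_pos hp).ne'
    simp only [smul_smul, inv_mul_cancel_right₀ h]
    exact coordS_sum _

theorem frameZ_r_inv (n : ℕ) : (frameZ D).Sym n (-1) fun _ p => ‖p.2‖⁻¹ :=
  frameZ_of_frameD D (frameD_r_inv D n)

theorem frameZ_om (n : ℕ) (k : Fin 3) : (frameZ D).Sym n 0 fun _ p => om k p :=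
  frameZ_of_frameD D (frameD_om D n k)

theorem om_sq {p : Spacetime} (hp : p.2 ≠ 0) : ∑ k : Fin 3, om k p * om k p = 1 := by
  have h1 : ‖p.2‖ ≠ 0 := norm_ne_zero_iff.2 hp
  have h2 := EuclideanSpace.norm_sq_eq p.2
  simp only [om]
  simp only [Real.norm_eq_abs, sq_abs] at h2
  have h3 : ∑ k : Fin 3, ‖p.2‖⁻¹ * p.2 k * (‖p.2‖⁻¹ * p.2 k) =
      (‖p.2‖ ^ 2)⁻¹ * ∑ k : Fin 3, p.2 k ^ 2 := by
    rw [Finset.mul_sum]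
    refine Finset.sum_congr rfl fun k _ => ?_
    rw [← inv_pow]
    ring
  rw [h3, ← h2, inv_mul_cancel₀ (pow_ne_zero 2 h1)]

theorem r_mul_om {p : Spacetime} (hp : p.2 ≠ 0) (k : Fin 3) : ‖p.2‖ * om k p = p.2 k :=
  mul_inv_cancel_left₀ (norm_ne_zero_iff.2 hp) _

theorem Frame.Sym.pd {n : ℕ} {k : ℤ} {f : Idx e₀ → Spacetime → ℝ}
    (hf : (frameZ D).Sym (n + 1) k f) (α : Fin 4) :
    (frameZ D).Sym n k fun i => QuasilinearWave.pd α (f i) := hf.der (VField.translation α)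

/-- For the scaled fields, a derivative lowers the degree. -/
theorem frameD_pd {n : ℕ} {k : ℤ} {f : Idx e₀ → Spacetime → ℝ} (hf : (frameD D).Sym (n + 1) k f)
    (α : Fin 4) : (frameD D).Sym n (k - 1) fun i => pd α (f i) := by
  refine ((frameD_t_inv D n).mul' (hf.der α) (by ring)).congr fun i p hp => ?_
  change _ = p.1⁻¹ * fderiv ℝ (f i) p (p.1 • coordDir α)
  rw [map_smul, smul_eq_mul, inv_mul_cancel_left₀ (D.t_pos hp).ne']
  rfl

/-! ### The null frame -/

/-- The radial derivative. -/
def opR (f : Spacetime → ℝ) (p : Spacetime) : ℝ := ∑ k : Fin 3, om k p * pd k.succ f p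

/-- The outgoing derivative `∂_t + ∂_r`. -/
def opL (f : Spacetime → ℝ) (p : Spacetime) : ℝ := pd 0 f p + opR f p

/-- The incoming derivative `∂_t - ∂_r`. -/
def opB (f : Spacetime → ℝ) (p : Spacetime) : ℝ := pd 0 f p - opR f p

/-- The angular derivative `∂_k - ω_k ∂_r`. -/
def opP (k : Fin 3) (f : Spacetime → ℝ) (p : Spacetime) : ℝ := pd k.succ f p - om k p * opR f p

variable {D}
variable {n : ℕ} {k : ℤ} {f : Idx e₀ → Spacetime → ℝ}

theorem Frame.Sym.opR (hf : (frameZ D).Sym (n + 1) k f) :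
    (frameZ D).Sym n k fun i => opR (f i) :=
  Frame.Sym.sum (s := Finset.univ) fun j _ => (frameZ_om D n j).mul' (hf.pd D j.succ) (zero_add k)

theorem Frame.Sym.opB (hf : (frameZ D).Sym (n + 1) k f) :
    (frameZ D).Sym n k fun i => opB (f i) := (hf.pd D 0).sub hf.opR

/-- `(t + r) L = S + Σ ω_j Ω_{0j}`, which shows the gain of `1/t`. -/
theorem Frame.Sym.opL (hf : (frameZ D).Sym (n + 1) k f) :
    (frameZ D).Sym n (k - 1) fun i => opL (f i) := by
  have h1 : (frameZ D).Sym n (-1) fun _ p => (p.1 + ‖p.2‖)⁻¹ := by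
    refine frameZ_of_frameD D (((frameD_t D n).add (frameD_r D n).1).inv (fun i p hp => ?_)
      ⟨1, zero_le_one, 0, fun i p hp => ?_⟩)
    · exact (add_pos (D.t_pos hp) (D.r_pos hp)).ne'
    · rw [pow_zero, mul_one, one_mul, zpow_neg_one, abs_of_pos
        (inv_pos.2 (add_pos (D.t_pos hp) (D.r_pos hp)))]
      have h2 := D.r_pos hp
      exact inv_anti₀ (D.t_pos hp) (by change p.1 ≤ p.1 + ‖p.2‖; linarith)
  refine (h1.mul' ((hf.der VField.scaling).add (Frame.Sym.sum (s := Finset.univ) fun j _ =>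
    (frameZ_om D n j).mul' (hf.der (VField.boost j)) (zero_add k))) (by ring)).congr
    fun i p hp => ?_
  have hx : p.2 ≠ 0 := norm_pos_iff.1 (D.r_pos hp)
  have hne : p.1 + ‖p.2‖ ≠ 0 := (add_pos (D.t_pos hp) (D.r_pos hp)).ne'
  have e1 : (frameZ D).der VField.scaling f i p =
      p.1 * QuasilinearWave.pd 0 (f i) p + ∑ j : Fin 3, p.2 j * QuasilinearWave.pd j.succ (f i) p :=
    (VField.act_eq VField.scaling (f i) p).symm
  have e2 : ∀ j : Fin 3, (frameZ D).der (VField.boost j) f i p =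
      p.2 j * QuasilinearWave.pd 0 (f i) p + p.1 * QuasilinearWave.pd j.succ (f i) p := fun j =>
    (VField.act_eq (VField.boost j) (f i) p).symm
  have hω := om_sq hx
  rw [e1, eq_inv_mul_iff_mul_eq₀ hne]
  simp only [e2, ← r_mul_om hx, QuasilinearWave.opL, QuasilinearWave.opR, Fin.sum_univ_three] at hω ⊢
  linear_combination (-‖p.2‖ * QuasilinearWave.pd 0 (f i) p) * hω

/-- `r (∂_j - ω_j ∂_r) = Σ_l ω_l Ω_{jl}`, with the same gain. -/
theorem Frame.Sym.opP (hf : (frameZ D).Sym (n + 1) k f) (j : Fin 3) :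
    (frameZ D).Sym n (k - 1) fun i => opP j (f i) := by
  refine ((frameZ_r_inv D n).mul' (Frame.Sym.sum (s := Finset.univ) fun l _ =>
    (frameZ_om D n l).mul' (hf.der (VField.rotation j l)) (zero_add k)) (by ring)).congr
    fun i p hp => ?_
  have hx : p.2 ≠ 0 := norm_pos_iff.1 (D.r_pos hp)
  have hne : ‖p.2‖ ≠ 0 := (D.r_pos hp).ne'
  have e2 : ∀ l : Fin 3, (frameZ D).der (VField.rotation j l) f i p =
      p.2 l * QuasilinearWave.pd j.succ (f i) p - p.2 j * QuasilinearWave.pd l.succ (f i) p :=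
    fun l => (VField.act_eq (VField.rotation j l) (f i) p).symm
  have hω := om_sq hx
  rw [eq_inv_mul_iff_mul_eq₀ hne]
  simp only [e2, ← r_mul_om hx, QuasilinearWave.opP, QuasilinearWave.opR, Fin.sum_univ_three] at hω ⊢
  linear_combination (-‖p.2‖ * QuasilinearWave.pd j.succ (f i) p) * hω

end

end QuasilinearWave

end

noncomputable section

namespace QuasilinearWave

/-! ### Symbols of all orders -/

namespace Frame

variable {ι E : Type} [NormedAddCommGroup E] [NormedSpace ℝ E] {F : Frame ι E}

/-- Symbols of degree `k`. -/
def Symbol (F : Frame ι E) (k : ℤ) (f : ι → E → ℝ) : Prop := ∀ n, F.Sym n k f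

variable {f g : ι → E → ℝ} {k l m : ℤ}

theorem Symbol.smooth (hf : F.Symbol k f) : F.Smooth f := (hf 0).smooth

theorem Symbol.congr (hf : F.Symbol k f) (h : ∀ i, ∀ p ∈ F.dom i, g i p = f i p) : F.Symbol k g :=
  fun n => (hf n).congr h

theorem Symbol.add (hf : F.Symbol k f) (hg : F.Symbol k g) :
    F.Symbol k fun i p => f i p + g i p := fun n => (hf n).add (hg n)

theorem Symbol.sub (hf : F.Symbol k f) (hg : F.Symbol k g) :
    F.Symbol k fun i p => f i p - g i p := fun n => (hf n).sub (hg n)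

theorem Symbol.mul (hf : F.Symbol k f) (hg : F.Symbol l g) (h : k + l = m) :
    F.Symbol m fun i p => f i p * g i p := fun n => (hf n).mul' (hg n) h

theorem Symbol.real_mul (c : ℝ) (hf : F.Symbol k f) : F.Symbol k fun i p => c * f i p :=
  fun n => (hf n).real_mul c

theorem Symbol.sum {α : Type} {s : Finset α} {f : α → ι → E → ℝ} (hf : ∀ a, F.Symbol k (f a)) :
    F.Symbol k fun i p => ∑ a ∈ s, f a i p := fun n => Sym.sum fun a _ => hf a n

theorem Symbol.der (hf : F.Symbol k f) (z : F.κ) : F.Symbol k (F.der z f) :=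
  fun n => (hf (n + 1)).der z

end Frame

/-! ### The wave operator in the null frame -/

section

variable {e₀ : ℝ} {D : Cone e₀} {f g : Idx e₀ → Spacetime → ℝ} {k l : ℤ}

theorem Frame.Symbol.pd (hf : (frameZ D).Symbol k f) (α : Fin 4) :
    (frameZ D).Symbol k fun i => QuasilinearWave.pd α (f i) := fun n => (hf (n + 1)).pd D α

theorem Frame.Symbol.opB (hf : (frameZ D).Symbol k f) :
    (frameZ D).Symbol k fun i => QuasilinearWave.opB (f i) := fun n => (hf (n + 1)).opB

theorem Frame.Symbol.opL (hf : (frameZ D).Symbol k f) (h : l + 1 = k) :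
    (frameZ D).Symbol l fun i => QuasilinearWave.opL (f i) := fun n =>
  (hf (n + 1)).opL.congr_deg (by omega)

theorem Frame.Symbol.opP (hf : (frameZ D).Symbol k f) (h : l + 1 = k) (j : Fin 3) :
    (frameZ D).Symbol l fun i => QuasilinearWave.opP j (f i) := fun n =>
  ((hf (n + 1)).opP j).congr_deg (by omega)

theorem Frame.Symbol.weakenZ (hf : (frameZ D).Symbol k f) (h : k ≤ l) : (frameZ D).Symbol l f :=
  fun n => frameZ_weaken h (hf n)

theorem Frame.Symbol.ofD (hf : (frameD D).Symbol k f) : (frameZ D).Symbol k f :=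
  fun n => frameZ_of_frameD D (hf n)

theorem Frame.Symbol.pdD (hf : (frameD D).Symbol k f) (h : l + 1 = k) (α : Fin 4) :
    (frameD D).Symbol l fun i => QuasilinearWave.pd α (f i) := fun n =>
  (frameD_pd D (hf (n + 1)) α).congr_deg (by omega)

variable (D) in
theorem symbol_om (j : Fin 3) : (frameZ D).Symbol 0 fun _ => om j := fun n => frameZ_om D n j

variable (D) in
theorem symbol_r_inv : (frameZ D).Symbol (-1) fun _ p => ‖p.2‖⁻¹ := fun n => frameZ_r_inv D n

variable (D) in
theorem symbol_const (c : ℝ) : (frameZ D).Symbol 0 fun _ _ => c := fun n => frameZ_const D n c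

variable {i : Idx e₀} {p : Spacetime}

theorem pd_mul (hf : (frameZ D).Smooth f) (hg : (frameZ D).Smooth g) (α : Fin 4)
    (hp : p ∈ D.dom i) :
    pd α (fun p => f i p * g i p) p = f i p * pd α (g i) p + pd α (f i) p * g i p :=
  Frame.der_mul hf hg (VField.translation α) hp

theorem pd_add (hf : (frameZ D).Smooth f) (hg : (frameZ D).Smooth g) (α : Fin 4)
    (hp : p ∈ D.dom i) : pd α (fun p => f i p + g i p) p = pd α (f i) p + pd α (g i) p :=
  Frame.der_add hf hg (VField.translation α) hp

theorem pd_sub (hf : (frameZ D).Smooth f) (hg : (frameZ D).Smooth g) (α : Fin 4)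
    (hp : p ∈ D.dom i) : pd α (fun p => f i p - g i p) p = pd α (f i) p - pd α (g i) p :=
  Frame.der_sub hf hg (VField.translation α) hp

theorem pd_sum {α : Type} {s : Finset α} {f : α → Idx e₀ → Spacetime → ℝ}
    (hf : ∀ a, (frameZ D).Smooth (f a)) (β : Fin 4) (hp : p ∈ D.dom i) :
    pd β (fun p => ∑ a ∈ s, f a i p) p = ∑ a ∈ s, pd β (f a i) p :=
  Frame.der_sum hf (VField.translation β) hp

theorem pd_congr (h : ∀ i, ∀ p ∈ D.dom i, g i p = f i p) (α : Fin 4) (hp : p ∈ D.dom i) :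
    pd α (g i) p = pd α (f i) p :=
  Frame.der_congr (F := frameZ D) h (VField.translation α) i p hp

theorem pd_comm (hf : (frameZ D).Smooth f) (α β : Fin 4) (hp : p ∈ D.dom i) :
    pd α (pd β (f i)) p = pd β (pd α (f i)) p :=
  Frame.der_comm (F := frameZ D) hf (z := VField.translation α) (z' := VField.translation β)
    (fun _ => rfl) (fun _ => rfl) hp

theorem Frame.Smooth.pd (hf : (frameZ D).Smooth f) (α : Fin 4) :
    (frameZ D).Smooth fun i => QuasilinearWave.pd α (f i) := hf.der (VField.translation α)

theorem pd_om (hx : p.2 ≠ 0) (j : Fin 3) (α : Fin 4) :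
    pd α (om j) p = ‖p.2‖⁻¹ * ((coordDir α).2 j - om j p * ∑ l : Fin 3, om l p * (coordDir α).2 l) := by
  have hr : ‖p.2‖ ≠ 0 := norm_ne_zero_iff.2 hx
  have hd : DifferentiableAt ℝ (fun p : Spacetime => ‖p.2‖) p :=
    (contDiffAt_snd.norm ℝ hx (n := 1)).differentiableAt (by simp)
  have h1 : HasFDerivAt (fun p : Spacetime => ‖p.2‖⁻¹) _ p :=
    (hasDerivAt_inv hr).comp_hasFDerivAt p hd.hasFDerivAt
  have h := h1.mul (coordS j.succ).hasFDerivAt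
  have h2 : pd α (om j) p = _ := congrArg (fun L => L (coordDir α)) h.fderiv
  rw [h2]
  simp only [add_apply, smul_apply, smul_eq_mul, fderiv_r hx, coordS_succ, om]
  rw [Fin.sum_univ_three, Fin.sum_univ_three]
  field_simp
  ring

theorem opR_om (hx : p.2 ≠ 0) (j : Fin 3) : opR (om j) p = 0 := by
  have h := om_sq hx
  simp only [opR, pd_om hx, coordDir_succ, Fin.sum_univ_three] at h ⊢
  fin_cases j <;> simp
  · linear_combination (-‖p.2‖⁻¹ * om 0 p) * h
  · linear_combination (-‖p.2‖⁻¹ * om 1 p) * h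
  · linear_combination (-‖p.2‖⁻¹ * om 2 p) * h

theorem pd_zero_om (hx : p.2 ≠ 0) (j : Fin 3) : pd 0 (om j) p = 0 := by
  simp [pd_om hx, coordDir_zero]

theorem opB_om (hx : p.2 ≠ 0) (j : Fin 3) : opB (om j) p = 0 := by
  rw [opB, pd_zero_om hx, opR_om hx, sub_zero]

theorem sum_pd_om (hx : p.2 ≠ 0) : ∑ j : Fin 3, pd j.succ (om j) p = 2 * ‖p.2‖⁻¹ := by
  have h := om_sq hx
  simp only [pd_om hx, coordDir_succ, Fin.sum_univ_three] at h ⊢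
  simp
  linear_combination (-‖p.2‖⁻¹) * h

theorem opR_mul (hf : (frameZ D).Smooth f) (hg : (frameZ D).Smooth g) (hp : p ∈ D.dom i) :
    opR (fun p => f i p * g i p) p = f i p * opR (g i) p + opR (f i) p * g i p := by
  simp only [opR, pd_mul hf hg _ hp, Fin.sum_univ_three]
  ring

theorem opL_mul (hf : (frameZ D).Smooth f) (hg : (frameZ D).Smooth g) (hp : p ∈ D.dom i) :
    opL (fun p => f i p * g i p) p = f i p * opL (g i) p + opL (f i) p * g i p := by
  simp only [opL, pd_mul hf hg _ hp, opR_mul hf hg hp]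
  ring

theorem opB_mul (hf : (frameZ D).Smooth f) (hg : (frameZ D).Smooth g) (hp : p ∈ D.dom i) :
    opB (fun p => f i p * g i p) p = f i p * opB (g i) p + opB (f i) p * g i p := by
  simp only [opB, pd_mul hf hg _ hp, opR_mul hf hg hp]
  ring

theorem opB_add (hf : (frameZ D).Smooth f) (hg : (frameZ D).Smooth g) (hp : p ∈ D.dom i) :
    opB (fun p => f i p + g i p) p = opB (f i) p + opB (g i) p := by
  simp only [opB, opR, pd_add hf hg _ hp, Fin.sum_univ_three]
  ring

theorem opL_add (hf : (frameZ D).Smooth f) (hg : (frameZ D).Smooth g) (hp : p ∈ D.dom i) :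
    opL (fun p => f i p + g i p) p = opL (f i) p + opL (g i) p := by
  simp only [opL, opR, pd_add hf hg _ hp, Fin.sum_univ_three]
  ring

theorem opL_congr (h : ∀ i, ∀ p ∈ D.dom i, g i p = f i p) (hp : p ∈ D.dom i) :
    opL (g i) p = opL (f i) p := by
  simp only [opL, opR, pd_congr h _ hp]

theorem opB_congr (h : ∀ i, ∀ p ∈ D.dom i, g i p = f i p) (hp : p ∈ D.dom i) :
    opB (g i) p = opB (f i) p := by
  simp only [opB, opR, pd_congr h _ hp]

theorem smooth_om (j : Fin 3) : (frameZ D).Smooth fun _ => om j := (symbol_om D j).smooth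

theorem Frame.Smooth.opR (hf : (frameZ D).Smooth f) :
    (frameZ D).Smooth fun i => QuasilinearWave.opR (f i) :=
  Frame.Smooth.sum (s := Finset.univ) fun j => (smooth_om j).mul (hf.pd j.succ)

theorem Cone.x_ne (D : Cone e₀) (hp : p ∈ D.dom i) : p.2 ≠ 0 := norm_pos_iff.1 (D.r_pos hp)

/-- The wave operator, decomposed with respect to the null frame. -/
theorem box_eq (hf : (frameZ D).Smooth f) (hp : p ∈ D.dom i) :
    ∑ α, ∑ β, boxCoeff α β * pd α (pd β (f i)) p =
      opL (opB (f i)) p + ‖p.2‖⁻¹ * opB (f i) p - ‖p.2‖⁻¹ * opL (f i) p -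
        ∑ j : Fin 3, opP j (opP j (f i)) p := by
  have hx := D.x_ne hp
  have hR := hf.opR
  have e1 : ∑ α, ∑ β, boxCoeff α β * pd α (pd β (f i)) p =
      pd 0 (pd 0 (f i)) p - ∑ j : Fin 3, pd j.succ (pd j.succ (f i)) p := by
    simp [Fin.sum_univ_succ, boxCoeff]
    ring
  have e2 : pd 0 (opR (f i)) p = ∑ j : Fin 3, om j p * pd 0 (pd j.succ (f i)) p :=
    (pd_sum (s := Finset.univ) (fun j => (smooth_om j).mul (hf.pd j.succ)) 0 hp).trans
      (Finset.sum_congr rfl fun j _ => by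
        rw [pd_mul (smooth_om j) (hf.pd j.succ) 0 hp, pd_zero_om hx, zero_mul, add_zero])
  have e3 : ∀ α, pd α (opB (f i)) p = pd α (pd 0 (f i)) p - pd α (opR (f i)) p := fun α =>
    pd_sub (hf.pd 0) hR α hp
  have e4 : ∀ j : Fin 3, ∀ α, pd α (opP j (f i)) p = pd α (pd j.succ (f i)) p -
      (om j p * pd α (opR (f i)) p + pd α (om j) p * opR (f i) p) := fun j α =>
    (pd_sub (hf.pd j.succ) ((smooth_om j).mul hR) α hp).trans
      (by rw [pd_mul (smooth_om j) hR α hp])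
  have hc : ∀ j : Fin 3, pd j.succ (pd 0 (f i)) p = pd 0 (pd j.succ (f i)) p := fun j =>
    pd_comm hf _ _ hp
  have hω := om_sq hx
  have hs := sum_pd_om hx
  -- The angular gradient is orthogonal to `ω`, and `ω` is constant along `∂_r`. So the second
  -- projection contributes nothing to the sum of the `P_j P_j`, which equals the sum of the `∂_j
  -- P_j`.
  have h5 : ∑ j : Fin 3, om j p * opR (opP j (f i)) p = 0 := by
    have h6 : opR (opR (f i)) p = ∑ l : Fin 3, ∑ j : Fin 3, om l p * (om j p * pd l.succ (pd j.succ (f i)) p +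
        pd l.succ (om j) p * pd j.succ (f i) p) :=
      Finset.sum_congr rfl fun l _ => by
        rw [← Finset.mul_sum]
        congr 1
        exact (pd_sum (s := Finset.univ) (fun j => (smooth_om j).mul (hf.pd j.succ)) _ hp).trans
          (Finset.sum_congr rfl fun j _ => pd_mul (smooth_om j) (hf.pd j.succ) _ hp)
    have h7 := fun j => opR_om hx j
    have h8 := h7 0
    have h9 := h7 1
    have h10 := h7 2
    have h11 : opR (opR (f i)) p = ∑ l : Fin 3, om l p * pd l.succ (opR (f i)) p := rfl
    rw [h6] at h11
    simp only [opR] at h8 h9 h10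
    have e5 : ∀ j : Fin 3, opR (opP j (f i)) p = ∑ l : Fin 3, om l p * pd l.succ (opP j (f i)) p :=
      fun j => rfl
    simp only [e5, e4, Fin.sum_univ_three] at h8 h9 h10 h11 hω ⊢
    linear_combination h11 - (om 0 p * pd (Fin.succ 0) (opR (f i)) p + om 1 p * pd (Fin.succ 1) (opR (f i)) p +
      om 2 p * pd (Fin.succ 2) (opR (f i)) p) * hω - (pd (Fin.succ 0) (f i) p + om 0 p * opR (f i) p) * h8 -
      (pd (Fin.succ 1) (f i) p + om 1 p * opR (f i) p) * h9 -
      (pd (Fin.succ 2) (f i) p + om 2 p * opR (f i) p) * h10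
  have e6 : ∑ j : Fin 3, opP j (opP j (f i)) p = ∑ j : Fin 3, pd j.succ (opP j (f i)) p := by
    simp only [opP] at h5 ⊢
    rw [Finset.sum_sub_distrib, h5, sub_zero]
  rw [e1, e6, opL]
  simp only [e4]
  have e7 : opR (opB (f i)) p = ∑ j : Fin 3, om j p * pd j.succ (opB (f i)) p := rfl
  have e8 : opL (f i) p = pd 0 (f i) p + opR (f i) p := rfl
  have e9 : opB (f i) p = pd 0 (f i) p - opR (f i) p := rfl
  rw [e7]
  simp only [e3, hc, e2, e8, e9, Fin.sum_univ_three] at hs ⊢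
  linear_combination (-opR (f i) p) * hs

/-- The discarded terms `r⁻¹ L` and `P_j P_j` gain two powers of `1/t`; the retained ones `L B` and
`r⁻¹ B` gain only one. -/
theorem symbol_box (hf : (frameZ D).Symbol k f) (h : l + 2 = k) :
    (frameZ D).Symbol l fun i p => (∑ α, ∑ β, boxCoeff α β * pd α (pd β (f i)) p) -
      (opL (opB (f i)) p + ‖p.2‖⁻¹ * opB (f i) p) := by
  have h1 := (symbol_r_inv D).mul (hf.opL (l := k - 1) (by ring)) (m := l) (by omega)
  have h2 := Frame.Symbol.sum (s := Finset.univ) fun j : Fin 3 =>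
    (hf.opP (l := k - 1) (by ring) j).opP (l := l) (by omega) j
  refine ((h1.add h2).real_mul (-1)).congr fun i p hp => ?_
  rw [box_eq hf.smooth hp]
  ring

/-- The covector `(-1, x/|x|)`. -/
def omHat (α : Fin 4) (p : Spacetime) : ℝ := hat (‖p.2‖⁻¹ • p.2) α

theorem omHat_zero (p : Spacetime) : omHat 0 p = -1 := rfl

theorem omHat_succ (j : Fin 3) (p : Spacetime) : omHat j.succ p = om j p := rfl

variable (D) in
theorem symbol_omHat (α : Fin 4) : (frameZ D).Symbol 0 fun _ => omHat α :=
  Fin.cases (symbol_const D (-1)) (fun j => symbol_om D j) α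

theorem opB_omHat (hx : p.2 ≠ 0) (α : Fin 4) : opB (omHat α) p = 0 := by
  refine Fin.cases ?_ (fun j => opB_om hx j) α
  have : omHat 0 = fun _ => (-1 : ℝ) := rfl
  rw [this]
  simp [opB, opR, pd]

/-- The tangential part of `∂_α`. -/
def opT (α : Fin 4) (f : Spacetime → ℝ) (p : Spacetime) : ℝ := pd α f p + 1 / 2 * omHat α p * opB f p

theorem opT_zero (f : Spacetime → ℝ) (p : Spacetime) : opT 0 f p = 1 / 2 * opL f p := by
  rw [opT, omHat_zero, opB, opL]
  ring

theorem opT_succ (f : Spacetime → ℝ) (j : Fin 3) (p : Spacetime) :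
    opT j.succ f p = 1 / 2 * (om j p * opL f p) + opP j f p := by
  rw [opT, omHat_succ, opB, opL, opP]
  ring

theorem Frame.Symbol.opT (hf : (frameZ D).Symbol k f) (h : l + 1 = k) (α : Fin 4) :
    (frameZ D).Symbol l fun i => QuasilinearWave.opT α (f i) := by
  refine Fin.cases ?_ (fun j => ?_) α
  · exact ((hf.opL h).real_mul (1 / 2)).congr fun i p _ => opT_zero _ _
  · exact ((((symbol_om D j).mul (hf.opL h) (zero_add l)).real_mul (1 / 2)).add (hf.opP h j)).congr
      fun i p _ => opT_succ _ _ _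

theorem pd_eq (α : Fin 4) (f : Spacetime → ℝ) (p : Spacetime) :
    pd α f p = -(1 / 2) * (omHat α p * opB f p) + opT α f p := by
  rw [opT]
  ring

/-- In `∂_α = -½ ω̂_α B + T_α` only `B` fails to gain a factor `1/t`, and `B` annihilates `ω̂`. -/
theorem symbol_pd_pd (hf : (frameZ D).Symbol k f) (h : l + 1 = k) (α β : Fin 4) :
    (frameZ D).Symbol l fun i p => pd α (pd β (f i)) p -
      1 / 4 * (omHat α p * (omHat β p * opB (opB (f i)) p)) := by
  have h1 := (hf.pd β).opT h α
  have h2 := (symbol_omHat D α).mul (hf.opT h β).opB (zero_add l)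
  refine (h1.add (h2.real_mul (-(1 / 2)))).congr fun i p hp => ?_
  have hx := D.x_ne hp
  have e1 := pd_eq α (pd β (f i)) p
  have hs1 : (frameZ D).Smooth fun i p => omHat β p * opB (f i) p :=
    (symbol_omHat D β).smooth.mul hf.opB.smooth
  have e2 : opB (pd β (f i)) p = -(1 / 2) * (omHat β p * opB (opB (f i)) p) +
      opB (opT β (f i)) p := by
    refine (opB_congr (D := D) (f := fun i p => -(1 / 2) * (omHat β p * opB (f i) p) + opT β (f i) p)
      (fun i p _ => pd_eq β (f i) p) hp).trans ?_
    refine (opB_add (D := D) (f := fun i p => -(1 / 2) * (omHat β p * opB (f i) p))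
      (((symbol_const D (-(1 / 2))).smooth).mul hs1) (hf.opT h β).smooth hp).trans ?_
    congr 1
    refine (opB_mul (D := D) (f := fun i p => -(1 / 2)) (symbol_const D (-(1 / 2))).smooth hs1
      hp).trans ?_
    rw [opB_mul (D := D) (f := fun _ => omHat β) (symbol_omHat D β).smooth hf.opB.smooth hp,
      opB_omHat hx]
    simp [opB, opR, pd]
  rw [e1, e2]
  ring

end

end QuasilinearWave

end

noncomputable section

namespace QuasilinearWave

/-! ### The region near the light cone -/

/-- The coordinates `(y, m, ω)` of a spacetime point. -/
def coordN (R : ℝ) (p : Spacetime) : ℝ × (ℝ × Space) :=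
  ((p.1 - ‖p.2‖ - R) / 2, (Real.log ((p.1 + ‖p.2‖ + R) / 2), ‖p.2‖⁻¹ • p.2))

/-- Parameters for which the points with `|q| < R + 1` have coordinates in the domain of `frameP`. -/
structure Near {R : ℝ} {a : ℝ × Space → ℝ} (ha : IsCoeff R a) extends Params R where
  T₁ : ℝ
  one_le : 1 ≤ T₁
  coeff_le : ∀ w, |a w| ≤ M
  M_mul : M * e₀ ≤ 1 / 2
  maps : ∀ (i : Idx e₀) (p : Spacetime), T₁ < p.1 → p.2 ≠ 0 →
    |ha.optical i.ε i.δ p| < R + 1 → coordN R p ∈ (frameP toParams).dom i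

variable {R : ℝ} {a : ℝ × Space → ℝ}

/-- For `1 ≤ τ ≤ e^m` the slow time is at most `εm + 1` in modulus, so `q` decreases in time at
least at the rate `k`, and `q + kτ` is antitone. This converts an upper bound for `q` into one for
`e^m - t = -y`. -/
theorem flow_lower (ha : IsCoeff R a) {M ε δ : ℝ} (hM : 0 ≤ M) (hab : ∀ w, |a w| ≤ M) (hε : 0 < ε)
    (hδ : 0 < δ) (hδ1 : δ < 1) {t m : ℝ} (x : Space) (ht : 1 ≤ t) (htm : t ≤ Real.exp m) :
    ha.flow ε δ (Real.exp m, (2 * Real.exp m - R, x)) +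
        2 * Real.exp (-(M * (ε * m + 1))) * (Real.exp m - t) ≤
      ha.flow ε δ (t, (2 * Real.exp m - R, x)) ∨ 2 * Real.exp m - R ≤ 0 := by
  rcases le_or_gt (2 * Real.exp m - R) 0 with hv | hv
  · exact Or.inr hv
  left
  set k : ℝ := 2 * Real.exp (-(M * (ε * m + 1)))
  have hd : ∀ τ ∈ Set.Icc t (Real.exp m), HasDerivAt
      (fun τ => ha.flow ε δ (τ, (2 * Real.exp m - R, x)) + k * τ)
      (speed a (ε * Real.log τ - δ) (ha.flow ε δ (τ, (2 * Real.exp m - R, x))) x + k) τ := by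
    intro τ hτ
    have h := (ha.flow_deriv ε δ (by linarith [hτ.1] : 0 < τ) hv x).add
      ((hasDerivAt_id' τ).const_mul k)
    exact h.congr_deriv (by rw [mul_one])
  have hanti : AntitoneOn (fun τ => ha.flow ε δ (τ, (2 * Real.exp m - R, x)) + k * τ)
      (Set.Icc t (Real.exp m)) := by
    refine antitoneOn_of_deriv_nonpos (convex_Icc _ _)
      (fun τ hτ => (hd τ hτ).continuousAt.continuousWithinAt)
      (fun τ hτ => (hd τ (interior_subset hτ)).differentiableAt.differentiableWithinAt)
      fun τ hτ => ?_
    have hτ' := interior_subset hτ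
    rw [(hd τ hτ').deriv]
    have hτ1 : 1 ≤ τ := ht.trans hτ'.1
    have hl0 : 0 ≤ Real.log τ := Real.log_nonneg hτ1
    have hl : Real.log τ ≤ m := by
      rw [← Real.log_exp m]
      exact Real.log_le_log (by linarith) hτ'.2
    have hs : |ε * Real.log τ - δ| ≤ ε * m + 1 := by
      rw [abs_le]
      have h1 := mul_le_mul_of_nonneg_left hl hε.le
      have h2 := mul_nonneg hε.le hl0
      constructor <;> linarith
    have h3 := hab (ha.flow ε δ (τ, (2 * Real.exp m - R, x)), x)
    have h4 : -(M * (ε * m + 1)) ≤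
        a (ha.flow ε δ (τ, (2 * Real.exp m - R, x)), x) * (ε * Real.log τ - δ) := by
      refine neg_le_of_abs_le ?_
      rw [abs_mul]
      exact mul_le_mul h3 hs (abs_nonneg _) hM
    have h5 := Real.exp_le_exp.2 h4
    simp only [speed, k]
    linarith
  have := hanti (Set.left_mem_Icc.2 htm) (Set.right_mem_Icc.2 htm) htm
  simp only at this
  linarith

theorem coordN_time {p : Spacetime} (hv : 0 < p.1 + ‖p.2‖ + R) :
    Real.exp (coordN R p).2.1 + (coordN R p).1 = p.1 := by
  simp only [coordN]
  rw [Real.exp_log (half_pos hv)]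
  ring

theorem coordN_cone {p : Spacetime} (hv : 0 < p.1 + ‖p.2‖ + R) :
    2 * Real.exp (coordN R p).2.1 - R = p.1 + ‖p.2‖ := by
  simp only [coordN]
  rw [Real.exp_log (half_pos hv)]
  ring

/-- The point is that `|q| < R + 1` bounds `|y|` by a constant times `e^{Mεm}`, which for small `ε`
is far below `e^m`. -/
theorem exists_near (ha : IsCoeff R a) (hR : 1 ≤ R) : Nonempty (Near ha) := by
  obtain ⟨M, hM⟩ := ha.compact.exists_bound_of_continuous ha.smooth.continuous
  have hM0 : 0 ≤ M := (norm_nonneg _).trans (hM 0)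
  set K₁ : ℝ := (R + 1) * Real.exp M with hK₁
  have hK : R + 1 ≤ K₁ := le_mul_of_one_le_right (by linarith) (Real.one_le_exp hM0)
  have hK0 : 0 < 32 * K₁ := by linarith
  -- With `M ε ≤ ½` it suffices that `32 K₁ e^{m/2} ≤ e^m`, i.e. `e^{m/2} ≥ 32 K₁`.
  set m₀ : ℝ := 2 * Real.log (32 * K₁) with hm₀
  have hm₀' : Real.exp m₀ = (32 * K₁) ^ 2 := by
    rw [hm₀, two_mul, Real.exp_add, Real.exp_log hK0, sq]
  have hR0 : R ≤ Real.exp m₀ / 32 := by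
    rw [hm₀']
    nlinarith
  have he : 0 < 1 / (2 * M + 2) := by positivity
  have he1 : 1 / (2 * M + 2) ≤ 1 := by
    rw [div_le_one (by positivity)]
    linarith
  have hMe : M * (1 / (2 * M + 2)) ≤ 1 / 2 := by
    rw [mul_one_div, div_le_iff₀ (by positivity)]
    linarith
  have hsmall : ∀ ε m, 0 < ε → ε < 1 / (2 * M + 2) → m₀ < m →
      K₁ * Real.exp (M * ε * m) ≤ Real.exp m / 32 := fun ε m hε hε1 hm => by
    have hm0 : 0 ≤ m₀ := mul_nonneg zero_le_two (Real.log_nonneg (by linarith))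
    have h1 : M * ε * m ≤ m / 2 := by
      have := mul_le_mul_of_nonneg_left hε1.le hM0
      nlinarith
    have h2 : 32 * K₁ ≤ Real.exp (m / 2) := by
      rw [← Real.exp_log hK0]
      exact Real.exp_le_exp.2 (by linarith)
    have h3 : Real.exp m = Real.exp (m / 2) * Real.exp (m / 2) := by
      rw [← Real.exp_add, add_halves]
    have h4 := Real.exp_le_exp.2 h1
    rw [h3]
    nlinarith [Real.exp_pos (m / 2)]
  let P : Params R := ⟨M, K₁, m₀, 1 / (2 * M + 2), by linarith, hM0, by linarith, he, he1,
    mul_nonneg zero_le_two (Real.log_nonneg (by linarith)), hR0, hsmall⟩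
  have hex : 1 ≤ Real.exp m₀ := Real.one_le_exp P.m₀_nonneg
  suffices hmaps : ∀ (i : Idx P.e₀) (p : Spacetime), 2 * Real.exp m₀ < p.1 → p.2 ≠ 0 →
      |ha.optical i.ε i.δ p| < R + 1 → coordN R p ∈ (frameP P).dom i from
    ⟨⟨P, 2 * Real.exp m₀, by linarith, hM, hMe, hmaps⟩⟩
  intro i p ht hx hq
  have hr : 0 < ‖p.2‖ := norm_pos_iff.2 hx
  have hv : 0 < p.1 + ‖p.2‖ + R := by linarith
  have e1 := coordN_time hv
  have e2 := coordN_cone hv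
  have hτ : Real.exp (coordN R p).2.1 = (p.1 + ‖p.2‖ + R) / 2 := Real.exp_log (half_pos hv)
  have hm : m₀ < (coordN R p).2.1 := by
    rw [← Real.exp_lt_exp, hτ]
    linarith
  have hq' : ha.optical i.ε i.δ p = ha.flow i.ε i.δ (p.1, (p.1 + ‖p.2‖, ‖p.2‖⁻¹ • p.2)) := rfl
  have hmε : 0 ≤ M * i.ε * (coordN R p).2.1 :=
    mul_nonneg (mul_nonneg hM0 i.ε_pos.le) (P.m₀_nonneg.trans hm.le)
  have hRm : R ≤ Real.exp (coordN R p).2.1 / 32 :=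
    hR0.trans (div_le_div_of_nonneg_right (Real.exp_le_exp.2 hm.le) (by norm_num))
  refine ⟨hm, ?_, ?_⟩
  · change |(coordN R p).1| < K₁ * Real.exp (M * i.ε * (coordN R p).2.1)
    have hlin := ha.flow_eq_linear i.ε i.δ (‖p.2‖⁻¹ • p.2) (v := p.1 + ‖p.2‖)
      (t := max p.1 ((p.1 + ‖p.2‖ + R) / 2)) (by linarith) hv (le_max_right _ _)
      (max_le (by linarith) (by linarith))
    -- For `y ≥ 0` the characteristic is still linear, `q = r - t`, and `q > -(R + 1)` gives `y <
    -- ½`. For `y ≤ 0` the minimal speed and `q < R + 1` give `|y| < (R + ½) e^{M(εm + 1)}`, which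
    -- explains `K₁ = (R + 1) e^M`.
    rcases le_total ((p.1 + ‖p.2‖ + R) / 2) p.1 with hc | hc
    · rw [max_eq_left hc, ← hq'] at hlin
      rw [hlin] at hq
      have h1 := (abs_lt.1 hq).1
      have h2 : (coordN R p).1 = (p.1 - ‖p.2‖ - R) / 2 := rfl
      rw [abs_of_nonneg (by rw [h2]; linarith), h2]
      nlinarith [Real.one_le_exp hmε]
    · rw [max_eq_right hc] at hlin
      have h1 := flow_lower ha hM0 hM i.ε_pos i.δ_pos i.δ_lt (t := p.1) (m := (coordN R p).2.1)
        (‖p.2‖⁻¹ • p.2) (by linarith) (by rw [hτ]; exact hc)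
      rw [e2, or_iff_left (by linarith), hτ, hlin, ← hq'] at h1
      have h2 := (abs_lt.1 hq).2
      have h3 : (coordN R p).1 = (p.1 - ‖p.2‖ - R) / 2 := rfl
      rw [abs_of_nonpos (by rw [h3]; linarith), h3]
      have h4 : Real.exp (M * (i.ε * (coordN R p).2.1 + 1)) =
          Real.exp M * Real.exp (M * i.ε * (coordN R p).2.1) := by
        rw [← Real.exp_add]
        ring_nf
      have h5 : Real.exp (-(M * (i.ε * (coordN R p).2.1 + 1))) *
          Real.exp (M * (i.ε * (coordN R p).2.1 + 1)) = 1 := by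
        rw [← Real.exp_add, neg_add_cancel, Real.exp_zero]
      rw [hK₁, mul_assoc, ← h4]
      set X := Real.exp (M * (i.ε * (coordN R p).2.1 + 1))
      set X' := Real.exp (-(M * (i.ε * (coordN R p).2.1 + 1)))
      have hX : 0 < X := Real.exp_pos _
      have h6 : X' * (‖p.2‖ + R - p.1) < 2 * R + 1 := by linarith
      have h7 := mul_lt_mul_of_pos_right h6 hX
      have h8 : X' * (‖p.2‖ + R - p.1) * X = ‖p.2‖ + R - p.1 := by
        linear_combination (‖p.2‖ + R - p.1) * h5
      nlinarith
  · change ‖‖p.2‖⁻¹ • p.2‖ < 2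
    rw [norm_smul, norm_inv, norm_norm, inv_mul_cancel₀ hr.ne']
    norm_num

namespace Near

variable {ha : IsCoeff R a} (N : Near ha)

/-- The conditions defining the region. -/
def region (i : Idx N.e₀) : Set Spacetime :=
  {p | (N.T₁ < p.1 ∧ p.2 ≠ 0) ∧ |ha.optical i.ε i.δ p| < R + 1}

variable {N} {i : Idx N.e₀} {p : Spacetime}

theorem mapsTo (hp : p ∈ N.region i) : coordN R p ∈ (frameP N.toParams).dom i :=
  N.maps i p hp.1.1 hp.1.2 hp.2

theorem t_ge (hp : p ∈ N.region i) : 1 ≤ p.1 := N.one_le.trans hp.1.1.le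

theorem v_pos (hp : p ∈ N.region i) : 0 < p.1 + ‖p.2‖ + R := by
  have := t_ge hp
  have := N.R_pos
  have := norm_nonneg p.2
  linarith

theorem exp_m (hp : p ∈ N.region i) : Real.exp (coordN R p).2.1 = (p.1 + ‖p.2‖ + R) / 2 :=
  Real.exp_log (half_pos (v_pos hp))

/-- The margins `1/32` in `Params` place the region inside `3/4 ≤ r/t ≤ 5/4`, where the cone cutoff
is identically one. -/
theorem geometry (hp : p ∈ N.region i) : 3 / 4 * p.1 ≤ ‖p.2‖ ∧ ‖p.2‖ ≤ 5 / 4 * p.1 ∧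
    Real.exp (coordN R p).2.1 ≤ 2 * p.1 := by
  have h1 := frameP_y (mapsTo hp)
  have h2 := frameP_R (mapsTo hp)
  have h3 := exp_m hp
  have h4 : (coordN R p).1 = (p.1 - ‖p.2‖ - R) / 2 := rfl
  have h5 := t_ge hp
  rw [h3] at h1 h2 ⊢
  rw [h4] at h1
  have h6 := abs_le.1 h1
  have h7 := N.R_pos
  refine ⟨?_, ?_, ?_⟩ <;> linarith [h6.1, h6.2]

theorem region_isOpen (i : Idx N.e₀) : IsOpen (N.region i) := by
  have h1 : IsOpen {p : Spacetime | N.T₁ < p.1 ∧ p.2 ≠ 0} :=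
    (isOpen_lt continuous_const continuous_fst).inter
      (isOpen_ne_fun continuous_snd continuous_const)
  have h2 := ((ha.optical_smooth i.ε i.δ).continuousOn.mono
    (t := {p : Spacetime | N.T₁ < p.1 ∧ p.2 ≠ 0})
    fun p hp => ⟨one_pos.trans_le (N.one_le.trans hp.1.le), hp.2⟩).isOpen_inter_preimage h1
    (Metric.isOpen_ball (x := 0) (ε := R + 1))
  simpa [Set.inter_def, region, Metric.ball, Real.dist_eq] using h2

variable (N)

/-- The region near the light cone. -/
def cone : Cone N.e₀ where
  θ := 1
  θ_nonneg := zero_le_one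
  dom := N.region
  isOpen := region_isOpen
  time _ _ hp := t_ge hp
  lower _ p hp := by linarith [(geometry hp).1, t_ge hp]
  upper _ p hp := by linarith [(geometry hp).2.1, t_ge hp]

theorem W_le (hp : p ∈ N.region i) (C : ℕ) :
    (frameP N.toParams).W i (coordN R p) ^ C ≤ 2 ^ C * (frameZ N.cone).W i p ^ C := by
  rw [← mul_pow]
  refine pow_le_pow_left₀ (Real.exp_pos _).le ?_ C
  change Real.exp (i.ε * (coordN R p).2.1) ≤ 2 * p.1 ^ (1 * i.ε)
  have ht : 0 < p.1 := one_pos.trans_le (t_ge hp)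
  rw [mul_comm, Real.exp_mul, one_mul]
  refine (Real.rpow_le_rpow (Real.exp_pos _).le (geometry hp).2.2 i.ε_pos.le).trans ?_
  rw [Real.mul_rpow zero_le_two ht.le]
  refine mul_le_mul_of_nonneg_right ?_ (Real.rpow_nonneg ht.le _)
  have h1 : i.ε ≤ 1 := i.ε_lt.le.trans N.e₀_le
  simpa using Real.rpow_le_rpow_of_exponent_le one_le_two h1

theorem bd_comp {f : Idx N.e₀ → ℝ × (ℝ × Space) → ℝ} (hf : (frameP N.toParams).Bd 0 f) :
    (frameZ N.cone).Bd 0 fun i p => f i (coordN R p) := by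
  obtain ⟨K, hK, C, H⟩ := hf
  refine ⟨K * 2 ^ C, by positivity, C, fun i p hp => (H i _ (mapsTo hp)).trans ?_⟩
  rw [zpow_zero, zpow_zero, mul_one, mul_one, mul_assoc]
  exact mul_le_mul_of_nonneg_left (W_le N hp C) hK

theorem smooth_r : (frameZ N.cone).Smooth fun _ p => ‖p.2‖ := (frameD_r_smooth N.cone)

theorem der_r (z : VField) (hp : p ∈ N.region i) :
    (frameZ N.cone).der z (fun _ p => ‖p.2‖) i p = ∑ k : Fin 3, om k p * (z.vec p).2 k := by
  change fderiv ℝ (fun p : Spacetime => ‖p.2‖) p (z.vec p) = _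
  rw [fderiv_r hp.1.2, Finset.mul_sum]
  simp only [om, mul_assoc]

theorem der_t (z : VField) :
    (frameZ N.cone).der z (fun _ p => p.1) i p = (z.vec p).1 := by
  change fderiv ℝ Prod.fst p (z.vec p) = _
  rw [fderiv_fst]
  rfl

/-- The size comes from `t - r = 2y + R`. The commuting fields reproduce it: `S(t - r) = t - r`,
rotations annihilate it, and `Ω_{0j}(t - r) = -ω_j (t - r)`. -/
theorem symbol_t_sub_r : (frameZ N.cone).Symbol 0 fun _ p => p.1 - ‖p.2‖ := by
  have hs : (frameZ N.cone).Smooth fun _ p => p.1 - ‖p.2‖ := fun i =>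
    contDiffOn_fst.sub (smooth_r N i)
  have hb : (frameZ N.cone).Bd 0 fun _ p => p.1 - ‖p.2‖ := by
    refine ((Frame.Bd.mul (k := 0) (l := 0) (Frame.Bd.const (c := fun _ => (2 : ℝ)) (M := 2) (by simp))
      (bd_comp N (frameP_y_sym N.toParams 0).bd)).add
        (Frame.Bd.const (c := fun _ => R) (M := |R|) fun _ => le_rfl)).congr fun i p hp => ?_
    simp only [coordN]
    ring
  intro n
  induction n with
  | zero => exact ⟨hs, hb⟩
  | succ n ih =>
    refine ⟨hs, hb, fun z => ?_⟩
    have e : ∀ i, ∀ p ∈ N.region i, (frameZ N.cone).der z (fun _ p => p.1 - ‖p.2‖) i p =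
        (VField.vec z p).1 - ∑ k : Fin 3, om k p * (VField.vec z p).2 k := fun i p hp => by
      rw [← der_r N z hp, ← der_t N z]
      exact Frame.der_sub (f := fun _ (p : Spacetime) => p.1) (fun i => contDiffOn_fst)
        (smooth_r N) z hp
    have hω := fun i p (hp : p ∈ N.region i) => om_sq (p := p) hp.1.2
    have hx := fun i p (hp : p ∈ N.region i) => r_mul_om (p := p) hp.1.2
    cases z with
    | translation α =>
      refine Frame.Sym.congr ?_ e
      refine (frameZ_const N.cone n (coordDir α).1).sub (Frame.Sym.sum (s := Finset.univ) fun k _ =>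
        (frameZ_om N.cone n k).mul' (frameZ_const N.cone n ((coordDir α).2 k)) (add_zero 0))
    | scaling =>
      refine ih.congr fun i p hp => (e i p hp).trans ?_
      have h1 := hω i p hp
      have h2 : VField.vec VField.scaling p = p := (coordS_sum p).symm ▸ by
        conv_rhs => rw [coordS_sum p, Fin.sum_univ_succ]
        rfl
      rw [h2]
      simp only [← hx i p hp, Fin.sum_univ_three] at h1 ⊢
      linear_combination (-‖p.2‖) * h1
    | rotation j l =>
      refine (Frame.Sym.zero n 0).congr fun i p hp => (e i p hp).trans ?_
      have h3 : ∑ k : Fin 3, om k p * (VField.vec (VField.rotation j l) p).2 k =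
          om j p * p.2 l - om l p * p.2 j := by
        simp only [VField.vec, coordDir_succ]
        fin_cases j <;> fin_cases l <;> simp [Fin.sum_univ_three] <;> ring
      rw [h3, ← hx i p hp, ← hx i p hp]
      simp [VField.vec, coordDir_succ]
      ring
    | boost j =>
      refine (((frameZ_om N.cone n j).mul' ih (add_zero 0)).real_mul (-1)).congr
        fun i p hp => (e i p hp).trans ?_
      have h3 : ∑ k : Fin 3, om k p * (VField.vec (VField.boost j) p).2 k = om j p * p.1 := by
        simp only [VField.vec, coordDir_succ, coordDir_zero]
        fin_cases j <;> simp
      rw [h3]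
      have h4 : (VField.vec (VField.boost j) p).1 = p.2 j := by
        simp [VField.vec, coordDir_succ, coordDir_zero]
      rw [h4, ← hx i p hp]
      ring

end Near

end QuasilinearWave

end

noncomputable section

namespace QuasilinearWave

/-! ### Transfer of symbols from characteristic coordinates to spacetime. -/

namespace Near

variable {R : ℝ} {a : ℝ × Space → ℝ} {ha : IsCoeff R a} (N : Near ha)

theorem coordN_smooth (i : Idx N.e₀) : ContDiffOn ℝ ∞ (coordN R) (N.region i) := by
  have hr := smooth_r N i
  have hx : ContDiffOn ℝ ∞ (fun p : Spacetime => ‖p.2‖⁻¹ • p.2) (N.region i) :=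
    contDiffOn_direction.mono fun p hp => hp.1.2
  refine ((contDiffOn_fst.sub hr).sub contDiffOn_const).div_const 2 |>.prodMk
    (ContDiffOn.prodMk (ContDiffOn.log ?_ fun p hp => (half_pos (v_pos hp)).ne') hx)
  exact ((contDiffOn_fst.add hr).add contDiffOn_const).div_const 2

theorem symbol_scale_inv :
    (frameZ N.cone).Symbol (-1) fun _ p => ((p.1 + ‖p.2‖ + R) / 2)⁻¹ := fun n => by
  refine frameZ_of_frameD _ (Frame.Sym.inv (f := fun _ (p : Spacetime) => (p.1 + ‖p.2‖ + R) / 2) ?_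
    (fun i p hp => (half_pos (v_pos hp)).ne') ⟨2, zero_le_two, 0, fun i p hp => ?_⟩)
  · exact ((((frameD_t N.cone n).add (frameD_r N.cone n).1).add
      (frameD_weaken (by norm_num) (frameD_const N.cone n R))).real_mul (1 / 2)).congr
      fun i p _ => by ring
  · rw [pow_zero, mul_one, zpow_neg_one, abs_of_pos (inv_pos.2 (half_pos (v_pos hp)))]
    change _ ≤ 2 * p.1⁻¹
    have h1 := t_ge hp
    rw [← div_eq_mul_inv, inv_le_comm₀ (half_pos (v_pos hp)) (by positivity), inv_div]
    have := N.R_pos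
    have := norm_nonneg p.2
    linarith

theorem symbol_coord (j : CoordLabel) (z : VField) : (frameZ N.cone).Symbol 0
    ((frameZ N.cone).der z fun _ p => ccoord j (coordN R p)) := by
  match j with
  | none =>
    refine Frame.Symbol.der (F := frameZ N.cone) ?_ z
    exact (((symbol_t_sub_r N).sub (symbol_const N.cone R)).real_mul (1 / 2)).congr fun i p _ => by
      simp only [ccoord, coordN, ContinuousLinearMap.coe_fst']
      ring
  | some none =>
    have h1 : (frameZ N.cone).Symbol 1 fun _ p => (p.1 + ‖p.2‖ + R) / 2 := fun n =>
      ((frameZ_of_frameD _ (((frameD_t N.cone n).add (frameD_r N.cone n).1).add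
        (frameD_weaken (by norm_num) (frameD_const N.cone n R)))).real_mul (1 / 2)).congr
        fun i p _ => by ring
    refine ((symbol_scale_inv N).mul (h1.der z) (by norm_num)).congr fun i p hp => ?_
    have h2 := ((h1.smooth.differentiableAt (i := i) hp).hasFDerivAt.log
      (half_pos (v_pos hp)).ne').fderiv
    exact congrArg (fun L => L (VField.vec z p)) h2
  | some (some k) => exact Frame.Symbol.der (F := frameZ N.cone) (symbol_om N.cone k) z

theorem symbol_comp {f : Idx N.e₀ → ℝ × (ℝ × Space) → ℝ}
    (hf : ∀ n, (frameP N.toParams).Sym n 0 f) :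
    (frameZ N.cone).Symbol 0 fun i p => f i (coordN R p) := fun n => by
  refine Frame.Sym.comp (F' := frameP N.toParams) (e := cdir) (c := ccoord) (fun _ _ => rfl)
    ccoord_sum (σ := id) (φ := fun _ => coordN R) (coordN_smooth N) (fun i p hp => mapsTo hp)
    (fun m _ j z => symbol_coord N j z m) (fun C => ?_) (hf n)
  refine ⟨2 ^ C, by positivity, C, fun i p hp => ?_⟩
  rw [zpow_zero, zpow_zero, one_mul, mul_one]
  exact W_le N hp C

variable {N} {i : Idx N.e₀} {p : Spacetime}

theorem radial_r (hx : p.2 ≠ 0) (σ : ℝ) :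
    fderiv ℝ (fun p : Spacetime => ‖p.2‖) p (1, σ • ‖p.2‖⁻¹ • p.2) = σ := by
  rw [fderiv_r hx]
  have h := om_sq hx
  simp only [om, Fin.sum_univ_three] at h
  simp only [PiLp.smul_apply, smul_eq_mul, Fin.sum_univ_three]
  linear_combination σ * h

theorem hasFDerivAt_r_inv (hx : p.2 ≠ 0) : HasFDerivAt (fun p : Spacetime => ‖p.2‖⁻¹)
    (-(‖p.2‖ ^ 2)⁻¹ • fderiv ℝ (fun p : Spacetime => ‖p.2‖) p) p :=
  (hasDerivAt_inv (norm_ne_zero_iff.2 hx)).comp_hasFDerivAt p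
    ((contDiffAt_snd.norm ℝ hx (n := 1)).differentiableAt (by simp)).hasFDerivAt

/-- The choices `σ = -1` and `σ = 1` show that `B` becomes `∂_y` and `L` becomes `e^{-m} ∂_m`; the
direction `ω` is constant along both. -/
theorem radial_deriv (hp : p ∈ N.region i) (σ : ℝ) :
    fderiv ℝ (coordN R) p (1, σ • ‖p.2‖⁻¹ • p.2) =
      ((1 - σ) / 2, (((p.1 + ‖p.2‖ + R) / 2)⁻¹ * ((1 + σ) / 2), 0)) := by
  have hx : p.2 ≠ 0 := hp.1.2
  have hr : ‖p.2‖ ≠ 0 := norm_ne_zero_iff.2 hx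
  have hd : DifferentiableAt ℝ (fun p : Spacetime => ‖p.2‖) p :=
    (contDiffAt_snd.norm ℝ hx (n := 1)).differentiableAt (by simp)
  have hr' := radial_r hx σ
  have h1 : HasFDerivAt (fun p : Spacetime => p.1) (ContinuousLinearMap.fst ℝ ℝ Space) p :=
    hasFDerivAt_fst
  have h2 : HasFDerivAt (fun p : Spacetime => p.2) (ContinuousLinearMap.snd ℝ ℝ Space) p :=
    hasFDerivAt_snd
  have hi := hasFDerivAt_r_inv hx
  have hy := ((h1.sub hd.hasFDerivAt).sub_const R).mul_const (2⁻¹ : ℝ)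
  have hm := (((h1.add hd.hasFDerivAt).add_const R).mul_const (2⁻¹ : ℝ)).log
    (by have := half_pos (v_pos hp); rw [div_eq_mul_inv] at this; exact this.ne')
  have h := hy.prodMk (hm.prodMk (hi.smul h2))
  have e : (fun p : Spacetime => ((p.1 - ‖p.2‖ - R) * 2⁻¹,
      (Real.log ((p.1 + ‖p.2‖ + R) * 2⁻¹), ‖p.2‖⁻¹ • p.2))) = coordN R := by
    funext p
    simp only [coordN, div_eq_mul_inv]
  have h3 := congrArg (fun L => L (1, σ • ‖p.2‖⁻¹ • p.2)) h.fderiv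
  rw [← e]
  refine h3.trans ?_
  refine Prod.ext ?_ (Prod.ext ?_ ?_)
  · simp [hr']
    ring
  · simp [hr']
    ring
  · change ‖p.2‖⁻¹ • (σ • ‖p.2‖⁻¹ • p.2) + (-(‖p.2‖ ^ 2)⁻¹ *
      fderiv ℝ (fun p : Spacetime => ‖p.2‖) p (1, σ • ‖p.2‖⁻¹ • p.2)) • p.2 = 0
    rw [hr', smul_smul, smul_smul, ← add_smul]
    convert zero_smul ℝ p.2 using 2
    field_simp
    ring

theorem opB_eq (f : Spacetime → ℝ) (p : Spacetime) :
    opB f p = fderiv ℝ f p (1, (-1 : ℝ) • ‖p.2‖⁻¹ • p.2) := by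
  rw [coordS_sum (1, (-1 : ℝ) • ‖p.2‖⁻¹ • p.2), Fin.sum_univ_succ, map_add, map_sum]
  simp [coordS_zero, coordS_succ, opB, opR, pd, om, Fin.sum_univ_three]
  ring

theorem opL_eq (f : Spacetime → ℝ) (p : Spacetime) :
    opL f p = fderiv ℝ f p (1, (1 : ℝ) • ‖p.2‖⁻¹ • p.2) := by
  rw [coordS_sum (1, (1 : ℝ) • ‖p.2‖⁻¹ • p.2), Fin.sum_univ_succ, map_add, map_sum]
  simp [coordS_zero, coordS_succ, opL, opR, pd, om, Fin.sum_univ_three]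

theorem opB_r_inv (hx : p.2 ≠ 0) : opB (fun p => ‖p.2‖⁻¹) p = ‖p.2‖⁻¹ * ‖p.2‖⁻¹ := by
  rw [opB_eq, (hasFDerivAt_r_inv hx).fderiv, smul_apply, radial_r hx, smul_eq_mul]
  ring

theorem opL_r_inv (hx : p.2 ≠ 0) : opL (fun p => ‖p.2‖⁻¹) p = -(‖p.2‖⁻¹ * ‖p.2‖⁻¹) := by
  rw [opL_eq, (hasFDerivAt_r_inv hx).fderiv, smul_apply, radial_r hx, smul_eq_mul]
  ring

variable {f : Idx N.e₀ → ℝ × (ℝ × Space) → ℝ}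

theorem fderiv_comp_coordN (hf : (frameP N.toParams).Smooth f) (hp : p ∈ N.region i)
    (v : Spacetime) : fderiv ℝ (fun p => f i (coordN R p)) p v =
      fderiv ℝ (f i) (coordN R p) (fderiv ℝ (coordN R) p v) := by
  have h := (hf.differentiableAt (mapsTo hp)).hasFDerivAt.comp p
    (((coordN_smooth N i).contDiffAt ((region_isOpen i).mem_nhds hp)).differentiableAt
      (by simp)).hasFDerivAt
  exact congrArg (fun L => L v) h.fderiv

theorem opB_comp (hf : (frameP N.toParams).Smooth f) (hp : p ∈ N.region i) :
    opB (fun p => f i (coordN R p)) p =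
      (frameP N.toParams).der (none : CoordLabel) f i (coordN R p) := by
  rw [opB_eq, fderiv_comp_coordN hf hp, radial_deriv hp]
  norm_num
  rfl

theorem opL_comp (hf : (frameP N.toParams).Smooth f) (hp : p ∈ N.region i) :
    opL (fun p => f i (coordN R p)) p = ((p.1 + ‖p.2‖ + R) / 2)⁻¹ *
      (frameP N.toParams).der (some none : CoordLabel) f i (coordN R p) := by
  rw [opL_eq, fderiv_comp_coordN hf hp, radial_deriv hp]
  have e : (((1 - 1) / 2, (((p.1 + ‖p.2‖ + R) / 2)⁻¹ * ((1 + 1) / 2), 0)) : ℝ × (ℝ × Space)) =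
      ((p.1 + ‖p.2‖ + R) / 2)⁻¹ • cdir (some none) := by
    simp [cdir]
  rw [e, map_smul, smul_eq_mul]
  rfl

end Near

end QuasilinearWave

end

noncomputable section

namespace QuasilinearWave

/-! ### Taylor expansion of the coefficients -/

theorem exists_hadamard {h : ℝ → ℝ} (hh : ContDiff ℝ ∞ h) :
    ∃ k : ℝ → ℝ, ContDiff ℝ ∞ k ∧ ∀ z, h z = h 0 + z * k z := by
  have h1 : ContDiff ℝ ∞ fun w : ℝ × ℝ => deriv h (w.1 * w.2) :=
    (contDiff_infty_iff_deriv.1 hh).2.comp (contDiff_fst.mul contDiff_snd)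
  have h2 := (contDiff_primitive h1).comp (f := fun z : ℝ => ((1 : ℝ), z)) (by fun_prop)
  refine ⟨_, h2, fun z => ?_⟩
  have hd : ∀ τ ∈ Set.uIcc (0 : ℝ) 1, HasDerivAt (fun τ => h (τ * z)) (deriv h (τ * z) * z) τ :=
    fun τ _ => by
      have h3 := ((hh.differentiable (by simp)) (τ * z)).hasDerivAt.comp τ
        ((hasDerivAt_id τ).mul_const z)
      exact h3.congr_deriv (by rw [one_mul])
  have hc : Continuous fun τ : ℝ => deriv h (τ * z) * z :=
    ((hh.continuous_deriv (by simp)).comp (by fun_prop)).mul continuous_const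
  have := intervalIntegral.integral_eq_sub_of_hasDerivAt hd (hc.intervalIntegrable _ _)
  rw [intervalIntegral.integral_mul_const, one_mul, zero_mul] at this
  simp only [Function.comp_def]
  linarith

theorem exists_taylor {h : ℝ → ℝ} (hh : ContDiff ℝ ∞ h) :
    ∃ k : ℝ → ℝ, ContDiff ℝ ∞ k ∧ ∀ z, h z = h 0 + deriv h 0 * z + z * (z * k z) := by
  obtain ⟨k₁, hk₁, e₁⟩ := exists_hadamard hh
  obtain ⟨k₂, hk₂, e₂⟩ := exists_hadamard hk₁
  refine ⟨k₂, hk₂, fun z => ?_⟩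
  have h1 : deriv h 0 = k₁ 0 := by
    have h2 := ((hasDerivAt_id (0 : ℝ)).mul
      ((hk₁.differentiable (by simp)) 0).hasDerivAt).const_add (h 0)
    have h3 : h = fun z => h 0 + z * k₁ z := funext e₁
    rw [h3]
    refine HasDerivAt.deriv (h2.congr_deriv ?_)
    simp
  rw [e₁ z, e₂ z, h1]
  ring

section

variable {e₀ : ℝ} {D : Cone e₀} {f : Idx e₀ → Spacetime → ℝ}

theorem Frame.Symbol.comp_bounded (hf : (frameZ D).Symbol (-1) f) {M : ℝ}
    (hM : ∀ i, ∀ p ∈ D.dom i, |f i p| ≤ M) {h : ℝ → ℝ} (hh : ContDiff ℝ ∞ h) :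
    (frameZ D).Symbol 0 fun i p => h (f i p) := fun n =>
  ((hf.weakenZ (by norm_num : (-1 : ℤ) ≤ 0)) n).comp_bounded hM hh

theorem Frame.Symbol.taylor (hf : (frameZ D).Symbol (-1) f) {M : ℝ}
    (hM : ∀ i, ∀ p ∈ D.dom i, |f i p| ≤ M) {h : ℝ → ℝ} (hh : ContDiff ℝ ∞ h) :
    (frameZ D).Symbol (-2) fun i p => h (f i p) - (h 0 + deriv h 0 * f i p) := by
  obtain ⟨k, hk, e⟩ := exists_taylor hh
  refine (hf.mul (hf.mul (hf.comp_bounded hM hk) (add_zero (-1))) (by norm_num)).congr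
    fun i p _ => ?_
  rw [e (f i p)]
  ring

end

/-! ### Functions of `(q, s, ω)` and their null derivatives. -/

namespace Near

variable {R : ℝ} {a b : ℝ × Space → ℝ} {ha : IsCoeff R a} (N : Near ha)

/-- The arguments `(q, s, ω)` of the profile. -/
def arg (i : Idx N.e₀) (p : Spacetime) : ℝ × (ℝ × Space) :=
  (ha.optical i.ε i.δ p, (i.ε * Real.log p.1 - i.δ, ‖p.2‖⁻¹ • p.2))

variable {N} {i : Idx N.e₀} {p : Spacetime}

theorem argP_eq (hp : p ∈ N.region i) : argP N.toParams ha i (coordN R p) = N.arg i p := by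
  simp only [argP, optP, slowP, arg, coordN_time (v_pos hp), coordN_cone (v_pos hp)]
  rfl

variable (N) in
theorem symbol_arg {f : Unit → ℝ × (ℝ × Space) → ℝ} (hf : ∀ n, (frameH R).Sym n 0 f) :
    (frameZ N.cone).Symbol 0 fun i p => f () (N.arg i p) :=
  (symbol_comp N fun n => argP_sym N.toParams ha n (hf n)).congr fun i p hp => by
    rw [argP_eq hp]

variable (N) in
theorem symbol_q : (frameZ N.cone).Symbol 0 fun i p => ha.optical i.ε i.δ p :=
  (symbol_comp N fun n => optP_sym N.toParams ha n).congr fun _ _ hp =>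
    congrArg Prod.fst (argP_eq hp).symm

theorem opB_q (hp : p ∈ N.region i) :
    opB (ha.optical i.ε i.δ) p = speedH a (N.arg i p) := by
  rw [← argP_eq hp, ← optP_der_none N.toParams ha (mapsTo hp),
    ← opB_comp (optP_smooth N.toParams ha) hp]
  exact opB_congr (D := N.cone) (g := fun i p => ha.optical i.ε i.δ p)
    (fun _ _ hp => congrArg Prod.fst (argP_eq hp).symm) hp

theorem opL_q (hp : p ∈ N.region i) :
    opL (ha.optical i.ε i.δ) p = ((p.1 + ‖p.2‖ + R) / 2)⁻¹ *
      (frameP N.toParams).der (some none : CoordLabel) (optP N.toParams ha) i (coordN R p) := by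
  rw [← opL_comp (optP_smooth N.toParams ha) hp]
  exact opL_congr (D := N.cone) (g := fun i p => ha.optical i.ε i.δ p)
    (fun _ _ hp => congrArg Prod.fst (argP_eq hp).symm) hp

variable {f : Unit → ℝ × (ℝ × Space) → ℝ}

theorem opB_arg (hf : (frameH R).Smooth f) (hp : p ∈ N.region i) :
    opB (fun p => f () (N.arg i p)) p =
      (frameH R).der (none : CoordLabel) f () (N.arg i p) * speedH a (N.arg i p) +
      (frameH R).der (some none : CoordLabel) f () (N.arg i p) * (i.ε * p.1⁻¹) := by
  have h1 := argP_der_none N.toParams ha hf (mapsTo hp)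
  have hs : (frameP N.toParams).Smooth fun i w => f () (argP N.toParams ha i w) := fun i =>
    (hf ()).comp (argP_smooth N.toParams ha i) fun _ _ => trivial
  rw [← opB_comp hs hp, coordN_time (v_pos hp), argP_eq hp] at h1
  rw [← h1]
  exact opB_congr (D := N.cone) (g := fun i p => f () (N.arg i p))
      (f := fun i p => f () (argP N.toParams ha i (coordN R p)))
    (fun i p hp => by rw [argP_eq hp]) hp

theorem opL_arg (hf : (frameH R).Smooth f)
    (hf0 : ∀ w, (frameH R).der (some none : CoordLabel) f () w = 0) (hp : p ∈ N.region i) :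
    opL (fun p => f () (N.arg i p)) p =
      (frameH R).der (none : CoordLabel) f () (N.arg i p) * opL (ha.optical i.ε i.δ) p := by
  have hs : (frameP N.toParams).Smooth fun i w => f () (argP N.toParams ha i w) := fun i =>
    (hf ()).comp (argP_smooth N.toParams ha i) fun _ _ => trivial
  have h1 := argP_der N.toParams ha hf (some none) (mapsTo hp)
  have h3 : ∀ k : Fin 3, (frameP N.toParams).der (some none : CoordLabel)
      (fun _ w => ccoord (some (some k)) w) i (coordN R p) = 0 := fun k => by
    change fderiv ℝ (ccoord (some (some k))) (coordN R p) (cdir (some none)) = 0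
    rw [(ccoord (some (some k))).fderiv]
    simp [ccoord, cdir]
  simp only [h3, mul_zero, Finset.sum_const_zero, add_zero, hf0, zero_mul] at h1
  rw [opL_q hp, ← argP_eq hp]
  have h4 : opL (fun p => f () (N.arg i p)) p =
      opL (fun p => f () (argP N.toParams ha i (coordN R p))) p :=
    opL_congr (D := N.cone) (g := fun i p => f () (N.arg i p))
      (f := fun i p => f () (argP N.toParams ha i (coordN R p)))
      (fun i p hp => by rw [argP_eq hp]) hp
  rw [h4]
  refine (opL_comp hs hp).trans ?_
  rw [h1]
  ring

end Near

end QuasilinearWave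

end

noncomputable section

namespace QuasilinearWave

/-! ### Symbols near the light cone -/

section

variable {e₀ : ℝ} {D : Cone e₀} {i : Idx e₀} {p : Spacetime}

theorem quadG_eq (g : Fin 4 → Fin 4 → ℝ → ℝ) (p : Spacetime) :
    quadG g (‖p.2‖⁻¹ • p.2) = ∑ α, ∑ β, deriv (g α β) 0 * (omHat α p * omHat β p) := by
  simp only [quadG, mul_assoc]
  rfl

theorem minkowski_eq (hx : p.2 ≠ 0) (f : Spacetime → ℝ) :
    ∑ α, ∑ β, boxCoeff α β * (pd α f p * pd β f p) =
      opL f p * opB f p - ∑ k : Fin 3, opP k f p * opP k f p := by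
  have h := om_sq hx
  have e : ∑ α, ∑ β, boxCoeff α β * (pd α f p * pd β f p) =
      pd 0 f p * pd 0 f p - ∑ k : Fin 3, pd k.succ f p * pd k.succ f p := by
    simp [Fin.sum_univ_succ, boxCoeff]
    ring
  have e2 : opR f p = ∑ k : Fin 3, om k p * pd k.succ f p := rfl
  rw [e]
  simp only [opL, opB, opP, Fin.sum_univ_three] at h e2 ⊢
  linear_combination (opR f p * opR f p) * h + (2 * opR f p) * e2

variable (D) in
theorem symbol_quadG (g : Fin 4 → Fin 4 → ℝ → ℝ) :
    (frameZ D).Symbol 0 fun _ p => quadG g (‖p.2‖⁻¹ • p.2) :=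
  (Frame.Symbol.sum (s := Finset.univ) fun α => Frame.Symbol.sum (s := Finset.univ) fun β =>
    ((symbol_omHat D α).mul (symbol_omHat D β) (add_zero 0)).real_mul (deriv (g α β) 0)).congr
    fun _ p _ => quadG_eq g p

end

theorem frameP_quadG {R : ℝ} (P : Params R) (g : Fin 4 → Fin 4 → ℝ → ℝ) (n : ℕ) :
    (frameP P).Sym n 0 fun _ w => quadG g w.2.2 := by
  have h : ∀ α, (frameP P).Sym n 0 fun _ w => hat w.2.2 α := fun α =>
    Fin.cases (Frame.Sym.const (c := fun _ => -1) (M := 1) (by simp) n) (frameP_x P n) α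
  exact (Frame.Sym.sum (s := Finset.univ) fun α _ => Frame.Sym.sum (s := Finset.univ) fun β _ =>
    ((h α).mul' (h β) (add_zero 0)).real_mul (deriv (g α β) 0)).congr
      fun _ p _ => by simp only [quadG, mul_assoc]

/-- The region near the light cone for the coefficient `½ G A`. -/
abbrev NearG {R : ℝ} {b : ℝ × Space → ℝ} (hb : IsCoeff R b) (g : Fin 4 → Fin 4 → ℝ → ℝ) :=
  Near (hb.half_quadG_mul g)

namespace NearG

open Near

variable {R : ℝ} {b : ℝ × Space → ℝ} {hb : IsCoeff R b} {g : Fin 4 → Fin 4 → ℝ → ℝ}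
  (N : NearG hb g)

/-- The profile `U`. -/
def U (i : Idx N.e₀) (p : Spacetime) : ℝ :=
  prof (fun w => 1 / 2 * quadG g w.2 * b w) b R (N.arg i p)

/-- The derivative of the profile in slow time. -/
def U' (i : Idx N.e₀) (p : Spacetime) : ℝ :=
  (frameH R).der (some none : CoordLabel)
    (fun _ => prof (fun w => 1 / 2 * quadG g w.2 * b w) b R) () (N.arg i p)

/-- The speed of the characteristics. -/
def μ (i : Idx N.e₀) (p : Spacetime) : ℝ :=
  speedH (fun w => 1 / 2 * quadG g w.2 * b w) (N.arg i p)

/-- The radiation field `A(q, ω)`. -/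
def β (i : Idx N.e₀) (p : Spacetime) : ℝ := b ((N.arg i p).1, (N.arg i p).2.2)

/-- The derivative of `A` in `q`. -/
def β' (i : Idx N.e₀) (p : Spacetime) : ℝ :=
  (frameH R).der (none : CoordLabel) (fun _ w => b (w.1, w.2.2)) () (N.arg i p)

/-- The optical function. -/
def q (i : Idx N.e₀) (p : Spacetime) : ℝ := (hb.half_quadG_mul g).optical i.ε i.δ p

/-- The value `G(ω)`. -/
def c (_ : Idx N.e₀) (p : Spacetime) : ℝ := quadG g (‖p.2‖⁻¹ • p.2)

/-- The factor `1/r`. -/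
def ri (_ : Idx N.e₀) (p : Spacetime) : ℝ := ‖p.2‖⁻¹

theorem symbol_U : (frameZ N.cone).Symbol 0 N.U :=
  symbol_arg N fun n => frameH_prof n (hb.half_quadG_mul g) hb

theorem symbol_U' : (frameZ N.cone).Symbol 0 N.U' :=
  symbol_arg N fun n => (frameH_prof (n + 1) (hb.half_quadG_mul g) hb).der (some none : CoordLabel)

theorem symbol_μ : (frameZ N.cone).Symbol 0 N.μ :=
  symbol_arg N fun n => frameH_speed n (hb.half_quadG_mul g)

theorem symbol_β : (frameZ N.cone).Symbol 0 N.β :=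
  symbol_arg N (f := fun _ w => b (w.1, w.2.2)) fun n => frameH_coeff R n hb.smooth hb.compact

theorem symbol_β' : (frameZ N.cone).Symbol 0 N.β' :=
  symbol_arg N fun n => (frameH_coeff R (n + 1) hb.smooth hb.compact).der (none : CoordLabel)

theorem symbol_c : (frameZ N.cone).Symbol 0 N.c := symbol_quadG N.cone g

theorem symbol_ri : (frameZ N.cone).Symbol (-1) N.ri := symbol_r_inv N.cone

theorem symbol_qN : (frameZ N.cone).Symbol 0 N.q := symbol_q N

variable {N} {i : Idx N.e₀} {p : Spacetime} {k : ℤ} {f : Idx N.e₀ → Spacetime → ℝ}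

theorem symbol_ε_mul (hf : (frameZ N.cone).Symbol k f) :
    (frameZ N.cone).Symbol k fun i p => i.ε * f i p := fun n =>
  (hf n).const_mul (c := fun i : Idx N.e₀ => i.ε) fun i => Idx.abs_ε_le (P := N.toParams) i

theorem symbol_ti : (frameZ N.cone).Symbol (-1) fun _ p => p.1⁻¹ := fun n =>
  frameZ_of_frameD _ (frameD_t_inv N.cone n)

/-- The exponentials in `∂_q U` and `μ` cancel, so the leading term is the radiation field itself,
without any loss in `t`. -/
theorem opB_U (hp : p ∈ N.region i) :
    opB (N.U i) p = -2 * N.β i p + N.U' i p * (i.ε * p.1⁻¹) := by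
  refine (opB_arg (frameH_prof 0 (hb.half_quadG_mul g) hb).smooth hp).trans ?_
  rw [prof_mul_speed (hb.half_quadG_mul g) hb]
  rfl

theorem opB_qN (hp : p ∈ N.region i) : opB (N.q i) p = N.μ i p := opB_q hp

theorem coeff_der_time (w : ℝ × (ℝ × Space)) : (frameH R).der (some none : CoordLabel)
    (fun _ w => b (w.1, w.2.2)) () w = 0 := by
  by_cases hd : DifferentiableAt ℝ (fun w : ℝ × (ℝ × Space) => b (w.1, w.2.2)) w
  · have h := hd.hasFDerivAt.comp_hasDerivAt w.2.1 ((hasDerivAt_const w.2.1 w.1).prodMk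
      ((hasDerivAt_id w.2.1).prodMk (hasDerivAt_const w.2.1 w.2.2)))
    exact h.unique (hasDerivAt_const w.2.1 (b (w.1, w.2.2)))
  · change fderiv ℝ _ w (cdir (some none)) = 0
    rw [fderiv_zero_of_not_differentiableAt hd]
    rfl

theorem opB_β (hp : p ∈ N.region i) : opB (N.β i) p = N.β' i p * N.μ i p := by
  refine (opB_arg (f := fun _ w => b (w.1, w.2.2))
    (frameH_coeff R 0 hb.smooth hb.compact).smooth hp).trans ?_
  rw [coeff_der_time, zero_mul, add_zero]
  rfl

theorem opL_β (hp : p ∈ N.region i) : opL (N.β i) p = N.β' i p * opL (N.q i) p :=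
  opL_arg (f := fun _ w => b (w.1, w.2.2)) (frameH_coeff R 0 hb.smooth hb.compact).smooth
    coeff_der_time hp

variable (N) in
/-- The outgoing derivative of the optical function, to leading order. -/
theorem symbol_opL_q : (frameZ N.cone).Symbol (-2) fun i p =>
    opL (N.q i) p + 1 / 4 * (i.ε * (N.c i p * (N.ri i p * (N.U i p * N.μ i p)))) := by
  have hd : (frameZ N.cone).Symbol 0 fun i p => Real.exp (coordN R p).2.1 *
      deficitP N.toParams (hb.half_quadG_mul g) b (quadG g) i (coordN R p) :=
    symbol_comp N (f := fun i w => Real.exp w.2.1 *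
      deficitP N.toParams (hb.half_quadG_mul g) b (quadG g) i w) fun n =>
      (frameP_exp N.toParams n).mul' (deficitP_sym N.toParams (hb.half_quadG_mul g) hb
        (quadG_smooth g) (fun n => frameP_quadG N.toParams g n) (fun _ _ => rfl) n) (by norm_num)
  have hτ := symbol_scale_inv N
  have h1 := hτ.mul (hτ.mul hd (add_zero (-1))) (by norm_num : (-1 : ℤ) + -1 = -2)
  have hcU := symbol_ε_mul ((symbol_c N).mul ((symbol_U N).mul (symbol_μ N) (add_zero 0)) (add_zero 0))
  -- The chart produces the factor `2/(t + r + R)` instead of `1/r`. Their difference is `(t - r +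
  -- R)/(r (t + r + R))`, of degree `-2`.
  have h2 := ((symbol_t_sub_r N).add (symbol_const N.cone R)).mul
    ((hτ.mul (symbol_ri N) (by norm_num : (-1 : ℤ) + -1 = -2)).mul hcU (add_zero (-2))) (zero_add (-2))
  refine (h1.add (h2.real_mul (1 / 8))).congr fun i p hp => ?_
  have e1 : opL (N.q i) p = _ := opL_q hp
  have hτ0 := (half_pos (v_pos hp)).ne'
  have hr : ‖p.2‖ ≠ 0 := norm_ne_zero_iff.2 hp.1.2
  rw [e1, exp_m hp, deficitP, argP_eq hp]
  have hU : prof (fun w => 1 / 2 * quadG g w.2 * b w) b R (N.arg i p) = N.U i p := rfl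
  have hμ : speedH (fun w => 1 / 2 * quadG g w.2 * b w) (N.arg i p) = N.μ i p := rfl
  have hc : quadG g (coordN R p).2.2 = N.c i p := rfl
  rw [hU, hμ, hc]
  generalize (frameP N.toParams).der (some none : CoordLabel) (optP N.toParams _) i (coordN R p) = X
  have hv : p.1 + ‖p.2‖ + R ≠ 0 := (v_pos hp).ne'
  simp only [ri]
  field_simp
  ring

variable (N)

/-- The leading part `U/r` of the solution. -/
def far (i : Idx N.e₀) (p : Spacetime) : ℝ := N.ri i p * N.U i p

theorem symbol_far : (frameZ N.cone).Symbol (-1) N.far :=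
  (symbol_ri N).mul (symbol_U N) (add_zero (-1))

/-- The remainder in the incoming derivative of `U/r`. -/
def farRem (i : Idx N.e₀) (p : Spacetime) : ℝ :=
  N.ri i p * (i.ε * (p.1⁻¹ * N.U' i p)) + N.ri i p * (N.ri i p * N.U i p)

theorem symbol_farRem : (frameZ N.cone).Symbol (-2) N.farRem :=
  ((symbol_ri N).mul (symbol_ε_mul (symbol_ti.mul (symbol_U' N) (add_zero (-1)))) (by norm_num)).add
    ((symbol_ri N).mul (symbol_far N) (by norm_num))

/-- The principal part of the incoming derivative of `U/r`. -/
def farMain (i : Idx N.e₀) (p : Spacetime) : ℝ := N.ri i p * N.β i p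

theorem symbol_farMain : (frameZ N.cone).Symbol (-1) N.farMain :=
  (symbol_ri N).mul (symbol_β N) (add_zero (-1))

variable {N}

theorem opB_far (hp : p ∈ N.region i) : opB (N.far i) p = -2 * N.farMain i p + N.farRem i p := by
  refine (opB_mul (D := N.cone) (symbol_ri N).smooth (symbol_U N).smooth hp).trans ?_
  have e1 : opB (N.ri i) p = N.ri i p * N.ri i p := opB_r_inv hp.1.2
  rw [e1, opB_U hp, farMain, farRem]
  ring

theorem opB_farMain (hp : p ∈ N.region i) : opB (N.farMain i) p =
    N.ri i p * (N.β' i p * N.μ i p) + N.ri i p * (N.ri i p * N.β i p) := by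
  refine (opB_mul (D := N.cone) (symbol_ri N).smooth (symbol_β N).smooth hp).trans ?_
  have e1 : opB (N.ri i) p = N.ri i p * N.ri i p := opB_r_inv hp.1.2
  rw [e1, opB_β hp]
  ring

theorem opL_farMain (hp : p ∈ N.region i) : opL (N.farMain i) p =
    N.ri i p * (N.β' i p * opL (N.q i) p) - N.ri i p * (N.ri i p * N.β i p) := by
  refine (opL_mul (D := N.cone) (symbol_ri N).smooth (symbol_β N).smooth hp).trans ?_
  have e1 : opL (N.ri i) p = -(N.ri i p * N.ri i p) := opL_r_inv hp.1.2
  rw [e1, opL_β hp]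
  ring

theorem smooth_const_mul (c : ℝ) (hf : (frameZ N.cone).Symbol k f) :
    (frameZ N.cone).Smooth fun i p => c * f i p := (hf.real_mul c).smooth

theorem opB_const_mul (c : ℝ) (hf : (frameZ N.cone).Symbol k f) (hp : p ∈ N.region i) :
    opB (fun p => c * f i p) p = c * opB (f i) p := by
  refine (opB_mul (D := N.cone) (f := fun _ _ => c) (symbol_const N.cone c).smooth hf.smooth
    hp).trans ?_
  simp [opB, opR, pd]

theorem opL_const_mul (c : ℝ) (hf : (frameZ N.cone).Symbol k f) (hp : p ∈ N.region i) :
    opL (fun p => c * f i p) p = c * opL (f i) p := by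
  refine (opL_mul (D := N.cone) (f := fun _ _ => c) (symbol_const N.cone c).smooth hf.smooth
    hp).trans ?_
  simp [opL, opR, pd]

variable (N)

theorem symbol_opB_opB_far : (frameZ N.cone).Symbol (-2) fun i p =>
    opB (opB (N.far i)) p + 2 * (N.ri i p * (N.β' i p * N.μ i p)) := by
  refine ((symbol_farRem N).opB.sub (((symbol_ri N).mul (symbol_farMain N) (by norm_num :
    (-1 : ℤ) + -1 = -2)).real_mul 2)).congr fun i p hp => ?_
  have e1 : opB (opB (N.far i)) p = opB (fun p => -2 * N.farMain i p + N.farRem i p) p :=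
    opB_congr (D := N.cone) (g := fun i => opB (N.far i))
      (f := fun i p => -2 * N.farMain i p + N.farRem i p) (fun i p hp => opB_far hp) hp
  rw [e1, opB_add (D := N.cone) (f := fun i p => -2 * N.farMain i p)
    (smooth_const_mul (-2) (symbol_farMain N)) (symbol_farRem N).smooth hp,
    opB_const_mul (-2) (symbol_farMain N) hp, opB_farMain hp, farMain]
  ring

/-- To leading order `B(U/r) = -2A/r`. In `L B + r⁻¹ B` the two terms `A/r²` cancel and `-2 r⁻¹ (∂_q
A) L q` remains, in which the leading part of `L q` is inserted. -/
theorem symbol_box_far : (frameZ N.cone).Symbol (-3) fun i p =>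
    (∑ α, ∑ β, boxCoeff α β * pd α (pd β (N.far i)) p) -
      1 / 2 * (i.ε * (N.c i p * (N.ri i p * (N.ri i p * (N.β' i p * (N.U i p * N.μ i p)))))) := by
  have h1 := symbol_box (l := -3) (symbol_far N) (by norm_num)
  have h2 := (symbol_farRem N).opL (l := -3) (by norm_num)
  have h3 := (symbol_ri N).mul (symbol_farRem N) (by norm_num : (-1 : ℤ) + -2 = -3)
  have h4 := (symbol_ri N).mul ((symbol_β' N).mul (symbol_opL_q N) (zero_add (-2)))
    (by norm_num : (-1 : ℤ) + -2 = -3)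
  refine (((h1.add h2).add h3).add (h4.real_mul (-2))).congr fun i p hp => ?_
  have e1 : opL (opB (N.far i)) p = opL (fun p => -2 * N.farMain i p + N.farRem i p) p :=
    opL_congr (D := N.cone) (g := fun i => opB (N.far i))
      (f := fun i p => -2 * N.farMain i p + N.farRem i p) (fun i p hp => opB_far hp) hp
  have e2 : (‖p.2‖)⁻¹ = N.ri i p := rfl
  rw [e1, e2, opL_add (D := N.cone) (f := fun i p => -2 * N.farMain i p)
    (smooth_const_mul (-2) (symbol_farMain N)) (symbol_farRem N).smooth hp,
    opL_const_mul (-2) (symbol_farMain N) hp, opL_farMain hp, opB_far hp, farMain]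
  ring

theorem symbol_pd_pd_far (α β : Fin 4) : (frameZ N.cone).Symbol (-2) fun i p =>
    pd α (pd β (N.far i)) p +
      1 / 2 * (omHat α p * (omHat β p * (N.ri i p * (N.β' i p * N.μ i p)))) := by
  have h1 := symbol_pd_pd (l := -2) (symbol_far N) (by norm_num) α β
  have h2 := (symbol_omHat N.cone α).mul ((symbol_omHat N.cone β).mul (symbol_opB_opB_far N)
    (zero_add (-2))) (zero_add (-2))
  refine (h1.add (h2.real_mul (1 / 4))).congr fun i p _ => ?_
  ring

end NearG

end QuasilinearWave

end

noncomputable section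

namespace QuasilinearWave

/-! ### The quasilinear operator near the light cone -/

section

variable {R : ℝ} {a b : ℝ × Space → ℝ}

theorem exists_prof_bound (ha : IsCoeff R a) (hb : IsCoeff R b) (hR : 0 < R) {M : ℝ}
    (hM : ∀ w, |a w| ≤ M) : ∃ B, 0 ≤ B ∧ ∀ w : ℝ × (ℝ × Space),
      |prof a b R w| ≤ B * Real.exp (M * |w.2.1|) := by
  obtain ⟨B, hB⟩ := hb.compact.exists_bound_of_continuous hb.smooth.continuous
  have hB0 : 0 ≤ B := (norm_nonneg _).trans (hB 0)
  have key : ∀ q ∈ Set.Icc (-R) R, ∀ l : ℝ × Space,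
      |prof a b R (q, l)| ≤ 2 * R * B * Real.exp (M * |l.1|) := by
    intro q hq l
    have h1 : ∀ p ∈ Set.uIoc (-R) q, ‖b (p, l.2) * Real.exp (-(a (p, l.2) * l.1))‖ ≤
        B * Real.exp (M * |l.1|) := fun p _ => by
      rw [norm_mul, Real.norm_of_nonneg (Real.exp_pos _).le]
      refine mul_le_mul (hB _) (Real.exp_le_exp.2 ?_) (Real.exp_pos _).le hB0
      refine (neg_le_abs _).trans ?_
      rw [abs_mul]
      exact mul_le_mul_of_nonneg_right (hM _) (abs_nonneg _)
    have h2 := intervalIntegral.norm_integral_le_of_norm_le_const h1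
    have h3 : |q - -R| ≤ 2 * R := by
      rw [abs_le]
      constructor <;> linarith [hq.1, hq.2]
    refine h2.trans ((mul_le_mul_of_nonneg_left h3 (by positivity)).trans (le_of_eq ?_))
    ring
  refine ⟨2 * R * B, by positivity, fun w => ?_⟩
  rcases le_or_gt R w.1 with h | h
  · rw [show w = (w.1, w.2) from rfl, prof_of_ge hb ha h]
    exact key R ⟨by linarith, le_rfl⟩ w.2
  · rcases le_or_gt w.1 (-R) with h' | h'
    · rw [show w = (w.1, w.2) from rfl, prof_of_le hb h', abs_zero]
      positivity
    · exact key w.1 ⟨h'.le, h.le⟩ w.2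

end

section

variable {e₀ : ℝ} {D : Cone e₀} {f g : Idx e₀ → Spacetime → ℝ} {i : Idx e₀} {p : Spacetime}

theorem pd_pd_sub (hf : (frameZ D).Smooth f) (hg : (frameZ D).Smooth g) (α β : Fin 4)
    (hp : p ∈ D.dom i) : pd α (pd β (fun p => f i p - g i p)) p =
      pd α (pd β (f i)) p - pd α (pd β (g i)) p :=
  (pd_congr (D := D) (g := fun i => pd β fun p => f i p - g i p)
    (f := fun i p => pd β (f i) p - pd β (g i) p) (fun _ _ hp => pd_sub hf hg β hp) α hp).trans
    (pd_sub (hf.pd β) (hg.pd β) α hp)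

end

namespace NearG

open Near

variable {R : ℝ} {b : ℝ × Space → ℝ} {hb : IsCoeff R b} {g : Fin 4 → Fin 4 → ℝ → ℝ}
  (N : NearG hb g)

/-- `M ε ≤ ½` limits the growth of the profile to `t^{1/2}`. This crude bound, with no unspecified
power of the weight, keeps the argument of the metric in a fixed compact set and later absorbs
derivatives of the cutoffs. -/
theorem exists_U_bound : ∃ B, 0 ≤ B ∧ ∀ (i : Idx N.e₀) (p : Spacetime), 1 ≤ p.1 →
    |N.U i p| ≤ B * p.1 ^ (1 / 2 : ℝ) := by
  obtain ⟨B, hB, H⟩ := exists_prof_bound (hb.half_quadG_mul g) hb N.R_pos N.coeff_le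
  refine ⟨B * Real.exp N.M, by positivity, fun i p hp => (H _).trans ?_⟩
  rw [mul_assoc]
  refine mul_le_mul_of_nonneg_left ?_ hB
  have ht : 0 < p.1 := one_pos.trans_le hp
  rw [Real.rpow_def_of_pos ht, ← Real.exp_add]
  refine Real.exp_le_exp.2 ?_
  have hl := Real.log_nonneg hp
  have h1 : |i.ε * Real.log p.1 - i.δ| ≤ i.ε * Real.log p.1 + 1 := by
    have := mul_nonneg i.ε_pos.le hl
    have := i.δ_pos
    have := i.δ_lt
    rw [abs_le]
    constructor <;> linarith
  have h2 : N.M * i.ε ≤ 1 / 2 :=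
    (mul_le_mul_of_nonneg_left i.ε_lt.le N.M_nonneg).trans N.M_mul
  calc N.M * |i.ε * Real.log p.1 - i.δ| ≤ N.M * (i.ε * Real.log p.1 + 1) :=
        mul_le_mul_of_nonneg_left h1 N.M_nonneg
    _ = N.M + N.M * i.ε * Real.log p.1 := by ring
    _ ≤ N.M + 1 / 2 * Real.log p.1 := by gcongr
    _ = _ := by ring

theorem exists_mul_U_bound {K : ℝ} (hK : 0 ≤ K) {κ : Idx N.e₀ → Spacetime → ℝ}
    {S : Idx N.e₀ → Set Spacetime} (hS : ∀ i, ∀ p ∈ S i, 1 ≤ p.1)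
    (hκ : ∀ i, ∀ p ∈ S i, |κ i p| ≤ K * p.1⁻¹) :
    ∃ M, ∀ i, ∀ p ∈ S i, |i.ε * (κ i p * N.U i p)| ≤ M := by
  obtain ⟨B, hB, H⟩ := N.exists_U_bound
  refine ⟨K * B, fun i p hp => ?_⟩
  have h1 := hS i p hp
  have ht : 0 < p.1 := one_pos.trans_le h1
  have h2 : p.1⁻¹ * p.1 ^ (1 / 2 : ℝ) ≤ 1 := by
    rw [inv_mul_le_iff₀ ht, mul_one]
    simpa using Real.rpow_le_rpow_of_exponent_le h1 (by norm_num : (1 / 2 : ℝ) ≤ 1)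
  rw [abs_mul, abs_mul, abs_of_pos i.ε_pos]
  have h3 : i.ε ≤ 1 := i.ε_lt.le.trans N.e₀_le
  calc i.ε * (|κ i p| * |N.U i p|) ≤ 1 * (|κ i p| * |N.U i p|) := by gcongr
    _ ≤ 1 * (K * p.1⁻¹ * (B * p.1 ^ (1 / 2 : ℝ))) := by
        gcongr
        · exact hκ i p hp
        · exact H i p h1
    _ = K * B * (p.1⁻¹ * p.1 ^ (1 / 2 : ℝ)) := by ring
    _ ≤ K * B * 1 := by gcongr
    _ = K * B := mul_one _

theorem exists_far_bound : ∃ M, ∀ i, ∀ p ∈ N.region i, |i.ε * N.far i p| ≤ M := by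
  refine exists_mul_U_bound N (K := 4) (by norm_num) (fun i p hp => t_ge hp) fun i p hp => ?_
  have h1 := N.cone.lower i p hp
  have h2 := N.cone.t_pos hp
  have h3 := N.cone.r_pos hp
  rw [ri, abs_of_pos (inv_pos.2 h3)]
  field_simp
  linarith

/-- The quasilinear operator applied to a perturbation of `U/r`. -/
theorem symbol_waveOp (hg : IsWaveMetric g) {v : Idx N.e₀ → Spacetime → ℝ}
    (he : (frameZ N.cone).Symbol (-3) fun i p => v i p - N.far i p) {M : ℝ}
    (hM : ∀ i, ∀ p ∈ N.region i, |i.ε * v i p| ≤ M) :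
    (frameZ N.cone).Symbol (-3) fun i p =>
      ∑ α, ∑ β, g α β (i.ε * v i p) * pd α (pd β (v i)) p := by
  have hv : (frameZ N.cone).Symbol (-1) v :=
    ((he.weakenZ (by norm_num : (-3 : ℤ) ≤ -1)).add (symbol_far N)).congr fun i p _ => by ring
  have hεv := symbol_ε_mul hv
  have hεe := symbol_ε_mul he
  have hX := (symbol_ri N).mul ((symbol_β' N).mul (symbol_μ N) (add_zero 0)) (add_zero (-1))
  have hω := fun α β => ((symbol_omHat N.cone α).mul ((symbol_omHat N.cone β).mul hX
    (zero_add (-1))) (zero_add (-1)))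
  have hpd := fun α β => (hv.pd β).pd α
  have hpde := fun α β => (he.pd β).pd α
  have hE : ∀ α β, (frameZ N.cone).Symbol (-2) fun i p => pd α (pd β (v i)) p +
      1 / 2 * (omHat α p * (omHat β p * (N.ri i p * (N.β' i p * N.μ i p)))) := fun α β =>
    ((symbol_pd_pd_far N α β).add ((hpde α β).weakenZ (by norm_num))).congr fun i p hp => by
      rw [pd_pd_sub (D := N.cone) hv.smooth (symbol_far N).smooth α β hp]
      ring
  -- The three contributions are the quadratic Taylor remainder times `∂∂v`, the linear Taylor term
  -- times the error in the formula for `∂∂v`, and the effect of replacing `v` by `U/r` in the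
  -- remaining product. What is left, `-½ ε G (U/r) r⁻¹ (∂_q A) μ`, is cancelled by the main term of
  -- `symbol_box_far`.
  have h1 := Frame.Symbol.sum (s := Finset.univ) fun α => Frame.Symbol.sum (s := Finset.univ)
    fun β => (((hεv.taylor hM (hg.smooth α β)).mul (hpd α β) (by norm_num : (-2 : ℤ) + -1 = -3)).add
      ((hεv.mul (hE α β) (by norm_num : (-1 : ℤ) + -2 = -3)).real_mul (deriv (g α β) 0))).add
      (((hεe.mul (hω α β) (by norm_num : (-3 : ℤ) + -1 = -4)).weakenZ
        (by norm_num : (-4 : ℤ) ≤ -3)).real_mul (-(1 / 2) * deriv (g α β) 0))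
  have h2 := Frame.Symbol.sum (s := Finset.univ) fun α => Frame.Symbol.sum (s := Finset.univ)
    fun β => (hpde α β).real_mul (boxCoeff α β)
  refine ((h1.add h2).add (symbol_box_far N)).congr fun i p hp => ?_
  have hc : N.c i p = _ := quadG_eq g p
  have e1 : 1 / 2 * (i.ε * (N.c i p * (N.ri i p * (N.ri i p * (N.β' i p * (N.U i p * N.μ i p)))))) =
      ∑ α, ∑ β, 1 / 2 * (i.ε * (deriv (g α β) 0 * (omHat α p * omHat β p) *
        (N.ri i p * (N.ri i p * (N.β' i p * (N.U i p * N.μ i p)))))) := by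
    rw [hc]
    simp only [Finset.sum_mul, Finset.mul_sum]
  rw [e1]
  simp only [← Finset.sum_add_distrib, ← Finset.sum_sub_distrib]
  refine Finset.sum_congr rfl fun α _ => Finset.sum_congr rfl fun β _ => ?_
  rw [pd_pd_sub (D := N.cone) hv.smooth (symbol_far N).smooth α β hp, hg.at_zero α β, far]
  ring

/-- The eikonal equation, approximately. -/
theorem symbol_eikonal (hg : IsWaveMetric g) : (frameZ N.cone).Symbol (-2) fun i p =>
    ∑ α, ∑ β, g α β (i.ε * N.far i p) * pd α (N.q i) p * pd β (N.q i) p := by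
  obtain ⟨M, hM⟩ := N.exists_far_bound
  have hεv := symbol_ε_mul (symbol_far N)
  have hq := symbol_qN N
  have hT := fun α => hq.opT (l := -1) (by norm_num) α
  have hP := fun k => hq.opP (l := -1) (by norm_num) k
  have hωμ := fun α => (symbol_omHat N.cone α).mul (symbol_μ N) (add_zero 0)
  have hE : ∀ α β, (frameZ N.cone).Symbol (-1) fun i p => pd α (N.q i) p * pd β (N.q i) p -
      1 / 4 * (omHat α p * N.μ i p * (omHat β p * N.μ i p)) := fun α β =>
    (((hT α).mul (hq.pd β) (add_zero (-1))).add (((hωμ α).mul (hT β) (zero_add (-1))).real_mul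
      (-(1 / 2)))).congr fun i p hp => by
        rw [pd_eq α (N.q i) p, pd_eq β (N.q i) p, opB_qN hp]
        ring
  have h1 := Frame.Symbol.sum (s := Finset.univ) fun α => Frame.Symbol.sum (s := Finset.univ)
    fun β => ((hεv.taylor hM (hg.smooth α β)).mul ((hq.pd α).mul (hq.pd β) (add_zero 0))
      (add_zero (-2))).add ((hεv.mul (hE α β) (by norm_num : (-1 : ℤ) + -1 = -2)).real_mul
        (deriv (g α β) 0))
  have h2 := Frame.Symbol.sum (s := Finset.univ) fun k =>
    (hP k).mul (hP k) (by norm_num : (-1 : ℤ) + -1 = -2)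
  -- Up to degree `-2` the expression is `L q · B q` plus `¼ ε G (U/r) μ²`, that is, `μ` times the
  -- quantity already known to be of degree `-2`.
  have h3 := (symbol_opL_q N).mul (symbol_μ N) (add_zero (-2))
  refine ((h1.add h3).sub h2).congr fun i p hp => ?_
  have hc : N.c i p = _ := quadG_eq g p
  have hm := minkowski_eq hp.1.2 (N.q i)
  rw [opB_qN hp] at hm
  have e1 : (opL (N.q i) p + 1 / 4 * (i.ε * (N.c i p * (N.ri i p * (N.U i p * N.μ i p))))) *
      N.μ i p = opL (N.q i) p * N.μ i p + ∑ α, ∑ β, 1 / 4 * (i.ε * (deriv (g α β) 0 *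
        (omHat α p * omHat β p) * (N.ri i p * (N.U i p * N.μ i p)))) * N.μ i p := by
    rw [hc]
    simp only [Finset.sum_mul, Finset.mul_sum, add_mul]
  rw [e1]
  have e2 : opL (N.q i) p * N.μ i p = (∑ α, ∑ β, boxCoeff α β * (pd α (N.q i) p * pd β (N.q i) p)) +
      ∑ k : Fin 3, opP k (N.q i) p * opP k (N.q i) p := by
    linarith
  rw [e2, add_right_comm _ (∑ k : Fin 3, opP k (N.q i) p * opP k (N.q i) p), ← add_assoc,
    add_sub_cancel_right]
  simp only [← Finset.sum_add_distrib]
  refine Finset.sum_congr rfl fun α _ => Finset.sum_congr rfl fun β _ => ?_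
  rw [hg.at_zero α β, far]
  ring

end NearG

end QuasilinearWave

end

noncomputable section

namespace QuasilinearWave

/-! ### The cutoffs -/

section

variable {e₀ : ℝ} (D : Cone e₀)

theorem bd_time_bump {S : ℝ} {h : ℝ → ℝ} (hh : Continuous h) (h0 : ∀ t, S ≤ t → h t = 0)
    (k : ℤ) : (frameD D).Bd k fun _ p => h p.1 := by
  have hc : ContinuousOn (fun t : ℝ => h t * t ^ (-k)) (Set.Icc 1 S) :=
    hh.continuousOn.mul fun t ht =>
      (continuousAt_zpow₀ t (-k) (Or.inl (by linarith [ht.1]))).continuousWithinAt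
  obtain ⟨B, hB⟩ := isCompact_Icc.exists_bound_of_continuousOn hc
  refine ⟨|B|, abs_nonneg B, 0, fun i p hp => ?_⟩
  rw [pow_zero, mul_one]
  change |h p.1| ≤ |B| * p.1 ^ k
  have ht := D.t_pos hp
  rcases le_or_gt S p.1 with hS | hS
  · rw [h0 _ hS, abs_zero]
    positivity
  · have h1 := (hB p.1 ⟨D.time i p hp, hS.le⟩).trans (le_abs_self B)
    rw [Real.norm_eq_abs, abs_mul, abs_of_pos (zpow_pos ht _)] at h1
    have h2 := mul_le_mul_of_nonneg_right h1 (zpow_pos ht k).le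
    rwa [mul_assoc, ← zpow_add₀ ht.ne', neg_add_cancel, zpow_zero, mul_one] at h2

/-- Functions of time vanishing for late times are symbols of every degree. -/
theorem symbol_time_bump {S : ℝ} {h : ℝ → ℝ} (hh : ContDiff ℝ ∞ h) (h0 : ∀ t, S ≤ t → h t = 0)
    (k : ℤ) : (frameD D).Symbol k fun _ p => h p.1 := by
  intro n
  have hs : (frameD D).Smooth fun _ p => h p.1 := fun _ => (hh.comp contDiff_fst).contDiffOn
  induction n generalizing S h k with
  | zero => exact ⟨hs, bd_time_bump D hh.continuous h0 k⟩
  | succ n ih =>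
    refine ⟨hs, bd_time_bump D hh.continuous h0 k, fun α => ?_⟩
    have hd := (contDiff_infty_iff_deriv.1 hh).2
    have h1 : ∀ t, S + 1 ≤ t → deriv h t = 0 := fun t ht => by
      have : h =ᶠ[nhds t] fun _ => 0 :=
        Filter.eventually_of_mem (Ioi_mem_nhds (by linarith : S < t)) fun x hx => h0 x (le_of_lt hx)
      rw [this.deriv_eq, deriv_const]
    refine ((frameD_t D n).mul' ((ih hd h1 (k - 1) fun _ => (hd.comp contDiff_fst).contDiffOn).mul'
      (frameD_const D n (coordDir α).1) (add_zero _)) (by ring)).congr fun i p _ => ?_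
    have h3 := ((hh.differentiable (by simp)) p.1).hasDerivAt.comp_hasFDerivAt p
      (hasFDerivAt_fst (𝕜 := ℝ) (E := ℝ) (F := Space))
    refine (congrArg (fun L => L (p.1 • coordDir α)) h3.fderiv).trans ?_
    simp only [smul_apply, ContinuousLinearMap.coe_fst', Prod.smul_fst, smul_eq_mul]
    ring

/-- The factor of the profile in the approximate solution, without `ε`. -/
def cutoff (η ψ : ℝ → ℝ) (p : Spacetime) : ℝ := ‖p.2‖⁻¹ * η p.1 * ψ (‖p.2‖ / p.1)

variable {T : ℝ} {η ψ : ℝ → ℝ}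

theorem symbol_cutoff (hη : IsTimeCutoff T η) (hψ : IsConeCutoff ψ) :
    (frameD D).Symbol (-1) fun _ => cutoff η ψ := fun n => by
  have h1 := symbol_time_bump D (h := fun t => η t - 1) (S := 2 * T)
    (hη.smooth.sub contDiff_const) (fun t ht => by rw [hη.eq_one t ht, sub_self]) 0 n
  have h2 : (frameD D).Sym n 0 fun _ p => η p.1 :=
    (h1.add (frameD_const D n 1)).congr fun _ p _ => by ring
  have h3 : (frameD D).Sym n 0 fun _ p => ‖p.2‖ * p.1⁻¹ :=
    (frameD_r D n).1.mul' (frameD_t_inv D n) (by norm_num)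
  have h4 := h3.comp_bounded (M := 2) (fun i p hp => by
    have ht := D.t_pos hp
    have hr := D.r_pos hp
    rw [abs_of_pos (by positivity), ← div_eq_mul_inv, div_le_iff₀ ht]
    exact D.upper i p hp) hψ.smooth
  exact ((frameD_r_inv D n).mul' h2 (add_zero (-1))).mul' h4 (add_zero (-1))

end

section

variable {T : ℝ} {η ψ : ℝ → ℝ}

theorem IsTimeCutoff.exists_bound (hη : IsTimeCutoff T η) :
    ∃ B, 0 ≤ B ∧ ∀ t, |η t| ≤ B := by
  obtain ⟨B, hB⟩ := isCompact_Icc.exists_bound_of_continuousOn (s := Set.Icc T (2 * T))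
    hη.smooth.continuous.continuousOn
  refine ⟨max |B| 1, by positivity, fun t => ?_⟩
  rcases le_or_gt t T with h | h
  · rw [hη.eq_zero t h, abs_zero]
    positivity
  · rcases le_or_gt (2 * T) t with h' | h'
    · rw [hη.eq_one t h', abs_one]
      exact le_max_right _ _
    · exact ((hB t ⟨h.le, h'.le⟩).trans (le_abs_self B)).trans (le_max_left _ _)

theorem IsConeCutoff.exists_bound (hψ : IsConeCutoff ψ) : ∃ B, 0 ≤ B ∧ ∀ z, |ψ z| ≤ B := by
  obtain ⟨B, hB⟩ := isCompact_Icc.exists_bound_of_continuousOn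
    (s := Set.Icc (1 / 2 : ℝ) (3 / 2)) hψ.smooth.continuous.continuousOn
  refine ⟨|B|, abs_nonneg B, fun z => ?_⟩
  by_cases h : z ∈ Set.Icc (1 / 2 : ℝ) (3 / 2)
  · exact (hB z h).trans (le_abs_self B)
  · rw [hψ.eq_zero z h, abs_zero]
    positivity

theorem exists_cutoff_bound (hη : IsTimeCutoff T η) (hψ : IsConeCutoff ψ) :
    ∃ K, 0 ≤ K ∧ ∀ p : Spacetime, 0 < p.1 → |cutoff η ψ p| ≤ K * p.1⁻¹ := by
  obtain ⟨B, hB, H⟩ := hη.exists_bound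
  obtain ⟨B', hB', H'⟩ := hψ.exists_bound
  refine ⟨2 * B * B', by positivity, fun p hp => ?_⟩
  by_cases h : ‖p.2‖ / p.1 ∈ Set.Icc (1 / 2 : ℝ) (3 / 2)
  · have h1 : p.1 ≤ 2 * ‖p.2‖ := by
      have := (le_div_iff₀ hp).1 h.1
      linarith
    have hr : 0 < ‖p.2‖ := by linarith
    have h2 : ‖p.2‖⁻¹ ≤ 2 * p.1⁻¹ := by
      field_simp
      linarith
    rw [cutoff, abs_mul, abs_mul, abs_of_pos (inv_pos.2 hr)]
    calc ‖p.2‖⁻¹ * |η p.1| * |ψ (‖p.2‖ / p.1)| ≤ 2 * p.1⁻¹ * B * B' := by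
          gcongr
          · exact H _
          · exact H' _
      _ = _ := by ring
  · rw [cutoff, hψ.eq_zero _ h, mul_zero, abs_zero]
    positivity

theorem cutoff_eventually_zero (hη : IsTimeCutoff T η) (hψ : IsConeCutoff ψ) {p : Spacetime}
    (h : p.1 < T ∨ 0 < p.1 ∧ (2 * ‖p.2‖ < p.1 ∨ 3 / 2 * p.1 < ‖p.2‖)) :
    cutoff η ψ =ᶠ[nhds p] 0 := by
  rcases h with h | ⟨ht, h | h⟩
  · filter_upwards [(isOpen_lt continuous_fst continuous_const).mem_nhds h] with x hx
    simp [cutoff, hη.eq_zero x.1 (le_of_lt hx)]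
  · filter_upwards [(isOpen_lt continuous_const continuous_fst).mem_nhds ht,
      (isOpen_lt (continuous_const.mul continuous_snd.norm) continuous_fst).mem_nhds h] with x hx hx'
    have : ‖x.2‖ / x.1 ∉ Set.Icc (1 / 2 : ℝ) (3 / 2) := fun hc => by
      have h1 := (le_div_iff₀ hx).1 hc.1
      change 2 * ‖x.2‖ < x.1 at hx'
      linarith
    simp [cutoff, hψ.eq_zero _ this]
  · filter_upwards [(isOpen_lt continuous_const continuous_fst).mem_nhds ht,
      (isOpen_lt (continuous_const.mul continuous_fst) continuous_snd.norm).mem_nhds h] with x hx hx'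
    have : ‖x.2‖ / x.1 ∉ Set.Icc (1 / 2 : ℝ) (3 / 2) := fun hc => by
      have h1 := (div_le_iff₀ hx).1 hc.2
      change 3 / 2 * x.1 < ‖x.2‖ at hx'
      linarith
    simp [cutoff, hψ.eq_zero _ this]

end

/-! ### Outside the wave zone -/

section

variable {e₀ : ℝ}

theorem frameD_slow (D : Cone e₀) (hθ : D.θ = 1) (he : e₀ ≤ 1) :
    (frameD D).Symbol 0 fun i p => i.ε * Real.log p.1 - i.δ := by
  have hs : (frameD D).Smooth fun i p => i.ε * Real.log p.1 - i.δ := fun i =>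
    (contDiffOn_const.mul (contDiffOn_fst.log fun p hp => (D.t_pos hp).ne')).sub contDiffOn_const
  refine fun n => Frame.Sym.intro hs ⟨2, zero_le_two, 1, fun i p hp => ?_⟩ fun m _ α => ?_
  · rw [zpow_zero, mul_one, pow_one]
    change _ ≤ 2 * p.1 ^ (D.θ * i.ε)
    have ht := D.t_pos hp
    have h1 := Real.log_nonneg (D.time i p hp)
    have h2 := (frameD D).one_le_W i p hp
    change 1 ≤ p.1 ^ (D.θ * i.ε) at h2
    have h3 := Real.log_le_self (zero_le_one.trans h2)
    rw [Real.log_rpow ht, hθ, one_mul] at h3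
    rw [hθ, one_mul] at h2 ⊢
    have h4 := mul_nonneg i.ε_pos.le h1
    have := i.δ_pos
    have := i.δ_lt
    rw [abs_le]
    constructor <;> linarith
  · refine (Frame.Sym.const (c := fun i : Idx e₀ => i.ε * (coordDir α).1) (M := |(coordDir α).1|)
      (fun i => ?_) m).congr fun i p hp => ?_
    · rw [abs_mul, abs_of_pos i.ε_pos]
      exact mul_le_of_le_one_left (abs_nonneg _) (i.ε_lt.le.trans he)
    · have ht := (D.t_pos hp).ne'
      have h := (((hasFDerivAt_fst (𝕜 := ℝ) (E := ℝ) (F := Space) (p := p)).log ht).const_mul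
        i.ε).sub_const i.δ
      refine (congrArg (fun L => L (p.1 • coordDir α)) h.fderiv).trans ?_
      simp only [smul_apply, ContinuousLinearMap.coe_fst', Prod.smul_fst, smul_eq_mul]
      field_simp

variable {R : ℝ}

/-- The first argument is frozen at `R`, as it may be for the profile where `q ≥ R`. A function of
`(s, ω)` alone is a symbol even for the fields `t ∂_α`, so every derivative gains `1/t`. -/
theorem frameD_comp (D : Cone e₀) (hθ : D.θ = 1) (he : e₀ ≤ 1) {f : Unit → ℝ × (ℝ × Space) → ℝ}
    (hf : ∀ n, (frameH R).Sym n 0 f) : (frameD D).Symbol 0 fun i p =>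
      f () (R, (i.ε * Real.log p.1 - i.δ, ‖p.2‖⁻¹ • p.2)) := fun n => by
  have hs := frameD_slow D hθ he
  refine Frame.Sym.comp (F' := frameH R) (e := cdir) (c := ccoord) (fun _ _ => rfl) ccoord_sum
    (σ := fun _ => ()) (φ := fun i (p : Spacetime) => (R, (i.ε * Real.log p.1 - i.δ, ‖p.2‖⁻¹ • p.2)))
    (fun i => contDiffOn_const.prodMk ((hs.smooth i).prodMk
      (contDiffOn_direction.mono fun p hp => D.x_ne hp))) (fun _ _ _ => trivial)
    (fun m _ j z => ?_) (fun C => ?_) (hf n)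
  · match j with
    | none => exact (frameD_const D (m + 1) R).der z
    | some none => exact (hs (m + 1)).der z
    | some (some k) => exact (frameD_om D (m + 1) k).der z
  · refine ⟨((1 + |R + R|) * Real.exp 1) ^ C, by positivity, C, fun i p hp => ?_⟩
    rw [zpow_zero, zpow_zero, one_mul, mul_one, ← mul_pow]
    refine pow_le_pow_left₀ (zero_le_one.trans ((frameH R).one_le_W () _ trivial)) ?_ C
    change (1 + |R + R|) * Real.exp |i.ε * Real.log p.1 - i.δ| ≤
      (1 + |R + R|) * Real.exp 1 * p.1 ^ (D.θ * i.ε)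
    rw [mul_assoc, Real.rpow_def_of_pos (D.t_pos hp), ← Real.exp_add, hθ]
    refine mul_le_mul_of_nonneg_left (Real.exp_le_exp.2 ?_) (by positivity)
    have h4 := mul_nonneg i.ε_pos.le (Real.log_nonneg (D.time i p hp))
    have := i.δ_pos
    have := i.δ_lt
    rw [abs_le]
    constructor <;> nlinarith

end

end QuasilinearWave

end

noncomputable section

namespace QuasilinearWave

/-! ### From symbols to pointwise bounds -/

theorem VField.act_const_mul (z : VField) (c : ℝ) (φ : Spacetime → ℝ) :
    z.act (fun p => c * φ p) = fun p => c * z.act φ p := by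
  funext p
  have h : (fun p => c * φ p) = c • φ := rfl
  rw [VField.act_eq, VField.act_eq, h, fderiv_const_smul_field]
  rfl

theorem pd_const_mul (α : Fin 4) (c : ℝ) (φ : Spacetime → ℝ) :
    pd α (fun p => c * φ p) = fun p => c * pd α φ p :=
  VField.act_const_mul (VField.translation α) c φ

theorem Zpow_const_mul (I : List VField) (c : ℝ) (φ : Spacetime → ℝ) :
    Zpow I (fun p => c * φ p) = fun p => c * Zpow I φ p := by
  induction I with
  | nil => rfl
  | cons z I ih =>
    change z.act (Zpow I _) = fun p => c * z.act (Zpow I φ) p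
    rw [ih, VField.act_const_mul]

theorem VField.act_congr (z : VField) {φ χ : Spacetime → ℝ} {p : Spacetime}
    (h : φ =ᶠ[nhds p] χ) : z.act φ =ᶠ[nhds p] z.act χ :=
  h.fderiv.mono fun x hx => by rw [VField.act_eq, VField.act_eq, hx]

theorem pd_eventuallyEq (α : Fin 4) {φ χ : Spacetime → ℝ} {p : Spacetime}
    (h : φ =ᶠ[nhds p] χ) : pd α φ =ᶠ[nhds p] pd α χ :=
  VField.act_congr (VField.translation α) h

theorem Zpow_congr (I : List VField) {φ χ : Spacetime → ℝ} {p : Spacetime}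
    (h : φ =ᶠ[nhds p] χ) : Zpow I φ =ᶠ[nhds p] Zpow I χ := by
  induction I with
  | nil => exact h
  | cons z I ih => exact z.act_congr ih

theorem VField.act_zero (z : VField) : z.act (0 : Spacetime → ℝ) = 0 := by
  funext p
  rw [VField.act_eq, fderiv_zero]
  rfl

theorem Zpow_zero (I : List VField) : Zpow I (0 : Spacetime → ℝ) = 0 := by
  induction I with
  | nil => rfl
  | cons z I ih =>
    change z.act (Zpow I _) = 0
    rw [ih, VField.act_zero]

section

variable {e₀ : ℝ} {D : Cone e₀} {F : Idx e₀ → Spacetime → ℝ} {k : ℤ}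

theorem Frame.Symbol.Zpow (hF : (frameZ D).Symbol k F) (I : List VField) :
    (frameZ D).Symbol k fun i => QuasilinearWave.Zpow I (F i) := by
  induction I with
  | nil => exact hF
  | cons z I ih => exact (ih.der z).congr fun i p _ => VField.act_eq z _ p

theorem Frame.Symbol.bound (hθ : D.θ = 1) (hF : (frameZ D).Symbol k F) :
    ∃ K C : ℝ, 0 ≤ K ∧ 0 ≤ C ∧ ∀ i, ∀ p ∈ D.dom i, |F i p| ≤ K * p.1 ^ ((k : ℝ) + C * i.ε) := by
  obtain ⟨K, hK, C, H⟩ := (hF 0).bd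
  refine ⟨K, C, hK, Nat.cast_nonneg C, fun i p hp => (H i p hp).trans (le_of_eq ?_)⟩
  change K * p.1 ^ k * (p.1 ^ (D.θ * i.ε)) ^ C = _
  have ht := D.t_pos hp
  rw [hθ, one_mul, Real.rpow_add ht, Real.rpow_intCast, mul_assoc, ← Real.rpow_natCast,
    ← Real.rpow_mul ht.le, mul_comm i.ε]

end

theorem rpow_shift {t k c : ℝ} (ht : 1 ≤ t) (hk : k ≤ 0) (hc : 0 ≤ c) :
    t ^ (k + c) ≤ 2 ^ (-k) * (1 + t) ^ (k + c) := by
  have h0 : 0 < t := by linarith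
  rw [Real.rpow_add h0, Real.rpow_add (by linarith)]
  have h1 : t ^ k ≤ 2 ^ (-k) * (1 + t) ^ k := by
    have h2 := Real.rpow_le_rpow_of_nonpos (by linarith : 0 < (1 + t) / 2)
      (by linarith : (1 + t) / 2 ≤ t) hk
    refine h2.trans (le_of_eq ?_)
    rw [Real.div_rpow (by linarith) zero_le_two, Real.rpow_neg zero_le_two, div_eq_inv_mul]
  have h3 : t ^ c ≤ (1 + t) ^ c := Real.rpow_le_rpow h0.le (by linarith) hc
  calc t ^ k * t ^ c ≤ 2 ^ (-k) * (1 + t) ^ k * (1 + t) ^ c :=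
        mul_le_mul h1 h3 (Real.rpow_nonneg h0.le _) (by positivity)
    _ = _ := by ring

namespace NearG

open Near

variable {R : ℝ} {b : ℝ × Space → ℝ} {hb : IsCoeff R b} {g : Fin 4 → Fin 4 → ℝ → ℝ}
  (N : NearG hb g)

/-! ### The region outside the wave zone -/

/-- The points of a cone around the light cone with `q > R`. -/
def farRegion (i : Idx N.e₀) : Set Spacetime :=
  {p | (N.T₁ < p.1 ∧ p.1 < 4 * ‖p.2‖ ∧ ‖p.2‖ < 2 * p.1) ∧ R < N.q i p}

theorem q_continuousAt (i : Idx N.e₀) {p : Spacetime} (ht : 0 < p.1) (hx : p.2 ≠ 0) :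
    ContinuousAt (N.q i) p :=
  ((hb.half_quadG_mul g).optical_smooth i.ε i.δ).continuousOn.continuousAt
    (((isOpen_lt continuous_const continuous_fst).inter
      (isOpen_ne_fun continuous_snd continuous_const)).mem_nhds ⟨ht, hx⟩)

theorem farRegion_isOpen (i : Idx N.e₀) : IsOpen (N.farRegion i) := by
  rw [isOpen_iff_mem_nhds]
  rintro p ⟨⟨h1, h2, h3⟩, h4⟩
  have ht : 0 < p.1 := one_pos.trans_le (N.one_le.trans h1.le)
  have hx : p.2 ≠ 0 := fun h => by
    rw [h, norm_zero] at h2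
    linarith
  filter_upwards [(isOpen_lt continuous_const continuous_fst).mem_nhds h1,
    (isOpen_lt continuous_fst (continuous_const.mul continuous_snd.norm)).mem_nhds h2,
    (isOpen_lt continuous_snd.norm (continuous_const.mul continuous_fst)).mem_nhds h3,
    (N.q_continuousAt i ht hx).eventually (lt_mem_nhds h4)] with x h1 h2 h3 h4
  exact ⟨⟨h1, h2, h3⟩, h4⟩

/-- The region outside the wave zone. -/
def farCone : Cone N.e₀ where
  θ := 1
  θ_nonneg := zero_le_one
  dom := N.farRegion
  isOpen := N.farRegion_isOpen
  time _ _ hp := N.one_le.trans hp.1.1.le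
  lower _ _ hp := hp.1.2.1.le
  upper _ _ hp := hp.1.2.2.le

theorem symbol_U_far : (frameD N.farCone).Symbol 0 N.U :=
  (frameD_comp N.farCone rfl N.e₀_le fun n => frameH_prof n (hb.half_quadG_mul g) hb).congr
    fun _ _ hp => prof_of_ge hb (hb.half_quadG_mul g) (le_of_lt hp.2) _

/-! ### The approximate solution -/

variable (η ψ : ℝ → ℝ)

/-- The approximate solution, divided by `ε`. -/
def v (i : Idx N.e₀) (p : Spacetime) : ℝ := cutoff η ψ p * N.U i p

variable {η ψ} {T : ℝ}

theorem symbol_v_far (hη : IsTimeCutoff T η) (hψ : IsConeCutoff ψ) :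
    (frameD N.farCone).Symbol (-1) (N.v η ψ) :=
  (symbol_cutoff N.farCone hη hψ).mul N.symbol_U_far (add_zero (-1))

/-- In the near region `ψ = 1`, so the difference is `(η - 1) U/r`; it vanishes for `t ≥ 2T` and
could be given any degree. -/
theorem symbol_v_sub_far (hη : IsTimeCutoff T η) (hψ : IsConeCutoff ψ) :
    (frameZ N.cone).Symbol (-3) fun i p => N.v η ψ i p - N.far i p := by
  have h1 := (symbol_time_bump N.cone (h := fun t => η t - 1) (S := 2 * T)
    (hη.smooth.sub contDiff_const) (fun t ht => by rw [hη.eq_one t ht, sub_self]) (-2)).ofD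
  refine (((symbol_ri N).mul h1 (by norm_num)).mul (symbol_U N) (add_zero (-3))).congr
    fun i p hp => ?_
  have h2 := geometry hp
  have ht := N.cone.t_pos hp
  have h3 : ψ (‖p.2‖ / p.1) = 1 := hψ.eq_one _ ⟨(le_div_iff₀ ht).2 h2.1, (div_le_iff₀ ht).2 h2.2.1⟩
  rw [v, cutoff, h3, far, ri]
  ring

theorem symbol_v (hη : IsTimeCutoff T η) (hψ : IsConeCutoff ψ) :
    (frameZ N.cone).Symbol (-1) (N.v η ψ) :=
  (((N.symbol_v_sub_far hη hψ).weakenZ (by norm_num : (-3 : ℤ) ≤ -1)).add (symbol_far N)).congr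
    fun i p _ => by ring

/-- The quasilinear operator applied to the approximate solution, divided by `ε`. -/
def err (η ψ : ℝ → ℝ) (i : Idx N.e₀) (p : Spacetime) : ℝ :=
  ∑ α, ∑ β, g α β (i.ε * N.v η ψ i p) * pd α (pd β (N.v η ψ i)) p

theorem exists_v_bound (hη : IsTimeCutoff T η) (hψ : IsConeCutoff ψ) :
    ∃ M, ∀ i, ∀ p ∈ {p : Spacetime | 1 ≤ p.1}, |i.ε * N.v η ψ i p| ≤ M := by
  obtain ⟨K, hK, H⟩ := exists_cutoff_bound hη hψ
  exact exists_mul_U_bound N hK (S := fun _ => {p : Spacetime | 1 ≤ p.1}) (fun i p hp => hp)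
    fun i p hp => H p (one_pos.trans_le hp)

theorem symbol_err (hg : IsWaveMetric g) (hη : IsTimeCutoff T η) (hψ : IsConeCutoff ψ) :
    (frameZ N.cone).Symbol (-3) (N.err η ψ) := by
  obtain ⟨M, hM⟩ := N.exists_v_bound hη hψ
  exact N.symbol_waveOp hg (N.symbol_v_sub_far hη hψ) fun i p hp => hM i p (t_ge hp)

/-- No cancellation is involved: two coordinate derivatives take degree `-1` to degree `-3`, and the
coefficients are bounded. -/
theorem symbol_err_far (hg : IsWaveMetric g) (hη : IsTimeCutoff T η) (hψ : IsConeCutoff ψ) :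
    (frameZ N.farCone).Symbol (-3) (N.err η ψ) := by
  obtain ⟨M, hM⟩ := N.exists_v_bound hη hψ
  have hv := N.symbol_v_far hη hψ
  have hεv : (frameZ N.farCone).Symbol (-1) fun i p => i.ε * N.v η ψ i p := fun n =>
    (hv.ofD n).const_mul (c := fun i : Idx N.e₀ => i.ε)
      fun i => Idx.abs_ε_le (P := N.toParams) i
  exact Frame.Symbol.sum (s := Finset.univ) fun α => Frame.Symbol.sum (s := Finset.univ) fun β =>
    (hεv.comp_bounded (fun i p hp => hM i p (N.farCone.time i p hp)) (hg.smooth α β)).mul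
      ((hv.pdD (l := -2) (by norm_num) β).pdD (l := -3) (by norm_num) α).ofD (zero_add (-3))

/-- Within the support of the cutoffs either `|q| < R + 1`, or `q > R`, or `q < -R`, and in the last
case the profile vanishes nearby. The gap between `R` and `R + 1` makes the open regions overlap, so
local statements hold at every point. -/
theorem v_cover (hη : IsTimeCutoff T η) (hψ : IsConeCutoff ψ) (hT : N.T₁ < T) (i : Idx N.e₀)
    (p : Spacetime) : p ∈ N.region i ∨ p ∈ N.farRegion i ∨ N.v η ψ i =ᶠ[nhds p] 0 := by
  have hcut : ∀ h : cutoff η ψ =ᶠ[nhds p] 0, N.v η ψ i =ᶠ[nhds p] 0 := fun h =>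
    h.mono fun x hx => by
      rw [v, hx]
      exact zero_mul _
  rcases lt_or_ge p.1 T with ht | ht
  · exact Or.inr (Or.inr (hcut (cutoff_eventually_zero hη hψ (Or.inl ht))))
  have ht0 : 0 < p.1 := by linarith [N.one_le]
  rcases lt_or_ge (2 * ‖p.2‖) p.1 with hr | hr
  · exact Or.inr (Or.inr (hcut (cutoff_eventually_zero hη hψ (Or.inr ⟨ht0, Or.inl hr⟩))))
  rcases lt_or_ge (3 / 2 * p.1) ‖p.2‖ with hr' | hr'
  · exact Or.inr (Or.inr (hcut (cutoff_eventually_zero hη hψ (Or.inr ⟨ht0, Or.inr hr'⟩))))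
  have hx : p.2 ≠ 0 := norm_pos_iff.1 (by linarith)
  rcases lt_or_ge |N.q i p| (R + 1) with hq | hq
  · exact Or.inl ⟨⟨by linarith, hx⟩, hq⟩
  rcases le_abs.1 hq with hq | hq
  · exact Or.inr (Or.inl ⟨⟨by linarith, by linarith, by linarith⟩, by linarith⟩)
  · refine Or.inr (Or.inr ?_)
    filter_upwards [(N.q_continuousAt i ht0 hx).eventually (gt_mem_nhds (by linarith : N.q i p < -R))]
      with x hx
    have : N.U i x = 0 := prof_of_le hb (le_of_lt hx) _
    rw [v, this, mul_zero]
    rfl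

theorem err_cover (hη : IsTimeCutoff T η) (hψ : IsConeCutoff ψ) (hT : N.T₁ < T) (i : Idx N.e₀)
    (p : Spacetime) : p ∈ N.region i ∨ p ∈ N.farRegion i ∨ N.err η ψ i =ᶠ[nhds p] 0 := by
  refine (N.v_cover hη hψ hT i p).imp id (Or.imp id fun h => ?_)
  have h1 : ∀ᶠ x in nhds p, ∀ α β, pd α (pd β (N.v η ψ i)) x = 0 :=
    Filter.eventually_all.2 fun α => Filter.eventually_all.2 fun β =>
      (Zpow_congr [VField.translation α, VField.translation β] h).mono fun x hx => by
        rw [Zpow_zero] at hx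
        exact hx
  filter_upwards [h1] with x hx
  simp [err, hx]

theorem cover_bound {F : Idx N.e₀ → Spacetime → ℝ} {k : ℤ} (hk : k ≤ 0)
    (h1 : (frameZ N.cone).Symbol k F) (h2 : (frameZ N.farCone).Symbol k F)
    (h3 : ∀ i p, p ∈ N.region i ∨ p ∈ N.farRegion i ∨ F i =ᶠ[nhds p] 0) (I : List VField) :
    ∃ K C : ℝ, 0 ≤ K ∧ 0 ≤ C ∧ ∀ i, ∀ p : Spacetime, 0 ≤ p.1 →
      |Zpow I (F i) p| ≤ K * (1 + p.1) ^ ((k : ℝ) + C * i.ε) := by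
  obtain ⟨K₁, C₁, hK₁, hC₁, H₁⟩ := (h1.Zpow I).bound rfl
  obtain ⟨K₂, C₂, hK₂, hC₂, H₂⟩ := (h2.Zpow I).bound rfl
  have hk' : (k : ℝ) ≤ 0 := by exact_mod_cast hk
  refine ⟨(K₁ + K₂) * 2 ^ (-(k : ℝ)), C₁ + C₂, by positivity, by positivity, fun i p hp => ?_⟩
  have key : ∀ K C : ℝ, 0 ≤ K → 0 ≤ C → K ≤ K₁ + K₂ → C ≤ C₁ + C₂ → 1 ≤ p.1 →
      |Zpow I (F i) p| ≤ K * p.1 ^ ((k : ℝ) + C * i.ε) →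
      |Zpow I (F i) p| ≤ (K₁ + K₂) * 2 ^ (-(k : ℝ)) * (1 + p.1) ^ ((k : ℝ) + (C₁ + C₂) * i.ε) := by
    intro K C hK hC hK' hC' ht H
    refine H.trans ?_
    have h4 := rpow_shift ht hk' (mul_nonneg hC i.ε_pos.le)
    have h5 : (1 + p.1) ^ ((k : ℝ) + C * i.ε) ≤ (1 + p.1) ^ ((k : ℝ) + (C₁ + C₂) * i.ε) := by
      refine Real.rpow_le_rpow_of_exponent_le (by linarith) ?_
      have := mul_le_mul_of_nonneg_right hC' i.ε_pos.le
      linarith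
    calc K * p.1 ^ ((k : ℝ) + C * i.ε)
        ≤ (K₁ + K₂) * (2 ^ (-(k : ℝ)) * (1 + p.1) ^ ((k : ℝ) + (C₁ + C₂) * i.ε)) := by
          refine mul_le_mul hK' (h4.trans ?_) (by positivity) (by positivity)
          gcongr
      _ = _ := by ring
  rcases h3 i p with h | h | h
  · exact key K₁ C₁ hK₁ hC₁ (by linarith) (by linarith) (N.cone.time i p h) (H₁ i p h)
  · exact key K₂ C₂ hK₂ hC₂ (by linarith) (by linarith) (N.farCone.time i p h) (H₂ i p h)
  · have h4 := (Zpow_congr I h).eq_of_nhds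
    rw [Zpow_zero] at h4
    rw [h4]
    simp only [Pi.zero_apply, abs_zero]
    positivity

end NearG

end QuasilinearWave

end

noncomputable section

namespace QuasilinearWave

namespace NearG

open Near

variable {R : ℝ} {b : ℝ × Space → ℝ} {hb : IsCoeff R b} {g : Fin 4 → Fin 4 → ℝ → ℝ}
  (N : NearG hb g)

/-! ### First derivatives -/

/-- Only the `B`-part of `∂_α` fails to gain `1/t`, and there the leading term is `-2A`. The main
part of the gradient is thus `ω̂_α A`, bounded without any power of the weight. -/
theorem symbol_pd_U (α : Fin 4) : (frameZ N.cone).Symbol (-1) fun i p =>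
    pd α (N.U i) p - omHat α p * N.β i p := by
  have h1 := symbol_ε_mul (symbol_ti.mul (symbol_U' N) (add_zero (-1)))
  refine (((symbol_U N).opT (l := -1) (by norm_num) α).add
    (((symbol_omHat N.cone α).mul h1 (zero_add (-1))).real_mul (-(1 / 2)))).congr fun i p hp => ?_
  rw [pd_eq α (N.U i) p, opB_U hp]
  ring

theorem abs_omHat_le (α : Fin 4) (p : Spacetime) : |omHat α p| ≤ 1 := by
  refine Fin.cases ?_ (fun k => ?_) α
  · rw [omHat_zero, abs_neg, abs_one]
  · rw [omHat_succ]
    refine (PiLp.norm_apply_le (‖p.2‖⁻¹ • p.2) k).trans ?_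
    rw [norm_smul, norm_inv, norm_norm]
    exact inv_mul_le_one

/-- Under `C ε ≤ 1` the error `t^{-1 + Cε}` is bounded. The constants concern `U` only and not the
cutoffs, so `ε₀` can be fixed before `T`, `η` and `ψ`. -/
theorem exists_pd_U_bound : ∃ C K : ℝ, 0 ≤ C ∧ 0 ≤ K ∧ ∀ i : Idx N.e₀, C * i.ε ≤ 1 →
    ∀ p, p ∈ N.region i ∨ p ∈ N.farRegion i → ∀ α, |pd α (N.U i) p| ≤ K := by
  obtain ⟨B, hB⟩ := hb.compact.exists_bound_of_continuous hb.smooth.continuous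
  have hB0 : 0 ≤ B := (norm_nonneg _).trans (hB 0)
  choose K₁ C₁ hK₁ hC₁ H₁ using fun α => (N.symbol_pd_U α).bound rfl
  choose K₂ C₂ hK₂ hC₂ H₂ using fun α =>
    ((N.symbol_U_far.pdD (l := -1) (by norm_num) α).ofD).bound rfl
  have sum_le : ∀ (f : Fin 4 → ℝ), (∀ α, 0 ≤ f α) → ∀ α, f α ≤ ∑ α, f α := fun f hf α =>
    Finset.single_le_sum (fun β _ => hf β) (Finset.mem_univ α)
  have hdecay : ∀ (i : Idx N.e₀) (t C : ℝ), 1 ≤ t → C * i.ε ≤ 1 →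
      t ^ (((-1 : ℤ) : ℝ) + C * i.ε) ≤ 1 := fun i t C ht hC =>
    Real.rpow_le_one_of_one_le_of_nonpos ht (by push_cast; linarith)
  refine ⟨∑ α, C₁ α + ∑ α, C₂ α, B + ∑ α, K₁ α + ∑ α, K₂ α,
    add_nonneg (Finset.sum_nonneg fun α _ => hC₁ α) (Finset.sum_nonneg fun α _ => hC₂ α),
    add_nonneg (add_nonneg hB0 (Finset.sum_nonneg fun α _ => hK₁ α))
      (Finset.sum_nonneg fun α _ => hK₂ α), fun i hi p hp α => ?_⟩
  have s1 := Finset.sum_nonneg fun α (_ : α ∈ Finset.univ) => hC₁ α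
  have s2 := Finset.sum_nonneg fun α (_ : α ∈ Finset.univ) => hC₂ α
  have s3 := Finset.sum_nonneg fun α (_ : α ∈ Finset.univ) => hK₁ α
  have s4 := Finset.sum_nonneg fun α (_ : α ∈ Finset.univ) => hK₂ α
  rcases hp with hp | hp
  · have h1 := H₁ α i p hp
    have h2 := hdecay i p.1 (C₁ α) (t_ge hp) ((mul_le_mul_of_nonneg_right
      (by linarith [sum_le C₁ hC₁ α]) i.ε_pos.le).trans hi)
    have h3 := mul_le_mul_of_nonneg_left h2 (hK₁ α)
    have h4 : |omHat α p * N.β i p| ≤ B := by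
      rw [abs_mul]
      exact (mul_le_mul (abs_omHat_le α p) (hB _) (abs_nonneg _) zero_le_one).trans_eq (one_mul B)
    have h5 := abs_add_le (pd α (N.U i) p - omHat α p * N.β i p) (omHat α p * N.β i p)
    rw [sub_add_cancel] at h5
    linarith [sum_le K₁ hK₁ α]
  · have h1 := H₂ α i p hp
    have h2 := hdecay i p.1 (C₂ α) (N.farCone.time i p hp) ((mul_le_mul_of_nonneg_right
      (by linarith [sum_le C₂ hC₂ α]) i.ε_pos.le).trans hi)
    have h3 := mul_le_mul_of_nonneg_left h2 (hK₂ α)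
    linarith [sum_le K₂ hK₂ α]

/-- A cone around the light cone, with trivial weights. -/
def wideCone : Cone N.e₀ where
  θ := 0
  θ_nonneg := le_rfl
  dom _ := {p | N.T₁ < p.1 ∧ p.1 < 4 * ‖p.2‖ ∧ ‖p.2‖ < 2 * p.1}
  isOpen _ := (isOpen_lt continuous_const continuous_fst).inter
    ((isOpen_lt continuous_fst (continuous_const.mul continuous_snd.norm)).inter
      (isOpen_lt continuous_snd.norm (continuous_const.mul continuous_fst)))
  time _ _ hp := N.one_le.trans hp.1.le
  lower _ _ hp := hp.2.1.le
  upper _ _ hp := hp.2.2.le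

variable {η ψ : ℝ → ℝ} {T : ℝ}

theorem exists_pd_cutoff_bound (hη : IsTimeCutoff T η) (hψ : IsConeCutoff ψ) :
    ∃ K : ℝ, 0 ≤ K ∧ ∀ i : Idx N.e₀, ∀ p ∈ N.wideCone.dom i, ∀ α,
      |pd α (cutoff η ψ) p| ≤ K * p.1 ^ (-2 : ℤ) := by
  choose K hK C H using fun α =>
    ((symbol_cutoff N.wideCone hη hψ).pdD (l := -2) (by norm_num) α 0).bd
  refine ⟨∑ α, K α, Finset.sum_nonneg fun α _ => hK α, fun i p hp α => ?_⟩
  have h := H α i p hp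
  have e : (frameD N.wideCone).W i p = 1 := by
    change p.1 ^ (0 * i.ε) = 1
    rw [zero_mul, Real.rpow_zero]
  rw [e, one_pow, mul_one] at h
  refine h.trans (mul_le_mul_of_nonneg_right ?_ (zpow_pos (N.wideCone.t_pos hp) _).le)
  exact Finset.single_le_sum (fun β _ => hK β) (Finset.mem_univ α)

theorem mem_wideCone {i : Idx N.e₀} {p : Spacetime} (hp : p ∈ N.region i ∨ p ∈ N.farRegion i) :
    p ∈ N.wideCone.dom i := by
  rcases hp with hp | hp
  · have h := geometry hp
    have ht := t_ge hp
    exact ⟨hp.1.1, by linarith [h.1], by linarith [h.2.1]⟩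
  · exact hp.1

theorem pd_v {i : Idx N.e₀} {p : Spacetime} (hη : IsTimeCutoff T η) (hψ : IsConeCutoff ψ)
    (hp : p ∈ N.region i ∨ p ∈ N.farRegion i) (α : Fin 4) : pd α (N.v η ψ i) p =
      cutoff η ψ p * pd α (N.U i) p + pd α (cutoff η ψ) p * N.U i p := by
  rcases hp with hp | hp
  · exact pd_mul (D := N.cone) (f := fun _ => cutoff η ψ) (symbol_cutoff N.cone hη hψ).ofD.smooth
      (symbol_U N).smooth α hp
  · exact pd_mul (D := N.farCone) (f := fun _ => cutoff η ψ)
      (symbol_cutoff N.farCone hη hψ).ofD.smooth N.symbol_U_far.ofD.smooth α hp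

/-- A derivative falling on the profile costs nothing and keeps the decay `1/t` of the cutoff. A
derivative falling on the cutoff gives `t⁻²`, which outweighs the growth `t^{1/2}` of the profile.
-/
theorem exists_pd_v_bound {C K : ℝ} (hK : 0 ≤ K) (hU : ∀ i : Idx N.e₀, C * i.ε ≤ 1 →
      ∀ p, p ∈ N.region i ∨ p ∈ N.farRegion i → ∀ α, |pd α (N.U i) p| ≤ K)
    (hη : IsTimeCutoff T η) (hψ : IsConeCutoff ψ) (hT : N.T₁ < T) :
    ∃ K' : ℝ, ∀ i : Idx N.e₀, C * i.ε ≤ 1 → ∀ p : Spacetime, T ≤ p.1 → ∀ α,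
      |pd α (N.v η ψ i) p| ≤ K' * (1 + p.1)⁻¹ := by
  obtain ⟨K₁, hK₁, H₁⟩ := exists_cutoff_bound hη hψ
  obtain ⟨K₂, hK₂, H₂⟩ := N.exists_pd_cutoff_bound hη hψ
  obtain ⟨B, hB, H₃⟩ := N.exists_U_bound
  refine ⟨2 * (K₁ * K + K₂ * B), fun i hi p hp α => ?_⟩
  have ht1 : 1 ≤ p.1 := N.one_le.trans (hT.le.trans hp)
  have ht : 0 < p.1 := one_pos.trans_le ht1
  have main : p ∈ N.region i ∨ p ∈ N.farRegion i →
      |pd α (N.v η ψ i) p| ≤ 2 * (K₁ * K + K₂ * B) * (1 + p.1)⁻¹ := by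
    intro h
    have h1 := H₁ p ht
    have h2 := hU i hi p h α
    have h3 := H₂ i p (N.mem_wideCone h) α
    have h4 := H₃ i p ht1
    have h5 : p.1 ^ (-2 : ℤ) * p.1 ^ (1 / 2 : ℝ) ≤ p.1⁻¹ := by
      rw [← Real.rpow_intCast, ← Real.rpow_add ht, ← Real.rpow_neg_one]
      exact Real.rpow_le_rpow_of_exponent_le ht1 (by norm_num)
    have h6 : p.1⁻¹ ≤ 2 * (1 + p.1)⁻¹ := by
      field_simp
      linarith
    rw [N.pd_v hη hψ h α]
    calc |cutoff η ψ p * pd α (N.U i) p + pd α (cutoff η ψ) p * N.U i p|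
        ≤ |cutoff η ψ p| * |pd α (N.U i) p| + |pd α (cutoff η ψ) p| * |N.U i p| := by
          rw [← abs_mul, ← abs_mul]
          exact abs_add_le _ _
      _ ≤ K₁ * p.1⁻¹ * K + K₂ * p.1 ^ (-2 : ℤ) * (B * p.1 ^ (1 / 2 : ℝ)) := by gcongr
      _ = K₁ * K * p.1⁻¹ + K₂ * B * (p.1 ^ (-2 : ℤ) * p.1 ^ (1 / 2 : ℝ)) := by ring
      _ ≤ K₁ * K * (2 * (1 + p.1)⁻¹) + K₂ * B * (2 * (1 + p.1)⁻¹) := by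
          exact add_le_add (mul_le_mul_of_nonneg_left h6 (mul_nonneg hK₁ hK))
            (mul_le_mul_of_nonneg_left (h5.trans h6) (mul_nonneg hK₂ hB))
      _ = _ := by ring
  rcases N.v_cover hη hψ hT i p with h | h | h
  · exact main (Or.inl h)
  · exact main (Or.inr h)
  · have h4 : pd α (N.v η ψ i) p = 0 := by
      have h5 := (Zpow_congr [VField.translation α] h).eq_of_nhds
      rw [Zpow_zero] at h5
      exact h5
    rw [h4, abs_zero]
    positivity

/-! ### The approximate solution -/

theorem v_smooth (hη : IsTimeCutoff T η) (hψ : IsConeCutoff ψ) (hT : N.T₁ < T) (i : Idx N.e₀) :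
    ContDiff ℝ ∞ (N.v η ψ i) := by
  rw [contDiff_iff_contDiffAt]
  intro p
  rcases N.v_cover hη hψ hT i p with h | h | h
  · exact ((N.symbol_v hη hψ).smooth i).contDiffAt ((region_isOpen i).mem_nhds h)
  · exact ((N.symbol_v_far hη hψ).smooth i).contDiffAt ((N.farRegion_isOpen i).mem_nhds h)
  · exact (contDiffAt_const (c := (0 : ℝ))).congr_of_eventuallyEq h

variable {A : ℝ × Sphere2 → ℝ}

theorem profile_eq (hbA : ∀ p (θ : Sphere2), b (p, (θ : Space)) = A (p, θ)) (i : Idx N.e₀)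
    {q : ℝ → ℝ → Sphere2 → ℝ} (hq : IsOptical g A i.ε i.δ q) {p : Spacetime} (ht : 0 < p.1)
    (hx : p.2 ≠ 0) :
    profile g A (i.ε * Real.log p.1 - i.δ) (qCart q p) (dir p.2) = N.U i p := by
  rw [profile_eq_prof hb hbA, hq.qCart_eq hb hbA ht hx, coe_dir hx]
  rfl

theorem uApp_eq (hbA : ∀ p (θ : Sphere2), b (p, (θ : Space)) = A (p, θ)) (hη : IsTimeCutoff T η)
    (hT : 0 < T) (i : Idx N.e₀) {q : ℝ → ℝ → Sphere2 → ℝ} (hq : IsOptical g A i.ε i.δ q) :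
    uApp g A η ψ i.ε i.δ q = fun p => i.ε * N.v η ψ i p := by
  funext p
  rw [uApp, v, cutoff]
  rcases le_or_gt p.1 T with ht | ht
  · simp [hη.eq_zero _ ht]
  · by_cases hx : p.2 = 0
    · simp [hx]
    · rw [N.profile_eq hbA i hq (hT.trans ht) hx]
      ring

theorem waveOp_eq (i : Idx N.e₀) :
    waveOp g (fun p => i.ε * N.v η ψ i p) = fun p => i.ε * N.err η ψ i p := by
  funext p
  simp only [waveOp, err, pd_const_mul, Finset.mul_sum]
  refine Finset.sum_congr rfl fun α _ => Finset.sum_congr rfl fun β _ => ?_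
  ring

theorem farField_eq (hbA : ∀ p (θ : Sphere2), b (p, (θ : Space)) = A (p, θ)) (i : Idx N.e₀)
    {q : ℝ → ℝ → Sphere2 → ℝ} (hq : IsOptical g A i.ε i.δ q) {p : Spacetime} (ht : 0 < p.1)
    (hx : p.2 ≠ 0) : farField g A i.ε i.δ q p = i.ε * N.far i p := by
  rw [farField, N.profile_eq hbA i hq ht hx, mul_assoc]
  rfl

theorem pd_qCart (hbA : ∀ p (θ : Sphere2), b (p, (θ : Space)) = A (p, θ)) (i : Idx N.e₀)
    {q : ℝ → ℝ → Sphere2 → ℝ} (hq : IsOptical g A i.ε i.δ q) {p : Spacetime} (ht : 0 < p.1)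
    (hx : p.2 ≠ 0) (α : Fin 4) : pd α (qCart q) p = pd α (N.q i) p := by
  refine (pd_eventuallyEq α ?_).eq_of_nhds
  filter_upwards [((isOpen_lt continuous_const continuous_fst).inter
    (isOpen_ne_fun continuous_snd continuous_const)).mem_nhds (⟨ht, hx⟩ :
      p ∈ {p : Spacetime | 0 < p.1} ∩ {p | p.2 ≠ 0})] with x hx
  exact hq.qCart_eq hb hbA hx.1 hx.2

end NearG

end QuasilinearWave

/-! ### Choice of constants and conclusion. -/

theorem mainTheorem2
    (g : Fin 4 → Fin 4 → ℝ → ℝ) (hg : QuasilinearWave.IsWaveMetric g)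
    (A : ℝ × QuasilinearWave.Sphere2 → ℝ) (hA : ContMDiff (𝓘(ℝ, ℝ).prod (𝓡 2)) 𝓘(ℝ, ℝ) ∞ A)
    (R : ℝ) (hR : 1 ≤ R) (hsupp : tsupport A ⊆ Set.Icc (-R) R ×ˢ Set.univ) :
    ∃ T₀ : ℝ, 1 ≤ T₀ ∧ ∃ ε₀ : ℝ, 0 < ε₀ ∧
      -- the optical function exists, is unique and smooth
      (∀ ε δ : ℝ, 0 < ε → ε < ε₀ → 0 < δ → δ < 1 →
        (∃ q, QuasilinearWave.IsOptical g A ε δ q) ∧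
        (∀ q q₂, QuasilinearWave.IsOptical g A ε δ q → QuasilinearWave.IsOptical g A ε δ q₂ →
          ∀ t r θ, 0 < t → 0 ≤ r → q t r θ = q₂ t r θ) ∧
        (∀ q, QuasilinearWave.IsOptical g A ε δ q →
          ContDiffOn ℝ ∞ (QuasilinearWave.qCart q) {p | 0 < p.1 ∧ p.2 ≠ 0})) ∧
      ∀ T : ℝ, T₀ ≤ T → ∀ η ψ : ℝ → ℝ,
        QuasilinearWave.IsTimeCutoff T η → QuasilinearWave.IsConeCutoff ψ →
        -- smoothness of the approximate solution
        (∀ ε δ q, 0 < ε → ε < ε₀ → 0 < δ → δ < 1 → QuasilinearWave.IsOptical g A ε δ q →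
          ContDiff ℝ ∞ (QuasilinearWave.uApp g A η ψ ε δ q)) ∧
        -- the sharp bound on first derivatives
        (∃ C : ℝ, ∀ ε δ q, 0 < ε → ε < ε₀ → 0 < δ → δ < 1 →
          QuasilinearWave.IsOptical g A ε δ q →
          ∀ p : QuasilinearWave.Spacetime, T ≤ p.1 → ∀ α : Fin 4,
            |QuasilinearWave.pd α (QuasilinearWave.uApp g A η ψ ε δ q) p|
              ≤ C * ε * (1 + p.1)⁻¹) ∧
        -- bounds with commuting vector fields
        (∀ I : List QuasilinearWave.VField, ∃ K C : ℝ, ∀ ε δ q,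
          0 < ε → ε < ε₀ → 0 < δ → δ < 1 → QuasilinearWave.IsOptical g A ε δ q →
          ∀ p : QuasilinearWave.Spacetime, 0 ≤ p.1 →
            |QuasilinearWave.Zpow I (QuasilinearWave.uApp g A η ψ ε δ q) p|
              ≤ K * ε * (1 + p.1) ^ (-1 + C * ε) ∧
            |QuasilinearWave.Zpow I
                (QuasilinearWave.waveOp g (QuasilinearWave.uApp g A η ψ ε δ q)) p|
              ≤ K * ε * (1 + p.1) ^ (-3 + C * ε)) ∧
        -- the optical function is an approximate solution of the eikonal equation
        (∃ K C : ℝ, ∀ ε δ q, 0 < ε → ε < ε₀ → 0 < δ → δ < 1 →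
          QuasilinearWave.IsOptical g A ε δ q →
          ∀ p : QuasilinearWave.Spacetime, T ≤ p.1 → |QuasilinearWave.qCart q p| ≤ R →
            |∑ α, ∑ β, g α β (QuasilinearWave.farField g A ε δ q p) *
                QuasilinearWave.pd α (QuasilinearWave.qCart q) p *
                QuasilinearWave.pd β (QuasilinearWave.qCart q) p|
              ≤ K * p.1 ^ (-2 + C * ε)) := by
  obtain ⟨b, hb, hbA⟩ := QuasilinearWave.exists_extension hA hsupp
  obtain ⟨N⟩ : Nonempty (QuasilinearWave.NearG hb g) := QuasilinearWave.exists_near (hb.half_quadG_mul g) hR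
  obtain ⟨C₀, K₀, hC₀, hK₀, hU⟩ := N.exists_pd_U_bound
  have hN := N.one_le
  -- `T > T₁` brings the support of the cutoffs into the region where the estimates hold, and `T >
  -- R` excludes the axis, where `q = -t`, from `|q| ≤ R`. The second term of the minimum ensures
  -- `C₀ ε ≤ 1` for the loss-free gradient bound.
  refine ⟨N.T₁ + R + 1, by linarith, min N.e₀ (1 / (C₀ + 1)),
    lt_min N.e₀_pos (by positivity), fun ε δ hε _ _ _ => ⟨⟨_, QuasilinearWave.isOptical_flow hb hbA ε δ⟩, ?_, ?_⟩, ?_⟩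
  · intro q q₂ hq hq₂ t r θ ht hr
    rw [hq.eq_flow hb hbA ht hr, hq₂.eq_flow hb hbA ht hr]
  · intro q hq
    exact ((hb.half_quadG_mul g).optical_smooth ε δ).congr fun p hp =>
      hq.qCart_eq hb hbA hp.1 hp.2
  intro T hT η ψ hη hψ
  have hT₁ : N.T₁ < T := by linarith
  have hT0 : 0 < T := by linarith
  have hidx : ∀ {ε : ℝ}, ε < min N.e₀ (1 / (C₀ + 1)) → ε < N.e₀ := fun h =>
    h.trans_le (min_le_left _ _)
  refine ⟨?_, ?_, ?_, ?_⟩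
  · intro ε δ q hε hε' hδ hδ' hq
    let i : QuasilinearWave.Idx N.e₀ := ⟨ε, δ, hε, hidx hε', hδ, hδ'⟩
    rw [N.uApp_eq hbA hη hT0 i hq]
    exact contDiff_const.mul (N.v_smooth hη hψ hT₁ i)
  · obtain ⟨K, hK⟩ := N.exists_pd_v_bound hK₀ hU hη hψ hT₁
    refine ⟨K, fun ε δ q hε hε' hδ hδ' hq p hp α => ?_⟩
    let i : QuasilinearWave.Idx N.e₀ := ⟨ε, δ, hε, hidx hε', hδ, hδ'⟩
    have hi : C₀ * i.ε ≤ 1 := by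
      have h := (lt_div_iff₀ (by positivity)).1 (hε'.trans_le (min_le_right _ _))
      change C₀ * ε ≤ 1
      nlinarith
    rw [N.uApp_eq hbA hη hT0 i hq, QuasilinearWave.pd_const_mul]
    have h := mul_le_mul_of_nonneg_left (hK i hi p hp α) hε.le
    rw [abs_mul, abs_of_pos i.ε_pos]
    refine h.trans (le_of_eq ?_)
    ring
  · intro I
    obtain ⟨K₁, C₁, hK₁, hC₁, H₁⟩ := N.cover_bound (by norm_num : (-1 : ℤ) ≤ 0)
      (N.symbol_v hη hψ) (N.symbol_v_far hη hψ).ofD (N.v_cover hη hψ hT₁) I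
    obtain ⟨K₂, C₂, hK₂, hC₂, H₂⟩ := N.cover_bound (by norm_num : (-3 : ℤ) ≤ 0)
      (N.symbol_err hg hη hψ) (N.symbol_err_far hg hη hψ) (N.err_cover hη hψ hT₁) I
    refine ⟨K₁ + K₂, C₁ + C₂, fun ε δ q hε hε' hδ hδ' hq p hp => ?_⟩
    let i : QuasilinearWave.Idx N.e₀ := ⟨ε, δ, hε, hidx hε', hδ, hδ'⟩
    rw [N.uApp_eq hbA hη hT0 i hq, N.waveOp_eq, QuasilinearWave.Zpow_const_mul, QuasilinearWave.Zpow_const_mul, abs_mul, abs_mul,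
      abs_of_pos i.ε_pos]
    have key : ∀ K C k X : ℝ, 0 ≤ K → K ≤ K₁ + K₂ → C ≤ C₁ + C₂ →
        X ≤ K * (1 + p.1) ^ (k + C * ε) →
        ε * X ≤ (K₁ + K₂) * ε * (1 + p.1) ^ (k + (C₁ + C₂) * ε) := by
      intro K C k X hK hK' hC' h
      have h1 : (1 + p.1) ^ (k + C * ε) ≤ (1 + p.1) ^ (k + (C₁ + C₂) * ε) := by
        refine Real.rpow_le_rpow_of_exponent_le (by linarith) ?_
        have := mul_le_mul_of_nonneg_right hC' hε.le
        linarith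
      calc ε * X ≤ ε * (K * (1 + p.1) ^ (k + C * ε)) := by gcongr
        _ ≤ ε * ((K₁ + K₂) * (1 + p.1) ^ (k + (C₁ + C₂) * ε)) := by gcongr
        _ = _ := by ring
    have h1 := H₁ i p hp
    have h2 := H₂ i p hp
    push_cast at h1 h2
    exact ⟨key K₁ C₁ (-1) _ hK₁ (by linarith) (by linarith) h1,
      key K₂ C₂ (-3) _ hK₂ (by linarith) (by linarith) h2⟩
  · obtain ⟨K, C, hK, hC, H⟩ := (N.symbol_eikonal hg).bound rfl
    refine ⟨K, C, fun ε δ q hε hε' hδ hδ' hq p hp hqR => ?_⟩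
    let i : QuasilinearWave.Idx N.e₀ := ⟨ε, δ, hε, hidx hε', hδ, hδ'⟩
    have ht : 0 < p.1 := by linarith
    have hx : p.2 ≠ 0 := fun hx => by
      rw [QuasilinearWave.qCart, hx, norm_zero, hq.boundary _ _ ht, abs_neg, abs_of_pos ht] at hqR
      linarith
    have hmem : p ∈ N.region i := by
      refine ⟨⟨by linarith, hx⟩, ?_⟩
      rw [hq.qCart_eq hb hbA ht hx] at hqR
      exact hqR.trans_lt (lt_add_one R)
    have h := H i p hmem
    push_cast at h
    have e : QuasilinearWave.farField g A ε δ q p = ε * N.far i p := N.farField_eq hbA i hq ht hx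
    simp only [N.pd_qCart hbA i hq ht hx, e]
    exact h

end
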